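/- Consider the $k$-Path detection problem: given an undirected graph $G$ on $n\ge 1$ vertices and an integer $k\ge 1$, decide whether $G$ contains a $k$-path, i.e. a simple path on exactly $k$ vertices. Suppose that $G$ is bipartite with a given partition $V=S\sqcup T$ of its vertices (every edge joins $S$ to $T$), that the partition is part of the input of the preprocessing, and that it remains a valid bipartition after the updates of any query. A *sensitivity oracle* for this problem consists of a preprocessing algorithm, which is given $n$, $k$, $G$ and $S$ and builds a data structure, and a query algorithm, which is given the data structure and a list of $\ell$ edge insertions and deletions and decides whether the graph obtained from the *original* graph $G$ by these updates contains a $k$-path; it does not change the data structure. Both run on a randomized word RAM with words of $w\ge c\,(k+\log_2 n+1)$ bits for a constant $c$ (the list of updates has fewer than $2^w$ entries), with unit cost for each word operation and each fair random bit. For every constant $\varepsilon>0$ there are a randomized sensitivity oracle, a polynomial $p$ and a constant $c$ (all depending only on $\varepsilon$) such that for all $n,k\ge 1$, all $w\ge c\,(k+\lfloor\log_2 n\rfloor+1)$, all $S$ and all such $G$: 1. the preprocessing time is at most $2^{k/2}\,p(k)\,n^3$, whatever the random bits are; 2. for every such list of $\ell\ge 0$ updates, fixed independently of the random bits, the query time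 is at most $\max\{\ell,1\}^3\,2^{k/2}\,p(k)$, whatever the random bits are, and the answer is wrong with probability at most $\varepsilon$. -/

import Mathlib

/-! ### Randomized word RAM

Programs are finite terms of a structured language over scalar registers and arrays.  Registers and
array cells hold `w`-bit words, every basic instruction takes one time unit, and an array is indexed
by a word.  An array `Arr.data j` belongs to the stored data structure, an array `Arr.work j` is
working storage. -/

namespace WordRAM

/-- Binary word operations; the result is taken modulo `2 ^ w`. -/
inductive Op
  | add | sub | mul | div | mod | and | or | xor | shl | shr | lt | eq

def Op.eval (w : ℕ) : Op → ℕ → ℕ → ℕ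
  | .add, a, b => (a + b) % 2 ^ w
  | .sub, a, b => (a + (2 ^ w - b % 2 ^ w)) % 2 ^ w
  | .mul, a, b => (a * b) % 2 ^ w
  | .div, a, b => (a / b) % 2 ^ w
  | .mod, a, b => (a % b) % 2 ^ w
  | .and, a, b => (a &&& b) % 2 ^ w
  | .or, a, b => (a ||| b) % 2 ^ w
  | .xor, a, b => (a ^^^ b) % 2 ^ w
  | .shl, a, b => (a <<< b) % 2 ^ w
  | .shr, a, b => (a >>> b) % 2 ^ w
  | .lt, a, b => (if a < b then 1 else 0) % 2 ^ w
  | .eq, a, b => (if a = b then 1 else 0) % 2 ^ w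

/-- Names of arrays. -/
inductive Arr
  | data (j : ℕ)
  | work (j : ℕ)
  deriving DecidableEq

/-- Programs.  Registers are named by natural numbers; a program mentions only finitely many
registers and arrays. -/
inductive Cmd
  /-- do nothing -/
  | skip
  /-- `r := c` -/
  | const (r c : ℕ)
  /-- `r := a o b` -/
  | op (o : Op) (r a b : ℕ)
  /-- `r := A[i]` -/
  | load (r : ℕ) (A : Arr) (i : ℕ)
  /-- `A[i] := r` -/
  | store (A : Arr) (i r : ℕ)
  /-- `r :=` a fresh fair random bit -/
  | flip (r : ℕ)
  | seq (p q : Cmd)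
  /-- if register `r` is nonzero then `p` else `q` -/
  | ite (r : ℕ) (p q : Cmd)
  /-- while register `r` is nonzero do `p` -/
  | while (r : ℕ) (p : Cmd)

/-- The program never writes to a data array. -/
def Cmd.DataReadOnly : Cmd → Prop
  | .store (.data _) _ _ => False
  | .seq p q => p.DataReadOnly ∧ q.DataReadOnly
  | .ite _ p q => p.DataReadOnly ∧ q.DataReadOnly
  | .while _ p => p.DataReadOnly
  | _ => True

/-- Machine states: registers, arrays, and the number of random bits used so far. -/
structure State where
  reg : ℕ → ℕ
  mem : Arr → ℕ → ℕ
  coins : ℕ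

def State.setReg (σ : State) (r x : ℕ) : State :=
  { σ with reg := Function.update σ.reg r x }

def State.setMem (σ : State) (A : Arr) (i x : ℕ) : State :=
  { σ with mem := Function.update σ.mem A (Function.update (σ.mem A) i x) }

/-- `Exec w ω p σ t τ`: with word length `w` and random bits `ω`, the program `p` started in the
state `σ` halts after exactly `t` time units in the state `τ`. -/
inductive Exec (w : ℕ) (ω : ℕ → Bool) : Cmd → State → ℕ → State → Prop
  | skip (σ) : Exec w ω .skip σ 1 σ
  | const (σ r c) : Exec w ω (.const r c) σ 1 (σ.setReg r (c % 2 ^ w))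
  | op (σ o r a b) : Exec w ω (.op o r a b) σ 1 (σ.setReg r (o.eval w (σ.reg a) (σ.reg b)))
  | load (σ r A i) : Exec w ω (.load r A i) σ 1 (σ.setReg r (σ.mem A (σ.reg i)))
  | store (σ A i r) : Exec w ω (.store A i r) σ 1 (σ.setMem A (σ.reg i) (σ.reg r))
  | flip (σ r) : Exec w ω (.flip r) σ 1
      { σ.setReg r ((if ω σ.coins then 1 else 0) % 2 ^ w) with coins := σ.coins + 1 }
  | seq {p q σ t ρ s τ} : Exec w ω p σ t ρ → Exec w ω q ρ s τ → Exec w ω (.seq p q) σ (t + s) τ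
  | ite_then {r p q σ t τ} : σ.reg r ≠ 0 → Exec w ω p σ t τ → Exec w ω (.ite r p q) σ (t + 1) τ
  | ite_else {r p q σ t τ} : σ.reg r = 0 → Exec w ω q σ t τ → Exec w ω (.ite r p q) σ (t + 1) τ
  | while_stop {r p σ} : σ.reg r = 0 → Exec w ω (.while r p) σ 1 σ
  | while_step {r p σ t ρ s τ} : σ.reg r ≠ 0 → Exec w ω p σ t ρ → Exec w ω (.while r p) ρ s τ →
      Exec w ω (.while r p) σ (t + s + 1) τ

/-- A program has at most one halting computation, so time and result are well defined. -/
theorem Exec.unique {w : ℕ} {ω : ℕ → Bool} {p : Cmd} {σ τ τ' : State} {t t' : ℕ}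
    (h : Exec w ω p σ t τ) (h' : Exec w ω p σ t' τ') : t = t' ∧ τ = τ' := by
  induction h generalizing t' τ' with
  | skip | const | op | load | store | flip => cases h'; exact ⟨rfl, rfl⟩
  | seq _ _ ih₁ ih₂ =>
    cases h' with
    | seq a b =>
      obtain ⟨rfl, rfl⟩ := ih₁ a
      obtain ⟨rfl, rfl⟩ := ih₂ b
      exact ⟨rfl, rfl⟩
  | ite_then hr _ ih | ite_else hr _ ih =>
    cases h' with
    | ite_then hr' a =>
      first
        | exact absurd hr hr'
        | (obtain ⟨rfl, rfl⟩ := ih a; exact ⟨rfl, rfl⟩)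
    | ite_else hr' a =>
      first
        | exact absurd hr' hr
        | (obtain ⟨rfl, rfl⟩ := ih a; exact ⟨rfl, rfl⟩)
  | while_stop hr =>
    cases h' with
    | while_stop => exact ⟨rfl, rfl⟩
    | while_step hr' => exact absurd hr hr'
  | while_step hr _ _ ih₁ ih₂ =>
    cases h' with
    | while_stop hr' => exact absurd hr' hr
    | while_step _ a b =>
      obtain ⟨rfl, rfl⟩ := ih₁ a
      obtain ⟨rfl, rfl⟩ := ih₂ b
      exact ⟨rfl, rfl⟩

/-- The distribution of an infinite sequence of independent fair random bits. -/
noncomputable def coinMeasure : MeasureTheory.Measure (ℕ → Bool) :=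
  MeasureTheory.Measure.infinitePi fun _ : ℕ => (PMF.uniformOfFintype Bool).toMeasure

end WordRAM

/-! ### The problem -/

/-- `G` contains a `k`-path: a path with exactly `k` vertices. -/
def HasKPath {V : Type*} (G : SimpleGraph V) (k : ℕ) : Prop :=
  ∃ (u v : V) (p : G.Walk u v), p.IsPath ∧ p.support.length = k

/-- Insertion (`insert = true`) or deletion (`insert = false`) of the edge `uv`. -/
structure EdgeUpdate (n : ℕ) where
  insert : Bool
  u : Fin n
  v : Fin n

def EdgeUpdate.apply {n : ℕ} (G : SimpleGraph (Fin n)) (e : EdgeUpdate n) : SimpleGraph (Fin n) :=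
  if e.insert then G ⊔ SimpleGraph.edge e.u e.v else G.deleteEdges {s(e.u, e.v)}

/-- The graph after the updates in the list have been carried out one after the other. -/
def applyUpdates {n : ℕ} (G : SimpleGraph (Fin n)) (L : List (EdgeUpdate n)) :
    SimpleGraph (Fin n) :=
  L.foldl EdgeUpdate.apply G

/-! ### Sensitivity oracles -/

open WordRAM

/-- A preprocessing program and a query program; the latter does not change the stored data
structure, so that every query refers to the original input. -/
structure SensitivityOracle where
  preprocess : Cmd
  query : Cmd
  query_readOnly : query.DataReadOnly

namespace SensitivityOracle

/-- Input of the preprocessing: `n` in register `0`, `k` in register `1`, the adjacency matrix of `G`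
in row-major order in `work 0`, the indicator of the side `S` of the bipartition in `work 1`;
everything else is zero. -/
noncomputable def inputState {n : ℕ} (k : ℕ) (G : SimpleGraph (Fin n)) (S : Finset (Fin n)) :
    State where
  reg r := if r = 0 then n else if r = 1 then k else 0
  mem
    | .work 0, i => open Classical in
        if ∃ u v : Fin n, G.Adj u v ∧ i = n * (u : ℕ) + (v : ℕ) then 1 else 0
    | .work 1, i => open Classical in if ∃ v ∈ S, i = (v : ℕ) then 1 else 0
    | _, _ => 0
  coins := 0

/-- Input of a query: the data arrays as left by the preprocessing (final state `σ`), the number of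
updates in register `0`, and for the `i`-th update its kind (`1` for insertion, `0` for deletion) and
its two endpoints in cell `i` of `work 0`, `work 1` and `work 2`; everything else is zero. Further
random bits are independent of those used by the preprocessing. -/
def queryState {n : ℕ} (σ : State) (L : List (EdgeUpdate n)) : State where
  reg r := if r = 0 then L.length else 0
  mem
    | .data j, i => σ.mem (.data j) i
    | .work 0, i => match L[i]? with
      | some e => if e.insert then 1 else 0
      | none => 0
    | .work 1, i => match L[i]? with
      | some e => (e.u : ℕ)
      | none => 0
    | .work 2, i => match L[i]? with
      | some e => (e.v : ℕ)
      | none => 0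
    | _, _ => 0
  coins := σ.coins

variable (O : SensitivityOracle) (w : ℕ) (ω : ℕ → Bool)

/-- Preprocessing of the instance halts within time `T`. -/
def PreprocessesWithin {n : ℕ} (k : ℕ) (G : SimpleGraph (Fin n)) (S : Finset (Fin n)) (T : ℝ) :
    Prop :=
  ∃ t σ, Exec w ω O.preprocess (inputState k G S) t σ ∧ (t : ℝ) ≤ T

/-- After preprocessing of the instance, the query with the updates `L` halts within time `T`. -/
def QueriesWithin {n : ℕ} (k : ℕ) (G : SimpleGraph (Fin n)) (S : Finset (Fin n))
    (L : List (EdgeUpdate n)) (T : ℝ) : Prop :=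
  ∃ t σ t' τ, Exec w ω O.preprocess (inputState k G S) t σ ∧
    Exec w ω O.query (queryState σ L) t' τ ∧ (t' : ℝ) ≤ T

/-- After preprocessing of the instance, the query with the updates `L` halts with the right answer
(nonzero for yes, zero for no) in register `0`. -/
def AnswersCorrectly {n : ℕ} (k : ℕ) (G : SimpleGraph (Fin n)) (S : Finset (Fin n))
    (L : List (EdgeUpdate n)) : Prop :=
  ∃ t σ t' τ, Exec w ω O.preprocess (inputState k G S) t σ ∧
    Exec w ω O.query (queryState σ L) t' τ ∧ (τ.reg 0 ≠ 0 ↔ HasKPath (applyUpdates G L) k)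

end SensitivityOracle

/-! Finding a `k`-path is reduced to testing whether a polynomial over a ring of characteristic two
is nonzero. A walk with `k` vertices, extended by a step from an artificial source and a step to an
artificial sink, gets the product of one variable for each step and, for each visit to the side `S`,
a linear form in label variables restricted to a set `X` of labels. There are `m = (k + 1) / 2`
labels; since the graph is bipartite, a walk with `k` vertices visits `S` at most `m` times, which
is why about `2 ^ (k / 2)` label sets suffice. `walkPoly` is the sum over all walks and all `X`.

In this sum everything but paths cancels (`exists_path_of_walkPoly_ne_zero`). If a labelled vertex
is repeated, two equal forms multiply to a square, which by Frobenius is again one linear form;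
fewer than `m` forms remain, every monomial misses some label, and toggling that label in `X` pairs
equal terms (`sum_prod_bitSum_eq_zero_of_eq`). If only unlabelled vertices are repeated, the closed
segment at the first repeated vertex is reversed. To prevent a segment `t, s, t` from being its own
reversal, every labelled vertex has two copies: steps at the first copy use the variable for the
direction of travel, steps at the second the variable for the opposite direction. Reversing and
exchanging copies preserves the weight and moves every such walk of nonzero weight
(`sum_noninjective_walks_eq_zero`). Conversely, for a path the variables can be chosen in `ZMod 2`
so that exactly one term survives (`walkPoly_pathVar`). Hence the polynomial is nonzero exactly if
there is a path.

The test evaluates the variables at random polynomials over `ZMod 2` with `q = k + E` coefficients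
instead of elements of a large finite field. By Schwartz–Zippel a nonzero polynomial of degree at
most `2 * k + 2` vanishes with probability at most `(2 * k + 2) / 2 ^ q`
(`coinMeasure_aeval_eq_zero_le`), the error is one-sided, and `D = (2 * k + 2) * q + 1` coefficients
determine the result.

For fixed `X` the sum over walks is an entry of the power `k + 1` of a matrix. The preprocessing
stores all entries of all powers up to `k + 1` for every `X`. Updates change the matrix `N` into `N'
= N + Δ`, where `Δ` is supported on the at most `2 * ℓ` touched vertices, and `N' ^ j` is the sum of
`N ^ j` and of `N' ^ i * Δ * N ^ (j - 1 - i)` over `i < j` (`powW_update`). Only the row of the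
source and the columns of the touched vertices and the sink are needed, so the recursion is cubic in
the number of updates and free of `n` (`reach_walkTable`).

The programs are built from expressions with exact natural number semantics; words are long enough
that the compiled code never overflows (`Expr.runs_compile`). Nearly all the work is filling tables
of truncated polynomials (`reach_polyTable`), assembled in `reach_preprocess` and `reach_query`.
Random bits are drawn only in the preprocessing, and all time bounds hold for every outcome. -/

/-! ### Expressions with exact arithmetic, and their compilation -/

namespace WordRAM

/-- The program `c`, started in `σ`, halts within `T` time units in a state satisfying `Q`. -/
def Runs (w : ℕ) (ω : ℕ → Bool) (c : Cmd) (σ : State) (T : ℕ) (Q : State → Prop) : Prop :=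
  ∃ t τ, Exec w ω c σ t τ ∧ t ≤ T ∧ Q τ

section Runs

variable {w : ℕ} {ω : ℕ → Bool}

theorem Runs.mono {c : Cmd} {σ : State} {T T' : ℕ} {Q Q' : State → Prop}
    (h : Runs w ω c σ T Q) (hT : T ≤ T') (hQ : ∀ τ, Q τ → Q' τ) : Runs w ω c σ T' Q' := by
  obtain ⟨t, τ, he, ht, hq⟩ := h
  exact ⟨t, τ, he, ht.trans hT, hQ τ hq⟩

theorem Runs.seq {p q : Cmd} {σ : State} {T₁ T₂ : ℕ} {P Q : State → Prop}
    (h₁ : Runs w ω p σ T₁ P) (h₂ : ∀ ρ, P ρ → Runs w ω q ρ T₂ Q) :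
    Runs w ω (.seq p q) σ (T₁ + T₂) Q := by
  obtain ⟨t, ρ, he, ht, hp⟩ := h₁
  obtain ⟨s, τ, he', hs, hq⟩ := h₂ ρ hp
  exact ⟨t + s, τ, .seq he he', by omega, hq⟩

theorem Runs.const {σ : State} {r c : ℕ} {Q : State → Prop} (h : Q (σ.setReg r (c % 2 ^ w))) :
    Runs w ω (.const r c) σ 1 Q := ⟨1, _, .const σ r c, le_rfl, h⟩

theorem Runs.op {σ : State} {o : Op} {r a b : ℕ} {Q : State → Prop}
    (h : Q (σ.setReg r (o.eval w (σ.reg a) (σ.reg b)))) :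
    Runs w ω (.op o r a b) σ 1 Q := ⟨1, _, .op σ o r a b, le_rfl, h⟩

theorem Runs.load {σ : State} {r i : ℕ} {A : Arr} {Q : State → Prop}
    (h : Q (σ.setReg r (σ.mem A (σ.reg i)))) :
    Runs w ω (.load r A i) σ 1 Q := ⟨1, _, .load σ r A i, le_rfl, h⟩

theorem Runs.store {σ : State} {r i : ℕ} {A : Arr} {Q : State → Prop}
    (h : Q (σ.setMem A (σ.reg i) (σ.reg r))) :
    Runs w ω (.store A i r) σ 1 Q := ⟨1, _, .store σ A i r, le_rfl, h⟩

theorem Runs.flip {σ : State} {r : ℕ} {Q : State → Prop}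
    (h : Q { σ.setReg r ((if ω σ.coins then 1 else 0) % 2 ^ w) with coins := σ.coins + 1 }) :
    Runs w ω (.flip r) σ 1 Q := ⟨1, _, .flip σ r, le_rfl, h⟩

/-- Induction on the number `j` of iterations still to come, while the index of the invariant counts
upwards; each iteration pays one extra unit for the test and the final failing test pays the last
one. -/
theorem Runs.while {s : ℕ} {p : Cmd} {T N : ℕ} (Inv : ℕ → State → Prop)
    (hstep : ∀ i < N, ∀ σ, Inv i σ → σ.reg s ≠ 0 ∧ Runs w ω p σ T (Inv (i + 1)))
    (hend : ∀ σ, Inv N σ → σ.reg s = 0) :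
    ∀ j ≤ N, ∀ σ, Inv (N - j) σ → Runs w ω (.while s p) σ (j * (T + 1) + 1) (Inv N) := by
  intro j
  induction j with
  | zero => intro _ σ h; exact ⟨1, σ, by constructor; exact hend σ h, by omega, h⟩
  | succ j ih =>
    intro hj σ h
    obtain ⟨hs, t, ρ, he, ht, hρ⟩ := hstep (N - (j + 1)) (by omega) σ h
    rw [show N - (j + 1) + 1 = N - j by omega] at hρ
    obtain ⟨t', τ, he', ht', hτ⟩ := ih (by omega) ρ hρ
    exact ⟨_, τ, .while_step hs he he', by linarith, hτ⟩

end Runs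

@[simp] theorem State.setReg_reg (σ : State) (r x : ℕ) :
    (σ.setReg r x).reg = Function.update σ.reg r x := rfl
@[simp] theorem State.setReg_mem (σ : State) (r x : ℕ) : (σ.setReg r x).mem = σ.mem := rfl
@[simp] theorem State.setReg_coins (σ : State) (r x : ℕ) : (σ.setReg r x).coins = σ.coins := rfl
@[simp] theorem State.setMem_reg (σ : State) (A : Arr) (i x : ℕ) :
    (σ.setMem A i x).reg = σ.reg := rfl
@[simp] theorem State.setMem_coins (σ : State) (A : Arr) (i x : ℕ) :
    (σ.setMem A i x).coins = σ.coins := rfl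

/-- `for r < N do body`, where `N` is the content of register `rb`; register `s` is scratch. -/
def forLoop (r rb s : ℕ) (body : Cmd) : Cmd :=
  .seq (.const r 0) (.seq (.op .lt s r rb) (.while s
    (.seq body (.seq (.const s 1) (.seq (.op .add r r s) (.op .lt s r rb))))))

theorem Op.eval_lt_of_one_le {w : ℕ} (hw : 1 ≤ w) (a b : ℕ) :
    Op.eval w .lt a b = if a < b then 1 else 0 := by
  have h : 1 < 2 ^ w := Nat.one_lt_two_pow (by omega)
  change (if a < b then 1 else 0) % 2 ^ w = _
  split_ifs <;> [exact Nat.mod_eq_of_lt h; exact Nat.zero_mod _]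

/-- The loop itself overwrites the counter and the flag, so the invariant has to ignore both
registers; the counter is tracked separately. The bound `N < 2 ^ w` keeps the increment from
wrapping around. -/
theorem Runs.forLoop {w : ℕ} {ω : ℕ → Bool} (hw : 1 ≤ w) {r rb s : ℕ} {body : Cmd} {σ : State}
    {N T : ℕ} (h₁ : r ≠ rb) (h₂ : r ≠ s) (h₃ : s ≠ rb) (hN : σ.reg rb = N) (hNw : N < 2 ^ w)
    (Inv : ℕ → State → Prop)
    (hr : ∀ i ρ x, Inv i ρ → Inv i (ρ.setReg r x)) (hs : ∀ i ρ x, Inv i ρ → Inv i (ρ.setReg s x))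
    (h0 : Inv 0 σ)
    (hbody : ∀ i < N, ∀ ρ, Inv i ρ → ρ.reg r = i → ρ.reg rb = N →
      Runs w ω body ρ T (fun τ => Inv (i + 1) τ ∧ τ.reg r = i ∧ τ.reg rb = N)) :
    Runs w ω (forLoop r rb s body) σ (N * (T + 4) + 3)
      (fun τ => Inv N τ ∧ τ.reg r = N ∧ τ.reg rb = N) := by
  have h1w : 1 < 2 ^ w := Nat.one_lt_two_pow (by omega)
  let J : ℕ → State → Prop := fun i ρ => Inv i ρ ∧ ρ.reg r = i ∧ ρ.reg rb = N ∧
    ρ.reg s = if i < N then 1 else 0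
  have key := Runs.while (w := w) (ω := ω) (s := s) (T := T + 3) (N := N)
    (p := .seq body (.seq (.const s 1) (.seq (.op .add r r s) (.op .lt s r rb)))) J
    (by
      rintro i hi ρ ⟨hI, hri, hrb, hss⟩
      refine ⟨by simp [hss, hi], ?_⟩
      refine ((hbody i hi ρ hI hri hrb).seq (T₂ := 3) ?_)
      rintro τ ⟨hI', hr', hrb'⟩
      refine Runs.seq (T₁ := 1) (T₂ := 2) (P := fun τ' => τ' = τ.setReg s (1 % 2 ^ w))
        (Runs.const rfl) ?_
      rintro _ rfl
      refine Runs.seq (T₁ := 1) (T₂ := 1) (P := fun τ' => τ' = (τ.setReg s (1 % 2 ^ w)).setReg r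
        (i + 1)) (Runs.op ?_) ?_
      · congr 1
        simp only [State.setReg_reg, Function.update_self, Function.update_of_ne h₂, hr', Op.eval]
        rw [Nat.mod_eq_of_lt h1w, Nat.mod_eq_of_lt (by omega)]
      rintro _ rfl
      refine Runs.op ⟨hs _ _ _ (hr _ _ _ (hs _ _ _ hI')), ?_, ?_, ?_⟩
      · simp [Function.update_of_ne h₂]
      · simp [Function.update_of_ne h₁.symm, Function.update_of_ne h₃.symm, hrb']
      · simp only [State.setReg_reg, Function.update_self]
        rw [Op.eval_lt_of_one_le hw, Function.update_of_ne h₁.symm, Function.update_of_ne h₃.symm,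
          hrb'])
    (by rintro ρ ⟨-, -, -, h⟩; simpa using h)
  refine (Runs.seq (T₁ := 1) (T₂ := 1 + (N * (T + 3 + 1) + 1))
    (P := fun τ' => τ' = σ.setReg r (0 % 2 ^ w)) (Runs.const rfl) ?_).mono (by linarith)
    (fun _ h => h)
  rintro _ rfl
  refine Runs.seq (P := J 0) (Runs.op ⟨hs _ _ _ (hr _ _ _ h0), ?_, ?_, ?_⟩) ?_
  · simp [Function.update_of_ne h₂]
  · simp [Function.update_of_ne h₁.symm, Function.update_of_ne h₃.symm, hN]
  · simp only [State.setReg_reg, Function.update_self]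
    rw [Op.eval_lt_of_one_le hw, Function.update_of_ne h₁.symm, hN, Nat.zero_mod]
  intro ρ hρ
  refine (key N le_rfl ρ (by simpa using hρ)).mono le_rfl ?_
  rintro τ ⟨a, b, c, -⟩
  exact ⟨a, b, c⟩

/-- Expressions over registers and arrays. `xsum r rb e` is the bitwise sum of the values of `e`
over all `r < N`, where `N` is the content of register `rb`. -/
inductive Expr
  | const (c : ℕ)
  | var (r : ℕ)
  | op (o : Op) (a b : Expr)
  | load (A : Arr) (e : Expr)
  | xsum (r rb : ℕ) (e : Expr)

/-- The operations with their exact values in `ℕ`; subtraction is truncated. -/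
def Op.exact : Op → ℕ → ℕ → ℕ
  | .add, a, b => a + b
  | .sub, a, b => a - b
  | .mul, a, b => a * b
  | .div, a, b => a / b
  | .mod, a, b => a % b
  | .and, a, b => a &&& b
  | .or, a, b => a ||| b
  | .xor, a, b => a ^^^ b
  | .shl, a, b => a <<< b
  | .shr, a, b => a >>> b
  | .lt, a, b => if a < b then 1 else 0
  | .eq, a, b => if a = b then 1 else 0

/-- The bit length of a left shift is not bounded by the lengths of the operands, so shifts are
barred from expressions. The one power of two that is needed comes from a raw instruction in
`setup`. -/
def Op.isShl : Op → Bool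
  | .shl => true
  | _ => false

/-- Bitwise sum of `f 0, …, f (n - 1)`. -/
def xorSum (f : ℕ → ℕ) : ℕ → ℕ
  | 0 => 0
  | n + 1 => xorSum f n ^^^ f n

namespace Expr

instance : Add Expr := ⟨op .add⟩
instance : Sub Expr := ⟨op .sub⟩
instance : Mul Expr := ⟨op .mul⟩
instance : Div Expr := ⟨op .div⟩
instance : Mod Expr := ⟨op .mod⟩
instance : XorOp Expr := ⟨op .xor⟩
instance : AndOp Expr := ⟨op .and⟩
instance (n : ℕ) : OfNat Expr n := ⟨const n⟩

def eval (mem : Arr → ℕ → ℕ) : Expr → (ℕ → ℕ) → ℕ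
  | const c, _ => c
  | var r, reg => reg r
  | op o a b, reg => o.exact (a.eval mem reg) (b.eval mem reg)
  | load A e, reg => mem A (e.eval mem reg)
  | xsum r rb e, reg => xorSum (fun i => e.eval mem (Function.update reg r i)) (reg rb)

/-- The value has at most `β * size` bits if registers and memory cells have at most `β` bits. -/
def size : Expr → ℕ
  | const c => c + 1
  | var _ => 1
  | op _ a b => a.size + b.size + 1
  | load _ e => e.size + 1
  | xsum _ _ e => e.size + 1

/-- Upper bound for the running time. -/
def cost (reg : ℕ → ℕ) : Expr → ℕ
  | const _ => 1
  | var _ => 1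
  | op _ a b => a.cost reg + b.cost reg + 3
  | load _ e => e.cost reg + 1
  | xsum _ rb e => reg rb * (e.cost reg + 5) + 4

/-- Code that writes the value into register `t`, using the registers from `t` on. -/
def compile : ℕ → Expr → Cmd
  | t, const c => .const t c
  -- Conjunction of a word with itself serves as a register copy.
  | t, var r => .op .and t r r
  -- Machine subtraction wraps around; multiplying by the test `b < a` turns it into truncated
  -- subtraction.
  | t, op .sub a b => .seq (compile t a) (.seq (compile (t + 1) b)
      (.seq (.op .lt (t + 2) (t + 1) t) (.seq (.op .sub t t (t + 1)) (.op .mul t t (t + 2)))))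
  | t, op o a b => .seq (compile t a) (.seq (compile (t + 1) b) (.op o t t (t + 1)))
  | t, load A e => .seq (compile t e) (.load t A t)
  | t, xsum r rb e => .seq (.const t 0) (forLoop r rb (t + 1)
      (.seq (compile (r + 1) e) (.op .xor t t (r + 1))))

/-- Well-formedness at level `t`: registers below `g` are global, those in `Γ` are the bound
variables in scope. -/
def wf (g : ℕ) : List ℕ → ℕ → Expr → Bool
  | _, _, const _ => true
  | Γ, _, var r => decide (r < g) || Γ.contains r
  | Γ, t, op o a b => !o.isShl && (wf g Γ t a && wf g Γ (t + 1) b)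
  | Γ, t, load _ e => wf g Γ t e
  -- Register `t` holds the partial sum and `t + 1` the loop flag, so a bound variable needs an
  -- index of at least `t + 2`. The bound is a global register, which the body leaves alone.
  | Γ, t, xsum r rb e => decide (rb < g) && (decide (t + 2 ≤ r) && wf g (r :: Γ) (r + 1) e)

theorem size_pos (e : Expr) : 1 ≤ e.size := by cases e <;> simp [size]

theorem eval_congr {g : ℕ} {mem : Arr → ℕ → ℕ} (e : Expr) : ∀ {Γ : List ℕ} {t : ℕ}
    {reg reg' : ℕ → ℕ}, wf g Γ t e → (∀ r, r < g ∨ r ∈ Γ → reg r = reg' r) →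
    e.eval mem reg = e.eval mem reg' := by
  induction e with
  | const c => intros; rfl
  | var r => intro Γ t reg reg' h hr; simp [wf] at h; exact hr r h
  | op o a b iha ihb =>
    intro Γ t reg reg' h hr
    simp only [wf, Bool.and_eq_true] at h
    simp only [eval, iha h.2.1 hr, ihb h.2.2 hr]
  | load A e ih => intro Γ t reg reg' h hr; simp only [eval, ih (t := t) h hr]
  | xsum r rb e ih =>
    intro Γ t reg reg' h hr
    simp only [wf, Bool.and_eq_true, decide_eq_true_eq] at h
    simp only [eval, hr rb (.inl h.1)]
    congr 1
    funext i
    refine ih h.2.2 ?_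
    intro r' hr'
    by_cases hrr : r' = r
    · subst hrr; simp
    · rw [Function.update_of_ne hrr, Function.update_of_ne hrr]
      refine hr r' ?_
      rcases hr' with h | h
      · exact .inl h
      · exact .inr ((List.mem_cons.1 h).resolve_left hrr)

theorem cost_congr {g : ℕ} (e : Expr) : ∀ {Γ : List ℕ} {t : ℕ} {reg reg' : ℕ → ℕ}, wf g Γ t e →
    (∀ r < g, reg r = reg' r) → e.cost reg = e.cost reg' := by
  induction e with
  | const c => intros; rfl
  | var r => intros; rfl
  | op o a b iha ihb =>
    intro Γ t reg reg' h hr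
    simp only [wf, Bool.and_eq_true] at h
    simp only [cost, iha h.2.1 hr, ihb h.2.2 hr]
  | load A e ih => intro Γ t reg reg' h hr; simp only [cost, ih (t := t) h hr]
  | xsum r rb e ih =>
    intro Γ t reg reg' h hr
    simp only [wf, Bool.and_eq_true, decide_eq_true_eq] at h
    simp only [cost, ih h.2.2 hr, hr rb h.1]

end Expr

theorem xorSum_lt {f : ℕ → ℕ} {n s : ℕ} (h : ∀ i < n, f i < 2 ^ s) : xorSum f n < 2 ^ s := by
  induction n with
  | zero => exact Nat.two_pow_pos s
  | succ n ih => exact Nat.xor_lt_two_pow (ih fun i hi => h i (by omega)) (h n (by omega))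

/-- Multiplication is the extreme case: there bit lengths add, and every other admitted operation
stays below the same bound. -/
theorem Op.exact_lt {o : Op} {a b β s t : ℕ} (hβ : 1 ≤ β) (ho : o.isShl = false) (hs : 1 ≤ s)
    (ht : 1 ≤ t) (ha : a < 2 ^ (β * s)) (hb : b < 2 ^ (β * t)) :
    o.exact a b < 2 ^ (β * (s + t + 1)) := by
  have e1 : 2 ^ (β * (s + t + 1)) = 2 ^ (β * s) * 2 ^ (β * t) * 2 ^ β := by
    rw [← pow_add, ← pow_add]; ring_nf
  have e2 : 2 ≤ 2 ^ β := by simpa using Nat.pow_le_pow_right (n := 2) (by norm_num) hβ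
  have e3 : 2 ≤ 2 ^ (β * s) := by
    simpa using Nat.pow_le_pow_right (n := 2) (by norm_num) (Nat.mul_pos hβ hs)
  have e4 : 2 ≤ 2 ^ (β * t) := by
    simpa using Nat.pow_le_pow_right (n := 2) (by norm_num) (Nat.mul_pos hβ ht)
  have la : 2 ^ (β * s) ≤ 2 ^ (β * (s + t + 1)) :=
    Nat.pow_le_pow_right (by norm_num) (Nat.mul_le_mul_left _ (by omega))
  have lb : 2 ^ (β * t) ≤ 2 ^ (β * (s + t + 1)) :=
    Nat.pow_le_pow_right (by norm_num) (Nat.mul_le_mul_left _ (by omega))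
  have l1 : 1 < 2 ^ (β * (s + t + 1)) := by omega
  cases o with
  | add =>
    rw [e1]
    have h1 : 2 ^ (β * s) + 2 ^ (β * t) ≤ 2 ^ (β * s) * 2 ^ (β * t) := by
      obtain ⟨x, hx⟩ := Nat.exists_eq_add_of_le e3
      obtain ⟨y, hy⟩ := Nat.exists_eq_add_of_le e4
      rw [hx, hy]; nlinarith
    exact (Nat.add_lt_add ha hb).trans_le (h1.trans (Nat.le_mul_of_pos_right _ (by omega)))
  | sub => simp only [Op.exact]; omega
  | mul => rw [e1]; exact (Nat.mul_lt_mul'' ha hb).trans_le (Nat.le_mul_of_pos_right _ (by omega))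
  | div => exact (Nat.div_le_self a b).trans_lt (ha.trans_le la)
  | mod => exact (Nat.mod_le a b).trans_lt (ha.trans_le la)
  | and => exact Nat.and_le_left.trans_lt (ha.trans_le la)
  | or => exact Nat.or_lt_two_pow (ha.trans_le la) (hb.trans_le lb)
  | xor => exact Nat.xor_lt_two_pow (ha.trans_le la) (hb.trans_le lb)
  | shl => simp [Op.isShl] at ho
  | shr => exact (Nat.shiftRight_le a b).trans_lt (ha.trans_le la)
  | lt => simp only [Op.exact]; split_ifs <;> omega
  | eq => simp only [Op.exact]; split_ifs <;> omega

namespace Expr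

theorem eval_lt {g β : ℕ} (hβ : 1 ≤ β) {mem : Arr → ℕ → ℕ} (hmem : ∀ A i, mem A i < 2 ^ β)
    (e : Expr) : ∀ {Γ : List ℕ} {t : ℕ} {reg : ℕ → ℕ}, wf g Γ t e →
    (∀ r, r < g ∨ r ∈ Γ → reg r < 2 ^ β) → e.eval mem reg < 2 ^ (β * e.size) := by
  induction e with
  | const c =>
    intros
    refine Nat.lt_two_pow_self.trans_le (Nat.pow_le_pow_right (by norm_num) ?_)
    simp only [eval, size]; nlinarith
  | var r => intro Γ t reg h hr; simp [wf] at h; simpa [eval, size] using hr r h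
  | op o a b iha ihb =>
    intro Γ t reg h hr
    simp only [wf, Bool.and_eq_true, Bool.not_eq_true'] at h
    exact Op.exact_lt hβ h.1 a.size_pos b.size_pos (iha h.2.1 hr) (ihb h.2.2 hr)
  | load A e ih =>
    intro Γ t reg h hr
    refine (hmem A _).trans_le (Nat.pow_le_pow_right (by norm_num) ?_)
    simp only [size]; nlinarith
  | xsum r rb e ih =>
    intro Γ t reg h hr
    simp only [wf, Bool.and_eq_true, decide_eq_true_eq] at h
    refine xorSum_lt fun i hi => (ih h.2.2 ?_).trans_le
      (Nat.pow_le_pow_right (by norm_num) (Nat.mul_le_mul_left _ (by simp [size])))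
    intro r' hr'
    by_cases hrr : r' = r
    · subst hrr; simpa using hi.trans (hr rb (.inl h.1))
    · rw [Function.update_of_ne hrr]
      refine hr r' ?_
      rcases hr' with h | h
      · exact .inl h
      · exact .inr ((List.mem_cons.1 h).resolve_left hrr)

end Expr

theorem Op.eval_of_exact_lt {w : ℕ} {o : Op} {a b : ℕ} (ho : o ≠ .sub) (h : o.exact a b < 2 ^ w) :
    o.eval w a b = o.exact a b := by
  cases o <;> first | exact absurd rfl ho | exact Nat.mod_eq_of_lt h

theorem Expr.compile_op {o : Op} (ho : o ≠ .sub) (t : ℕ) (a b : Expr) :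
    compile t (op o a b) = .seq (compile t a) (.seq (compile (t + 1) b) (.op o t t (t + 1))) := by
  cases o <;> first | exact absurd rfl ho | rfl

/-- No intermediate value reaches `2 ^ w` by `eval_lt`, so machine arithmetic agrees with exact
arithmetic. The frame condition on registers below `t` drives the induction: it preserves the left
operand while the right one is computed, and the bound variables of enclosing sums. -/
theorem Expr.runs_compile {w : ℕ} {ω : ℕ → Bool} {g β : ℕ} (hβ : 1 ≤ β) (e : Expr) :
    ∀ {Γ : List ℕ} {t : ℕ} {σ : State}, g ≤ t → (∀ r ∈ Γ, r < t) → wf g Γ t e →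
    (∀ r, r < g ∨ r ∈ Γ → σ.reg r < 2 ^ β) → (∀ A i, σ.mem A i < 2 ^ β) → β * e.size ≤ w →
    Runs w ω (e.compile t) σ (e.cost σ.reg) (fun τ => τ.reg t = e.eval σ.mem σ.reg ∧
      (∀ r < t, τ.reg r = σ.reg r) ∧ τ.mem = σ.mem ∧ τ.coins = σ.coins) := by
  induction e with
  | const c =>
    intro Γ t σ hg hΓ hwf hreg hmem hw
    have h := eval_lt hβ hmem (const c) hwf hreg
    refine Runs.const ⟨?_, fun r hr => ?_, rfl, rfl⟩
    · simpa [eval] using Nat.mod_eq_of_lt (h.trans_le (Nat.pow_le_pow_right (by norm_num) hw))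
    · simp [Function.update_of_ne hr.ne]
  | var r =>
    intro Γ t σ hg hΓ hwf hreg hmem hw
    have h := eval_lt hβ hmem (var r) hwf hreg
    refine Runs.op ⟨?_, fun r hr => ?_, rfl, rfl⟩
    · simpa [eval, Op.eval] using Nat.mod_eq_of_lt (h.trans_le (Nat.pow_le_pow_right (by norm_num) hw))
    · simp [Function.update_of_ne hr.ne]
  | op o a b iha ihb =>
    intro Γ t σ hg hΓ hwf hreg hmem hw
    have hlt := eval_lt hβ hmem (op o a b) hwf hreg
    have hwf' := hwf
    simp only [wf, Bool.and_eq_true, Bool.not_eq_true'] at hwf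
    have hpw : 2 ^ (β * (op o a b).size) ≤ 2 ^ w := Nat.pow_le_pow_right (by norm_num) hw
    have hsa : β * a.size ≤ w := (Nat.mul_le_mul_left _ (by simp [size]; omega)).trans hw
    have hsb : β * b.size ≤ w := (Nat.mul_le_mul_left _ (by simp [size]; omega)).trans hw
    have hsc : ∀ r, r < g ∨ r ∈ Γ → r < t := fun r hr => hr.elim (fun h => h.trans_le hg) (hΓ r)
    have hA := iha (t := t) hg hΓ hwf.2.1 hreg hmem hsa
    -- The common prefix of all binary operations: both operands are computed, and only the closing
    -- instructions `q` differ.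
    have hAB : ∀ {q T Q}, (∀ ρ, ρ.reg t = a.eval σ.mem σ.reg → ρ.reg (t + 1) = b.eval σ.mem σ.reg →
        (∀ r < t, ρ.reg r = σ.reg r) → ρ.mem = σ.mem → ρ.coins = σ.coins → Runs w ω q ρ T Q) →
        Runs w ω (.seq (compile t a) (.seq (compile (t + 1) b) q)) σ
          (a.cost σ.reg + (b.cost σ.reg + T)) Q := by
      intro q T Q hq
      refine hA.seq ?_
      rintro ρ ⟨h1, h2, h3, h4⟩
      have hagree : ∀ r, r < g ∨ r ∈ Γ → ρ.reg r = σ.reg r := fun r hr => h2 r (hsc r hr)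
      have hB := ihb (t := t + 1) (σ := ρ) (by omega) (fun r hr => (hΓ r hr).trans (by omega))
        hwf.2.2 (fun r hr => by rw [hagree r hr]; exact hreg r hr) (by rw [h3]; exact hmem) hsb
      rw [h3, eval_congr b hwf.2.2 hagree, cost_congr b hwf.2.2 (fun r hr => hagree r (.inl hr))] at hB
      refine hB.seq ?_
      rintro τ ⟨k1, k2, k3, k4⟩
      exact hq τ (by rw [k2 t (by omega), h1]) k1 (fun r hr => by rw [k2 r (by omega), h2 r hr])
        k3 (k4.trans h4)
    by_cases ho : o = .sub
    · subst ho
      have ha := (eval_lt hβ hmem a hwf.2.1 hreg).trans_le (Nat.pow_le_pow_right (by norm_num) hsa)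
      have hb := (eval_lt hβ hmem b hwf.2.2 hreg).trans_le (Nat.pow_le_pow_right (by norm_num) hsb)
      have hw1 : 1 ≤ w := le_trans (Nat.mul_pos hβ a.size_pos) hsa
      refine (hAB (T := 3) ?_).mono (by simp only [cost]; omega) (fun _ h => h)
      intro ρ h1 h2 h3 h4 h5
      refine Runs.seq (T₁ := 1) (T₂ := 2) (P := fun τ => τ = ρ.setReg (t + 2) _) (Runs.op rfl) ?_
      rintro _ rfl
      refine Runs.seq (T₁ := 1) (T₂ := 1) (P := fun τ => τ = State.setReg _ t _) (Runs.op rfl) ?_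
      rintro _ rfl
      refine Runs.op ⟨?_, fun r hr => ?_, h4, h5⟩
      · simp only [State.setReg_reg, Function.update_self]
        rw [Function.update_of_ne (show t + 2 ≠ t by omega), Function.update_self,
          Function.update_of_ne (show t + 1 ≠ t + 2 by omega),
          Function.update_of_ne (show t ≠ t + 2 by omega), h1, h2, Op.eval_lt_of_one_le hw1]
        simp only [Op.eval, eval, Op.exact, Nat.mod_eq_of_lt hb]
        split_ifs with hlt
        · rw [mul_one, Nat.mod_mod, show a.eval σ.mem σ.reg + (2 ^ w - b.eval σ.mem σ.reg) =
            (a.eval σ.mem σ.reg - b.eval σ.mem σ.reg) + 2 ^ w by omega, Nat.add_mod_right,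
            Nat.mod_eq_of_lt (by omega)]
        · rw [mul_zero, Nat.zero_mod]; omega
      · simp only [State.setReg_reg]
        rw [Function.update_of_ne (by omega), Function.update_of_ne (by omega),
          Function.update_of_ne (by omega), h3 r hr]
    · rw [compile_op ho]
      refine (hAB (T := 1) ?_).mono (by simp only [cost]; omega) (fun _ h => h)
      intro ρ h1 h2 h3 h4 h5
      refine Runs.op ⟨?_, fun r hr => ?_, h4, h5⟩
      · simp only [State.setReg_reg, Function.update_self, h1, h2]
        exact Op.eval_of_exact_lt ho (hlt.trans_le hpw)
      · simp [Function.update_of_ne hr.ne, h3 r hr]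
  | load A e ih =>
    intro Γ t σ hg hΓ hwf hreg hmem hw
    refine (ih hg hΓ hwf hreg hmem ((Nat.mul_le_mul_left _ (by simp [size])).trans hw)).seq ?_
    rintro ρ ⟨h1, h2, h3, h4⟩
    refine Runs.load ⟨?_, fun r hr => ?_, h3, h4⟩
    · simp [h1, h3, eval]
    · simp [Function.update_of_ne hr.ne, h2 r hr]
  | xsum r rb e ih =>
    intro Γ t σ hg hΓ hwf hreg hmem hw
    have hwf' := hwf
    simp only [wf, Bool.and_eq_true, decide_eq_true_eq] at hwf
    obtain ⟨hrb, hrt, hwe⟩ := hwf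
    have hse : β * e.size ≤ w := (Nat.mul_le_mul_left _ (by simp [size])).trans hw
    have hw1 : 1 ≤ w := le_trans (Nat.mul_pos hβ e.size_pos) hse
    have hβw : β ≤ w := le_trans (Nat.le_mul_of_pos_right β e.size_pos) hse
    have hsc : ∀ r, r < g ∨ r ∈ Γ → r < t := fun r hr => hr.elim (fun h => h.trans_le hg) (hΓ r)
    let f : ℕ → ℕ := fun i => e.eval σ.mem (Function.update σ.reg r i)
    have hregU : ∀ i < σ.reg rb, ∀ r', r' < g ∨ r' ∈ r :: Γ →
        Function.update σ.reg r i r' < 2 ^ β := by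
      intro i hi r' hr'
      by_cases hrr : r' = r
      · subst hrr; simpa using hi.trans (hreg rb (.inl hrb))
      · rw [Function.update_of_ne hrr]
        exact hreg r' (hr'.imp_right fun h => (List.mem_cons.1 h).resolve_left hrr)
    have hf : ∀ i < σ.reg rb, f i < 2 ^ w := fun i hi =>
      (eval_lt hβ hmem e hwe (hregU i hi)).trans_le (Nat.pow_le_pow_right (by norm_num) hse)
    let Inv : ℕ → State → Prop := fun i ρ => ρ.reg t = xorSum f i ∧
      (∀ r' < t, ρ.reg r' = σ.reg r') ∧ ρ.mem = σ.mem ∧ ρ.coins = σ.coins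
    have hstab : ∀ x, t < x → ∀ i ρ y, Inv i ρ → Inv i (ρ.setReg x y) := by
      rintro x hx i ρ y ⟨h1, h2, h3, h4⟩
      refine ⟨?_, fun r' hr' => ?_, h3, h4⟩
      · simpa [Function.update_of_ne hx.ne] using h1
      · simpa [Function.update_of_ne (hr'.trans hx).ne] using h2 r' hr'
    refine (Runs.seq (T₁ := 1) (T₂ := σ.reg rb * (e.cost σ.reg + 1 + 4) + 3)
      (P := fun τ => τ = σ.setReg t (0 % 2 ^ w)) (Runs.const rfl) ?_).mono
      (by simp only [cost]; linarith) (fun _ h => h)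
    rintro _ rfl
    refine (Runs.forLoop (T := e.cost σ.reg + 1) hw1 (by omega) (by omega) (by omega) ?_
      ((hreg rb (.inl hrb)).trans_le (Nat.pow_le_pow_right (by norm_num) hβw)) Inv
      (hstab r (by omega)) (hstab (t + 1) (by omega)) ?_ ?_).mono le_rfl (fun τ h => h.1)
    · simp [Function.update_of_ne (show rb ≠ t by omega)]
    · refine ⟨by simp [xorSum], fun r' hr' => ?_, rfl, rfl⟩
      simp [Function.update_of_ne hr'.ne]
    rintro i hi ρ ⟨h1, h2, h3, h4⟩ hri hrbi
    have hagree : ∀ r', r' < g ∨ r' ∈ r :: Γ → ρ.reg r' = Function.update σ.reg r i r' := by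
      intro r' hr'
      by_cases hrr : r' = r
      · subst hrr; simpa using hri
      · rw [Function.update_of_ne hrr]
        exact h2 r' (hsc r' (hr'.imp_right fun h => (List.mem_cons.1 h).resolve_left hrr))
    have hE := ih (Γ := r :: Γ) (t := r + 1) (σ := ρ) (by omega)
      (fun r' hr' => by
        rcases List.mem_cons.1 hr' with h | h
        · omega
        · have := hΓ r' h; omega) hwe
      (fun r' hr' => by rw [hagree r' hr']; exact hregU i hi r' hr') (by rw [h3]; exact hmem) hse
    rw [h3, eval_congr e hwe hagree, cost_congr e hwe (reg' := σ.reg)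
      (fun r' hr' => h2 r' (by omega))] at hE
    refine hE.seq ?_
    rintro τ ⟨k1, k2, k3, k4⟩
    have hτt : τ.reg t = xorSum f i := by rw [k2 t (by omega), h1]
    refine Runs.op ⟨⟨?_, fun r' hr' => ?_, k3, k4.trans h4⟩, ?_, ?_⟩
    · simp only [State.setReg_reg, Function.update_self, hτt, k1]
      exact Nat.mod_eq_of_lt (Nat.xor_lt_two_pow (xorSum_lt fun j hj => hf j (by omega)) (hf i hi))
    · simp [Function.update_of_ne hr'.ne, k2 r' (by omega), h2 r' hr']
    · simp [Function.update_of_ne (show r ≠ t by omega), k2 r (by omega), hri]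
    · simp [Function.update_of_ne (show rb ≠ t by omega), k2 rb (by omega), hrbi]

/-! ### Programs on abstract states -/

/- Registers below `glob` may occur in expressions; registers below `vis` are visible, all others
are scratch. -/
notation "glob" => (32 : ℕ)

notation "vis" => (40 : ℕ)

/-- The states agree up to scratch registers. -/
def Sim (σ τ : State) : Prop :=
  (∀ r < vis, σ.reg r = τ.reg r) ∧ σ.mem = τ.mem ∧ σ.coins = τ.coins

/-- Up to scratch registers, `c` leads from `σ` to `σ'` within `T` time units. -/
def Reach (w : ℕ) (ω : ℕ → Bool) (c : Cmd) (σ : State) (T : ℕ) (σ' : State) : Prop :=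
  ∀ ρ, Sim ρ σ → Runs w ω c ρ T (fun τ => Sim τ σ')

/-- Only registers below `glob` are bounded. The number of updates and the index of the current one
may come close to `2 ^ w`; they live between `glob` and `vis`, where no well-formed expression can
refer to them. -/
structure Bounded (β : ℕ) (σ : State) : Prop where
  reg : ∀ r < glob, σ.reg r < 2 ^ β
  mem : ∀ A i, σ.mem A i < 2 ^ β

/-- `r := e` -/
def assign (r : ℕ) (e : Expr) : Cmd := .seq (e.compile vis) (.op .and r vis vis)

/-- `A[a] := e` -/
def put (A : Arr) (a e : Expr) : Cmd :=
  .seq (a.compile vis) (.seq (e.compile (vis + 1)) (.store A vis (vis + 1)))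

/-- `A[r] := e` for all `r` less than the content of register `rb` -/
def fill (A : Arr) (r rb : ℕ) (e : Expr) : Cmd := forLoop r rb vis (put A (.var r) e)

/-- `A[r] :=` a random bit masked by `e`, for all `r` less than the content of register `rb` -/
def fillRandom (A : Arr) (r rb : ℕ) (e : Expr) : Cmd :=
  forLoop r rb vis (.seq (.flip vis) (.seq (e.compile (vis + 1))
    (.seq (.op .and (vis + 1) vis (vis + 1)) (.seq (.op .and vis r r)
      (.store A vis (vis + 1))))))

def State.fillMem (σ : State) (A : Arr) (val : ℕ → ℕ) (N : ℕ) : State :=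
  { σ with mem := Function.update σ.mem A fun i => if i < N then val i else σ.mem A i }

@[simp] theorem State.fillMem_reg (σ : State) (A : Arr) (val : ℕ → ℕ) (N : ℕ) :
    (σ.fillMem A val N).reg = σ.reg := rfl
@[simp] theorem State.fillMem_coins (σ : State) (A : Arr) (val : ℕ → ℕ) (N : ℕ) :
    (σ.fillMem A val N).coins = σ.coins := rfl

theorem Sim.refl (σ : State) : Sim σ σ := ⟨fun _ _ => rfl, rfl, rfl⟩

theorem State.fillMem_zero (σ : State) (A : Arr) (val : ℕ → ℕ) : σ.fillMem A val 0 = σ := by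
  simp [State.fillMem]

theorem State.setMem_fillMem (σ : State) (A : Arr) (val : ℕ → ℕ) (t : ℕ) :
    (σ.fillMem A val t).setMem A t (val t) = σ.fillMem A val (t + 1) := by
  simp only [State.fillMem, State.setMem, Function.update_self, Function.update_idem]
  congr 2
  funext i
  rcases eq_or_ne i t with rfl | h
  · simp
  · simp only [Function.update_of_ne h]
    congr 1
    simp only [eq_iff_iff]; omega

section Reach

variable {w : ℕ} {ω : ℕ → Bool} {β : ℕ}

theorem Reach.mono {c : Cmd} {σ σ' : State} {T T' : ℕ} (h : Reach w ω c σ T σ') (hT : T ≤ T') :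
    Reach w ω c σ T' σ' := fun ρ hρ => (h ρ hρ).mono hT fun _ h => h

theorem Reach.seq {p q : Cmd} {σ σ' σ'' : State} {T₁ T₂ : ℕ} (h₁ : Reach w ω p σ T₁ σ')
    (h₂ : Reach w ω q σ' T₂ σ'') : Reach w ω (.seq p q) σ (T₁ + T₂) σ'' :=
  fun ρ hρ => (h₁ ρ hρ).seq h₂

theorem Bounded.of_sim {σ τ : State} (h : Bounded β σ) (hs : Sim τ σ) : Bounded β τ :=
  ⟨fun r hr => by rw [hs.1 r (by omega)]; exact h.reg r hr, by rw [hs.2.1]; exact h.mem⟩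

theorem Bounded.setReg {σ : State} (h : Bounded β σ) {r x : ℕ} (hx : x < 2 ^ β) :
    Bounded β (σ.setReg r x) := by
  refine ⟨fun r' hr' => ?_, h.mem⟩
  rcases eq_or_ne r' r with rfl | hne
  · simpa using hx
  · simpa [Function.update_of_ne hne] using h.reg r' hr'

theorem Bounded.setMem {σ : State} (h : Bounded β σ) {A : Arr} {i x : ℕ} (hx : x < 2 ^ β) :
    Bounded β (σ.setMem A i x) := by
  refine ⟨h.reg, fun B j => ?_⟩
  simp only [State.setMem]
  rcases eq_or_ne B A with rfl | hne
  · rw [Function.update_self]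
    rcases eq_or_ne j i with rfl | hne
    · simpa using hx
    · rw [Function.update_of_ne hne]; exact h.mem _ _
  · rw [Function.update_of_ne hne]; exact h.mem _ _

theorem Bounded.fillMem {σ : State} (h : Bounded β σ) {A : Arr} {val : ℕ → ℕ} {N : ℕ}
    (hx : ∀ i < N, val i < 2 ^ β) : Bounded β (σ.fillMem A val N) := by
  refine ⟨h.reg, fun B j => ?_⟩
  simp only [State.fillMem]
  rcases eq_or_ne B A with rfl | hne
  · rw [Function.update_self]
    split_ifs with hj
    exacts [hx j hj, h.mem _ _]
  · rw [Function.update_of_ne hne]; exact h.mem _ _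

theorem Expr.eval_lt_two_pow {σ : State} (hβ : 1 ≤ β) (hσ : Bounded β σ) {e : Expr} {t : ℕ}
    (hwf : e.wf glob [] t) (hw : β * e.size ≤ w) : e.eval σ.mem σ.reg < 2 ^ w :=
  (Expr.eval_lt hβ hσ.mem e hwf (fun r hr => hσ.reg r (by simpa using hr))).trans_le
    (Nat.pow_le_pow_right (by norm_num) hw)

theorem reach_assign {σ : State} (hβ : 1 ≤ β) (hσ : Bounded β σ) {r : ℕ} {e : Expr}
    (hwf : e.wf glob [] vis) (hw : β * e.size ≤ w) :
    Reach w ω (assign r e) σ (e.cost σ.reg + 1) (σ.setReg r (e.eval σ.mem σ.reg)) := by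
  intro ρ hρ
  have hρb := hσ.of_sim hρ
  rw [← hρ.2.1, ← Expr.eval_congr (reg := ρ.reg) e hwf (fun r hr => hρ.1 r (by simp at hr; omega)),
    ← Expr.cost_congr (reg := ρ.reg) e hwf (fun r hr => hρ.1 r (by omega))]
  refine (Expr.runs_compile hβ e (by omega) (by simp) hwf (fun r hr => hρb.reg r (by simpa using hr))
    hρb.mem hw).seq ?_
  rintro τ ⟨h1, h2, h3, h4⟩
  refine Runs.op ⟨fun r' hr' => ?_, h3.trans hρ.2.1, h4.trans hρ.2.2⟩
  rcases eq_or_ne r' r with rfl | hne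
  · simpa [Op.eval, h1] using Nat.mod_eq_of_lt (Expr.eval_lt_two_pow hβ hρb hwf hw)
  · simp only [State.setReg_reg, Function.update_of_ne hne]
    rw [h2 r' hr', hρ.1 r' hr']

theorem reach_put {σ : State} (hβ : 1 ≤ β) (hσ : Bounded β σ) {A : Arr} {a e : Expr}
    (hwfa : a.wf glob [] vis) (hwfe : e.wf glob [] (vis + 1)) (hwa : β * a.size ≤ w)
    (hwe : β * e.size ≤ w) :
    Reach w ω (put A a e) σ (a.cost σ.reg + e.cost σ.reg + 1)
      (σ.setMem A (a.eval σ.mem σ.reg) (e.eval σ.mem σ.reg)) := by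
  intro ρ hρ
  have hρb := hσ.of_sim hρ
  rw [← hρ.2.1, ← Expr.eval_congr (reg := ρ.reg) e hwfe (fun r hr => hρ.1 r (by simp at hr; omega)),
    ← Expr.cost_congr (reg := ρ.reg) e hwfe (fun r hr => hρ.1 r (by omega)),
    ← Expr.eval_congr (reg := ρ.reg) a hwfa (fun r hr => hρ.1 r (by simp at hr; omega)),
    ← Expr.cost_congr (reg := ρ.reg) a hwfa (fun r hr => hρ.1 r (by omega)), add_assoc]
  refine (Expr.runs_compile hβ a (by omega) (by simp) hwfa (fun r hr => hρb.reg r (by simpa using hr))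
    hρb.mem hwa).seq ?_
  rintro τ ⟨h1, h2, h3, h4⟩
  have hs : Sim τ ρ := ⟨h2, h3, h4⟩
  have hτb := hρb.of_sim hs
  rw [← Expr.eval_congr (reg := τ.reg) e hwfe (fun r hr => hs.1 r (by simp at hr; omega)),
    ← Expr.cost_congr (reg := τ.reg) e hwfe (fun r hr => hs.1 r (by omega)), ← h3]
  refine (Expr.runs_compile hβ e (by omega) (by simp) hwfe
    (fun r hr => hτb.reg r (by simpa using hr)) hτb.mem hwe).seq ?_
  rintro υ ⟨k1, k2, k3, k4⟩
  refine Runs.store ⟨fun r hr => ?_, ?_, ?_⟩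
  · rw [State.setMem_reg, State.setMem_reg, k2 r (by omega), h2 r hr, hρ.1 r hr]
  · simp only [State.setMem]
    rw [k2 vis (by omega), h1, k1, k3, h3, hρ.2.1]
  · rw [State.setMem_coins, State.setMem_coins, k4, h4, hρ.2.2]

/-- The run is described by a prescribed sequence of states `S`, in which the content of the counter
is irrelevant because it is overwritten before and after each body. -/
theorem reach_forLoop (hw : 1 ≤ w) {r rb N T : ℕ} {body : Cmd} (S : ℕ → State) (hne : r ≠ rb)
    (hr : r < vis) (hrb : rb < vis) (hN : ∀ i ≤ N, (S i).reg rb = N) (hNw : N < 2 ^ w)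
    (hbody : ∀ i < N, Reach w ω body ((S i).setReg r i) T ((S (i + 1)).setReg r i)) :
    Reach w ω (forLoop r rb vis body) (S 0) (N * (T + 4) + 3) ((S N).setReg r N) := by
  intro ρ hρ
  let Inv : ℕ → State → Prop := fun i ρ => (∀ r' < vis, r' ≠ r → ρ.reg r' = (S i).reg r') ∧
    ρ.mem = (S i).mem ∧ ρ.coins = (S i).coins
  refine (Runs.forLoop hw hne hr.ne hrb.ne' ((hρ.1 rb hrb).trans (hN 0 (Nat.zero_le _))) hNw Inv
    ?_ ?_ ⟨fun r' hr' _ => hρ.1 r' hr', hρ.2⟩ ?_).mono le_rfl ?_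
  · rintro i ρ x ⟨h1, h2⟩
    refine ⟨fun r' hr' h => ?_, h2⟩
    simpa [Function.update_of_ne h] using h1 r' hr' h
  · rintro i ρ x ⟨h1, h2⟩
    refine ⟨fun r' hr' h => ?_, h2⟩
    simpa [Function.update_of_ne hr'.ne] using h1 r' hr' h
  · rintro i hi ρ ⟨h1, h2⟩ h3 h4
    refine (hbody i hi ρ ⟨fun r' hr' => ?_, h2⟩).mono le_rfl ?_
    · rcases eq_or_ne r' r with rfl | h
      · simpa using h3
      · simpa [Function.update_of_ne h] using h1 r' hr' h
    · rintro τ ⟨k1, k2⟩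
      refine ⟨⟨fun r' hr' h => ?_, k2⟩, ?_, ?_⟩
      · simpa [Function.update_of_ne h] using k1 r' hr'
      · simpa using k1 r hr
      · simpa [Function.update_of_ne hne.symm, hN (i + 1) hi] using k1 rb hrb
  · rintro τ ⟨⟨h1, h2⟩, h3, h4⟩
    refine ⟨fun r' hr' => ?_, h2⟩
    rcases eq_or_ne r' r with rfl | h
    · simpa using h3
    · simpa [Function.update_of_ne h] using h1 r' hr' h

/-- In `hE` the expression is evaluated in the memory whose first `t` cells are already filled. This
is what permits tables whose entries refer to earlier entries. -/
theorem reach_fill {σ : State} (hβ : 1 ≤ β) (hσ : Bounded β σ) {A : Arr} {r rb C : ℕ} {e : Expr}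
    {val : ℕ → ℕ} (hne : r ≠ rb) (hr : r < glob) (hrb : rb < glob)
    (hwf : e.wf glob [] (vis + 1)) (hw : β * e.size ≤ w)
    (hval : ∀ t < σ.reg rb, val t < 2 ^ β)
    (hE : ∀ t < σ.reg rb, e.eval (σ.fillMem A val t).mem (Function.update σ.reg r t) = val t)
    (hC : ∀ t < σ.reg rb, e.cost (Function.update σ.reg r t) ≤ C) :
    Reach w ω (fill A r rb e) σ (σ.reg rb * (C + 6) + 3)
      ((σ.fillMem A val (σ.reg rb)).setReg r (σ.reg rb)) := by
  have hβw : β ≤ w := le_trans (Nat.le_mul_of_pos_right β e.size_pos) hw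
  have h0 := σ.fillMem_zero A val
  have hlt : σ.reg rb < 2 ^ β := hσ.reg rb hrb
  have key := reach_forLoop (w := w) (ω := ω) (hβ.trans hβw) (r := r) (rb := rb)
    (N := σ.reg rb) (T := C + 2) (body := put A (.var r) e) (fun i => σ.fillMem A val i) hne (by omega) (by omega)
    (fun i _ => rfl) (hlt.trans_le (Nat.pow_le_pow_right (by norm_num) hβw)) (fun i hi => by
      have hb : Bounded β ((σ.fillMem A val i).setReg r i) :=
        (hσ.fillMem fun j hj => hval j (hj.trans hi)).setReg (hi.trans hlt)
      have hput := reach_put (w := w) (ω := ω) hβ hb (A := A) (a := .var r) (e := e)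
        (by simp [Expr.wf, hr]) hwf (by simpa [Expr.size] using hβw) hw
      have h1 : e.eval ((σ.fillMem A val i).setReg r i).mem ((σ.fillMem A val i).setReg r i).reg
          = val i := hE i hi
      have h2 : (Expr.var r).eval ((σ.fillMem A val i).setReg r i).mem
          ((σ.fillMem A val i).setReg r i).reg = i := by simp [Expr.eval]
      have h3 : ((σ.fillMem A val i).setReg r i).setMem A i (val i) =
          (σ.fillMem A val (i + 1)).setReg r i := by rw [← σ.setMem_fillMem A val i]; rfl
      rw [h1, h2, h3] at hput
      refine hput.mono ?_
      have := hC i hi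
      simp only [Expr.cost, State.setReg_reg, State.fillMem_reg]; omega)
  simp only [h0] at key
  exact key

/-- Cell `t` receives exactly the coin number `σ.coins + t`, masked. This rigid correspondence makes
the table an explicit function of the outcome `ω`. -/
theorem reach_fillRandom {σ : State} (hβ : 1 ≤ β) (hσ : Bounded β σ) {A : Arr} {r rb C : ℕ}
    {e : Expr} {val : ℕ → ℕ} (hne : r ≠ rb) (hr : r < glob) (hrb : rb < glob)
    (hwf : e.wf glob [] (vis + 1)) (hw : β * e.size ≤ w)
    (hval : ∀ t < σ.reg rb, val t < 2 ^ β)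
    (hE : ∀ t < σ.reg rb, (if ω (σ.coins + t) then 1 else 0) &&&
      e.eval (σ.fillMem A val t).mem (Function.update σ.reg r t) = val t)
    (hC : ∀ t < σ.reg rb, e.cost (Function.update σ.reg r t) ≤ C) :
    Reach w ω (fillRandom A r rb e) σ (σ.reg rb * (C + 8) + 3)
      { (σ.fillMem A val (σ.reg rb)).setReg r (σ.reg rb) with
        coins := σ.coins + σ.reg rb } := by
  have hβw : β ≤ w := le_trans (Nat.le_mul_of_pos_right β e.size_pos) hw
  have hw1 : 1 ≤ w := hβ.trans hβw
  have h0 := σ.fillMem_zero A val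
  have hlt : σ.reg rb < 2 ^ β := hσ.reg rb hrb
  have key := reach_forLoop (w := w) (ω := ω) hw1 (r := r) (rb := rb)
    (N := σ.reg rb) (T := C + 4)
    (body := .seq (.flip vis) (.seq (e.compile (vis + 1))
      (.seq (.op .and (vis + 1) vis (vis + 1)) (.seq (.op .and vis r r)
      (.store A vis (vis + 1))))))
    (fun i => { σ.fillMem A val i with coins := σ.coins + i }) hne (by omega) (by omega)
    (fun i _ => rfl) (hlt.trans_le (Nat.pow_le_pow_right (by norm_num) hβw)) (fun i hi => by
      have h1w : 1 < 2 ^ w := Nat.one_lt_two_pow (by omega)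
      have hb : Bounded β ((σ.fillMem A val i).setReg r i) :=
        (hσ.fillMem fun j hj => hval j (hj.trans hi)).setReg (hi.trans hlt)
      intro ρ hρ
      refine (Runs.seq (T₁ := 1) (T₂ := C + 3) (P := fun τ => τ = _) (Runs.flip rfl) ?_).mono
        (by omega) (fun _ h => h)
      rintro _ rfl
      set b : ℕ := (if ω ρ.coins = true then 1 else 0) % 2 ^ w with hbdef
      have hs : Sim { ρ.setReg vis b with coins := ρ.coins + 1 }
          { (σ.fillMem A val i).setReg r i with coins := σ.coins + i + 1 } := by
        refine ⟨fun r' hr' => ?_, hρ.2.1, ?_⟩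
        · have := hρ.1 r' hr'
          simpa [Function.update_of_ne hr'.ne] using this
        · simpa using hρ.2.2
      have hb' : Bounded β { ρ.setReg vis b with coins := ρ.coins + 1 } :=
        Bounded.of_sim (σ := { (σ.fillMem A val i).setReg r i with coins := σ.coins + i + 1 })
          ⟨hb.reg, hb.mem⟩ hs
      have hrun := Expr.runs_compile (w := w) (ω := ω) hβ e (t := vis + 1) (by omega) (by simp)
        hwf (fun r hr => hb'.reg r (by simpa using hr)) hb'.mem hw
      rw [Expr.eval_congr e hwf (fun r hr => hs.1 r (by simp at hr; omega)),
        Expr.cost_congr e hwf (fun r hr => hs.1 r (by omega)), hs.2.1] at hrun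
      refine (hrun.seq (T₂ := 3) ?_).mono (by have := hC i hi; simpa using this) (fun _ h => h)
      rintro τ ⟨k1, k2, k3, k4⟩
      refine Runs.seq (T₁ := 1) (T₂ := 2) (P := fun τ' => τ' = _) (Runs.op rfl) ?_
      rintro _ rfl
      refine Runs.seq (T₁ := 1) (T₂ := 1) (P := fun τ' => τ' = _) (Runs.op rfl) ?_
      rintro _ rfl
      have hcoin : ρ.coins = σ.coins + i := hρ.2.2
      have hτr : τ.reg r = i := by
        rw [k2 r (by omega)]
        simpa [Function.update_of_ne (show r ≠ vis by omega)] using hρ.1 r (by omega)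
      have hbv : b = if ω (σ.coins + i) = true then 1 else 0 := by
        rw [hbdef, hcoin]; split_ifs <;> [exact Nat.mod_eq_of_lt h1w; exact Nat.zero_mod _]
      have hvb := (hval i hi).trans_le (Nat.pow_le_pow_right (n := 2) (by norm_num) hβw)
      refine Runs.store ⟨fun r' hr' => ?_, ?_, ?_⟩
      · simp only [State.setMem_reg, State.setReg_reg, Function.update_of_ne hr'.ne,
          Function.update_of_ne (show r' ≠ vis + 1 by omega)]
        rw [k2 r' (by omega)]
        exact hs.1 r' hr'
      · have e1 : ∀ x y : ℕ, ((τ.setReg (vis + 1) x).setReg vis y).reg vis = y :=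
          fun x y => by simp
        have e2 : ∀ x y : ℕ, ((τ.setReg (vis + 1) x).setReg vis y).reg (vis + 1) = x :=
          fun x y => by simp
        simp only [State.setMem, e1, e2]
        simp only [State.setReg_reg, Function.update_of_ne (show r ≠ vis + 1 by omega), hτr, k1,
          k2 vis (by omega), Function.update_self, State.setReg_mem, Op.eval, Nat.and_self, hbv]
        have hEi := hE i hi
        change (_ &&& Expr.eval (σ.fillMem A val i).mem e (Function.update σ.reg r i)) = _ at hEi
        have hiw : i % 2 ^ w = i := Nat.mod_eq_of_lt
          ((hi.trans hlt).trans_le (Nat.pow_le_pow_right (by norm_num) hβw))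
        simp only [State.fillMem_reg, hEi, hiw, Nat.mod_eq_of_lt hvb, k3,
          State.setReg_mem]
        exact congrArg State.mem (σ.setMem_fillMem A val i)
      · simp only [State.setMem_coins, State.setReg_coins, k4, hcoin]; omega)
  simp only [h0] at key
  exact key

theorem reach_op {σ : State} {o : Op} {r a b : ℕ} (ha : a < vis) (hb : b < vis) :
    Reach w ω (.op o r a b) σ 1 (σ.setReg r (o.eval w (σ.reg a) (σ.reg b))) := by
  intro ρ hρ
  refine Runs.op ⟨fun r' hr' => ?_, hρ.2⟩
  rw [hρ.1 a ha, hρ.1 b hb]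
  rcases eq_or_ne r' r with rfl | h
  · simp
  · simpa [Function.update_of_ne h] using hρ.1 r' hr'

theorem reach_const {σ : State} {r c : ℕ} :
    Reach w ω (.const r c) σ 1 (σ.setReg r (c % 2 ^ w)) := by
  intro ρ hρ
  refine Runs.const ⟨fun r' hr' => ?_, hρ.2⟩
  rcases eq_or_ne r' r with rfl | h
  · simp
  · simpa [Function.update_of_ne h] using hρ.1 r' hr'

theorem reach_load {σ : State} {r i : ℕ} {A : Arr} (hi : i < vis) :
    Reach w ω (.load r A i) σ 1 (σ.setReg r (σ.mem A (σ.reg i))) := by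
  intro ρ hρ
  refine Runs.load ⟨fun r' hr' => ?_, hρ.2⟩
  rw [hρ.1 i hi, hρ.2.1]
  rcases eq_or_ne r' r with rfl | h
  · simp
  · simpa [Function.update_of_ne h] using hρ.1 r' hr'

end Reach

/-! ### Programs that do not write to data arrays -/

theorem Expr.readOnly_compile (e : Expr) : ∀ t, (e.compile t).DataReadOnly := by
  induction e with
  | const c => intro t; trivial
  | var r => intro t; trivial
  | op o a b iha ihb =>
    intro t
    cases o <;> simp [Expr.compile, Cmd.DataReadOnly, iha, ihb]
  | load A e ih => intro t; simp [Expr.compile, Cmd.DataReadOnly, ih]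
  | xsum r rb e ih => intro t; simp [Expr.compile, forLoop, Cmd.DataReadOnly, ih]

theorem readOnly_forLoop {r rb s : ℕ} {p : Cmd} (h : p.DataReadOnly) :
    (forLoop r rb s p).DataReadOnly := by
  simp [forLoop, Cmd.DataReadOnly, h]

theorem readOnly_assign (r : ℕ) (e : Expr) : (assign r e).DataReadOnly := by
  simp [assign, Cmd.DataReadOnly, e.readOnly_compile]

theorem readOnly_put (j : ℕ) (a e : Expr) : (put (.work j) a e).DataReadOnly := by
  simp [put, Cmd.DataReadOnly, e.readOnly_compile, a.readOnly_compile]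

theorem readOnly_fill (j r rb : ℕ) (e : Expr) : (fill (.work j) r rb e).DataReadOnly :=
  readOnly_forLoop (readOnly_put _ _ _)

end WordRAM

/-! ### Sieving in characteristic two -/

section Sieve

variable {A : Type*} [CommRing A] [CharP A 2]

/-- The sum of the coefficients selected by the bits of `X`. -/
def bitSum (m X : ℕ) (a : ℕ → A) : A := ∑ i ∈ Finset.range m, if X.testBit i then a i else 0

/-- Squaring is additive in characteristic two, so the square of a restricted linear form is again a
single restricted linear form. -/
theorem bitSum_sq (m X : ℕ) (a : ℕ → A) : bitSum m X a ^ 2 = bitSum m X fun i => a i ^ 2 := by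
  unfold bitSum
  rw [CharTwo.sum_sq]
  refine Finset.sum_congr rfl fun i _ => ?_
  split_ifs <;> simp

/-- Expand the product: a monomial selects one label per factor, hence misses some label `i < m`.
Membership of `i` in `X` does not matter for it, so toggling the bit `i` pairs the sets `X` with
equal terms, which cancel. -/
theorem sum_prod_bitSum_eq_zero {ι : Type*} (J : Finset ι) {m : ℕ} (hJ : J.card < m)
    (a : ι → ℕ → A) : ∑ X ∈ Finset.range (2 ^ m), ∏ j ∈ J, bitSum m X (a j) = 0 := by
  classical
  simp only [bitSum, Finset.prod_sum]
  rw [Finset.sum_comm]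
  refine Finset.sum_eq_zero fun p hp => ?_
  -- A choice `p` of labels uses at most `J.card < m` of them.
  obtain ⟨i, hi, hni⟩ : ∃ i < m, ∀ x : J, p x.1 x.2 ≠ i := by
    by_contra! h
    have : Finset.range m ⊆ J.attach.image fun x => p x.1 x.2 := by
      intro i hi
      obtain ⟨x, hx⟩ := h i (Finset.mem_range.1 hi)
      exact Finset.mem_image.2 ⟨x, Finset.mem_attach _ _, hx⟩
    have h1 := Finset.card_le_card this
    have h2 := Finset.card_image_le (s := J.attach) (f := fun x => p x.1 x.2)
    simp only [Finset.card_range, Finset.card_attach] at h1 h2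
    omega
  have hbit : ∀ X l, l ≠ i → (X ^^^ 2 ^ i).testBit l = X.testBit l := fun X l hl => by
    simp [Nat.testBit_xor, Nat.testBit_two_pow_of_ne hl.symm]
  refine Finset.sum_involution (fun X _ => X ^^^ 2 ^ i) ?_ ?_ ?_ ?_
  · intro X _
    have : ∀ x ∈ J.attach, (if (X ^^^ 2 ^ i).testBit (p x.1 x.2) then a x.1 (p x.1 x.2) else 0) =
        if X.testBit (p x.1 x.2) then a x.1 (p x.1 x.2) else 0 := fun x _ => by
      rw [hbit _ _ (hni x)]
    rw [Finset.prod_congr rfl this, CharTwo.add_self_eq_zero]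
  · intro X _ _ h
    have := congrArg (fun Y => Y.testBit i) h
    simp [Nat.testBit_xor, Nat.testBit_two_pow_self] at this
  · intro X hX
    exact Finset.mem_range.2 (Nat.xor_lt_two_pow (Finset.mem_range.1 hX)
      (Nat.pow_lt_pow_right (by norm_num) hi))
  · intro X _
    simp

/-- The two equal factors merge into one by `bitSum_sq`, which leaves fewer than `m` linear forms.
-/
theorem sum_prod_bitSum_eq_zero_of_eq {ι : Type*} (J : Finset ι) {m : ℕ} (hJ : J.card ≤ m)
    (a : ι → ℕ → A) {x y : ι} (hx : x ∈ J) (hy : y ∈ J) (hxy : x ≠ y) (ha : a x = a y) :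
    ∑ X ∈ Finset.range (2 ^ m), ∏ j ∈ J, bitSum m X (a j) = 0 := by
  classical
  have hx' : x ∈ J.erase y := Finset.mem_erase.2 ⟨hxy, hx⟩
  have hcard : (J.erase y).card < m := by
    have := Finset.card_erase_lt_of_mem hy; omega
  rw [← sum_prod_bitSum_eq_zero (J.erase y) hcard (Function.update a x fun i => a x i ^ 2)]
  refine Finset.sum_congr rfl fun X _ => ?_
  rw [← Finset.mul_prod_erase _ _ hy, ← Finset.mul_prod_erase _ _ hx',
    ← Finset.mul_prod_erase (J.erase y) _ hx', Function.update_self, ← bitSum_sq, ← ha, sq,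
    mul_assoc]
  congr 2
  refine Finset.prod_congr rfl fun z hz => ?_
  rw [Function.update_of_ne (Finset.ne_of_mem_erase hz)]

end Sieve

/-! ### Walks in weighted digraphs -/

section Walks

variable {Q A : Type*} [CommRing A]

open Matrix in
theorem Matrix.sum_walks [Fintype Q] [DecidableEq Q] (N : Matrix Q Q A) (b : Q → A) (j : ℕ) :
    ∀ a : Q → A, ∑ u : Fin (j + 1) → Q, a (u 0) *
      (∏ i : Fin j, N (u i.castSucc) (u i.succ)) * b (u (Fin.last j)) =
      a ⬝ᵥ ((N ^ j) *ᵥ b) := by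
  induction j with
  | zero =>
    intro a
    rw [← (Equiv.funUnique (Fin 1) Q).symm.sum_comp]
    simp [dotProduct]
  | succ j ih =>
    intro a
    rw [← (Fin.consEquiv fun _ => Q).sum_comp, Fintype.sum_prod_type_right]
    rw [pow_succ', ← Matrix.mulVec_mulVec, Matrix.dotProduct_mulVec, ← ih]
    refine Finset.sum_congr rfl fun u _ => ?_
    simp only [Matrix.vecMul, dotProduct, Finset.sum_mul]
    refine Finset.sum_congr rfl fun p _ => ?_
    simp [Fin.prod_univ_succ, Fin.consEquiv, ← Fin.succ_last, mul_assoc]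

variable {V : Type*} {j : ℕ}

/-- Reflection of the segment from `i` to `i'`. -/
def segFlip (i i' l : ℕ) : ℕ := if i ≤ l ∧ l ≤ i' then i + i' - l else l

/-- The segment from `i` to `i'` joins the first vertex that occurs again to its last occurrence. -/
def IsSeg (v : ℕ → V) (j i i' : ℕ) : Prop :=
  i < i' ∧ i' ≤ j ∧ v i = v i' ∧ (∀ l < i, ∀ l' ≤ j, l < l' → v l' ≠ v l) ∧
    ∀ l ≤ j, i' < l → v l ≠ v i

theorem IsSeg.unique {v : ℕ → V} {j i i' k k' : ℕ} (h : IsSeg v j i i') (h' : IsSeg v j k k') :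
    i = k ∧ i' = k' := by
  obtain ⟨a1, a2, a3, a4, a5⟩ := h
  obtain ⟨b1, b2, b3, b4, b5⟩ := h'
  have hik : i = k := by
    rcases lt_trichotomy i k with h | h | h
    · exact absurd a3.symm (b4 i h i' a2 a1)
    · exact h
    · exact absurd b3.symm (a4 k h k' b2 b1)
  subst hik
  refine ⟨rfl, ?_⟩
  rcases lt_trichotomy i' k' with h | h | h
  · exact absurd b3.symm (a5 k' b2 h)
  · exact h
  · exact absurd a3.symm (b5 i' a2 h)

theorem exists_isSeg {v : ℕ → V} {j : ℕ} (h : ∃ l l', l < l' ∧ l' ≤ j ∧ v l = v l') :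
    ∃ i i', IsSeg v j i i' := by
  classical
  let i := Nat.find h
  obtain ⟨l', h1, h2, h3⟩ := Nat.find_spec h
  let P : ℕ → Prop := fun l => v i = v l
  have hP : P l' := h3
  refine ⟨i, Nat.findGreatest P j, h1.trans_le (Nat.le_findGreatest h2 hP),
    Nat.findGreatest_le j, Nat.findGreatest_spec (P := P) h2 hP, ?_, ?_⟩
  · intro l hl l' hl' hll heq
    exact Nat.find_min h hl ⟨l', hll, hl', heq.symm⟩
  · intro l hl hil heq
    exact Nat.findGreatest_is_greatest (P := P) hil hl heq.symm

theorem segFlip_segFlip {i i' : ℕ} (l : ℕ) : segFlip i i' (segFlip i i' l) = l := by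
  unfold segFlip; split_ifs <;> omega

theorem segFlip_le {i i' l j : ℕ} (h : i' ≤ j) (hl : l ≤ j) : segFlip i i' l ≤ j := by
  unfold segFlip; split_ifs <;> omega

/-- The reversed walk has the same distinguished segment. Together with uniqueness this makes
segment reversal an involution on walks. -/
theorem IsSeg.flip {v : ℕ → V} {j i i' : ℕ} (h : IsSeg v j i i') :
    IsSeg (fun l => v (segFlip i i' l)) j i i' := by
  obtain ⟨a1, a2, a3, a4, a5⟩ := h
  have e1 : segFlip i i' i = i' := by unfold segFlip; split_ifs <;> omega
  have e2 : segFlip i i' i' = i := by unfold segFlip; split_ifs <;> omega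
  refine ⟨a1, a2, by simp only [e1, e2, a3], fun l hl l' hl' hll => ?_, fun l hl hil => ?_⟩
  · have e3 : segFlip i i' l = l := by unfold segFlip; split_ifs <;> omega
    simp only [e3]
    refine a4 l hl _ (segFlip_le a2 hl') ?_
    unfold segFlip; split_ifs <;> omega
  · have e3 : segFlip i i' l = l := by unfold segFlip; split_ifs <;> omega
    simp only [e3, e1, ← a3]
    exact a5 l hl hil

/-- The sequence `u`, continued constantly. -/
def extend (u : Fin (j + 1) → Q) (l : ℕ) : Q := u ⟨min l j, by omega⟩

theorem extend_of_le (u : Fin (j + 1) → Q) {l : ℕ} (h : l ≤ j) :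
    extend u l = u ⟨l, by omega⟩ := by simp [extend, h]

/-- Reverse the segment from `i` to `i'` and apply `bar` to its states. -/
def revSeg (bar : Q → Q) (i i' : ℕ) (u : Fin (j + 1) → Q) : Fin (j + 1) → Q := fun l =>
  if i ≤ l ∧ (l : ℕ) ≤ i' then bar (extend u (i + i' - l)) else u l

theorem extend_revSeg (bar : Q → Q) {i i' l : ℕ} (u : Fin (j + 1) → Q) (hl : l ≤ j) :
    extend (revSeg bar i i' u) l =
      if i ≤ l ∧ l ≤ i' then bar (extend u (i + i' - l)) else extend u l := by
  rw [extend_of_le _ hl, extend_of_le u hl]; rfl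

-- Here `π` maps a state to its vertex, `T` marks the unlabelled states, `val` the admissible ones,
-- and `bar` exchanges the copies of labelled vertices. The sign-free involution reverses the
-- segment at the first repeated vertex when that vertex is unlabelled. By `he` the step weights are
-- permuted; by `hc` the remaining factor sees only the two end states and the vertices up to order.
-- Walks repeating a labelled vertex have weight zero by `hrep`, so it is enough to pair the others,
-- and these are never fixed.
open Classical in
theorem sum_noninjective_walks_eq_zero [Fintype Q] [CharP A 2] (π : Q → V) (bar : Q → Q)
    (T val : Q → Prop) (e : Q → Q → A) (c : (Fin (j + 1) → Q) → A)
    (hbar : ∀ p, bar (bar p) = p) (hπ : ∀ p, π (bar p) = π p) (hT : ∀ p, bar p = p ↔ T p)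
    (hTπ : ∀ p q, π p = π q → (T p ↔ T q))
    (hval : ∀ p q, T p → val p → val q → π p = π q → p = q)
    (heval : ∀ p q, e p q ≠ 0 → val p ∧ val q ∧ (T p ↔ ¬ T q))
    (he : ∀ p q, e (bar q) (bar p) = e p q)
    (hc : ∀ (u u' : Fin (j + 1) → Q) (ρ : Equiv.Perm (Fin (j + 1))), u' 0 = u 0 →
      u' (Fin.last j) = u (Fin.last j) → (∀ l, π (u' l) = π (u (ρ l))) → c u' = c u)
    (hrep : ∀ u : Fin (j + 1) → Q, c u * ∏ l ∈ Finset.range j, e (extend u l) (extend u (l + 1)) ≠ 0 →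
      ∀ l l', π (u l) = π (u l') → ¬ T (u l) → l = l') :
    ∑ u : Fin (j + 1) → Q with ¬ Function.Injective (fun l => π (u l)),
      c u * ∏ l ∈ Finset.range j, e (extend u l) (extend u (l + 1)) = 0 := by
  set f : (Fin (j + 1) → Q) → A := fun u =>
    c u * ∏ l ∈ Finset.range j, e (extend u l) (extend u (l + 1)) with hf
  let P : (Fin (j + 1) → Q) → ℕ × ℕ → Prop := fun u s =>
    IsSeg (fun l => π (extend u l)) j s.1 s.2 ∧ T (extend u s.1)
  let g : (Fin (j + 1) → Q) → (Fin (j + 1) → Q) := fun u =>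
    if h : ∃ s, P u s then revSeg bar h.choose.1 h.choose.2 u else u
  have hg : ∀ u i i', P u (i, i') → g u = revSeg bar i i' u := by
    intro u i i' h
    have hex : ∃ s, P u s := ⟨_, h⟩
    have := hex.choose_spec.1.unique h.1
    simp only [g, dif_pos hex, this.1, this.2]
  have hg' : ∀ u, (¬ ∃ s, P u s) → g u = u := fun u h => by simp only [g, dif_neg h]
  have hπrev : ∀ (u : Fin (j + 1) → Q) i i' l, l ≤ j →
      π (extend (revSeg bar i i' u) l) = π (extend u (segFlip i i' l)) := by
    intro u i i' l hl
    rw [extend_revSeg _ _ hl]; unfold segFlip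
    split_ifs <;> simp [hπ]
  have hP : ∀ u i i', P u (i, i') → P (revSeg bar i i' u) (i, i') := by
    rintro u i i' ⟨h1, h2⟩
    have h3 := h1.flip
    obtain ⟨a1, a2, a3, -, -⟩ := h1
    refine ⟨?_, ?_⟩
    · obtain ⟨b1, b2, b3, b4, b5⟩ := h3
      simp only at b1 b2 b3 b4 b5
      refine ⟨b1, b2, ?_, fun l hl l' hl' hll => ?_, fun l hl hil => ?_⟩
      · simp only; rw [hπrev _ _ _ _ (by omega), hπrev _ _ _ _ (by omega)]; exact b3
      · simp only; rw [hπrev _ _ _ _ (by omega), hπrev _ _ _ _ (by omega)]; exact b4 l hl l' hl' hll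
      · simp only; rw [hπrev _ _ _ _ (by omega), hπrev _ _ _ _ (by omega)]; exact b5 l hl hil
    · refine (hTπ _ _ ?_).1 h2
      simp only at a3 ⊢
      rw [hπrev _ _ _ _ (by omega), a3]
      congr 2
      unfold segFlip; split_ifs <;> omega
  have hinv : ∀ u, g (g u) = u := by
    intro u
    by_cases h : ∃ s, P u s
    · obtain ⟨⟨i, i'⟩, hs⟩ := h
      have hi' : i' ≤ j := hs.1.2.1
      rw [hg u i i' hs, hg _ i i' (hP u i i' hs)]
      funext l
      have hl : (l : ℕ) ≤ j := by omega
      have : extend (revSeg bar i i' (revSeg bar i i' u)) l = extend u l := by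
        rw [extend_revSeg _ _ hl]
        split_ifs with hh
        · rw [extend_revSeg _ _ (by omega), if_pos (by omega), hbar]
          congr 1; omega
        · rw [extend_revSeg _ _ hl, if_neg hh]
      simpa [extend_of_le _ hl] using this
    · rw [hg' u h, hg' u h]
  have hne : ∀ u, f u ≠ 0 → ∀ l < j, e (extend u l) (extend u (l + 1)) ≠ 0 := by
    intro u hu l hl h0
    exact hu (by
      simp only [hf]
      rw [Finset.prod_eq_zero (Finset.mem_range.2 hl) h0, mul_zero])
  -- An unlabelled vertex has a single admissible state, so the segment begins and ends in the same
  -- state and its reversal joins up with the rest of the walk.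
  have hfix : ∀ u, f u ≠ 0 → ∀ i i', P u (i, i') → extend u i = extend u i' := by
    rintro u hu i i' ⟨⟨a1, a2, a3, -, -⟩, h⟩
    simp only at a1 a2 a3
    have v1 := (heval _ _ (hne u hu i (by omega))).1
    have v2 := (heval _ _ (hne u hu (i' - 1) (by omega))).2.1
    rw [show i' - 1 + 1 = i' by omega] at v2
    exact hval _ _ h v1 v2 a3
  have hfg : ∀ u, f u ≠ 0 → f (g u) = f u := by
    intro u hu
    by_cases h : ∃ s, P u s
    swap
    · rw [hg' u h]
    obtain ⟨⟨i, i'⟩, hs⟩ := h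
    have hii := hfix u hu i i' hs
    rw [hg u i i' hs]
    obtain ⟨⟨a1, a2, a3, -, -⟩, hTi⟩ := hs
    simp only at a1 a2 a3 hTi
    have hTi' : bar (extend u i) = extend u i := (hT _).2 hTi
    have hout : ∀ l ≤ j, l ≤ i ∨ i' ≤ l → extend (revSeg bar i i' u) l = extend u l := by
      intro l hl hor
      rw [extend_revSeg _ _ hl]
      split_ifs with hh
      · rcases hor with h | h
        · obtain rfl : l = i := by omega
          rw [show l + i' - l = i' by omega, ← hii, hTi']
        · obtain rfl : l = i' := by omega
          rw [show i + l - l = i by omega, hTi', hii]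
      · rfl
    simp only [hf]
    congr 1
    · refine hc _ _ ⟨fun l => ⟨segFlip i i' l, by have := segFlip_le (i := i) a2 (show (l : ℕ) ≤ j by omega); omega⟩,
        fun l => ⟨segFlip i i' l, by have := segFlip_le (i := i) a2 (show (l : ℕ) ≤ j by omega); omega⟩,
        fun l => Fin.ext (segFlip_segFlip _), fun l => Fin.ext (segFlip_segFlip _)⟩ ?_ ?_ ?_
      · have := hout 0 (by omega) (by omega)
        simpa [extend_of_le] using this
      · have := hout j le_rfl (by omega)
        simpa [extend_of_le, Fin.last] using this
      · intro l
        have hl : (l : ℕ) ≤ j := by omega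
        have := hπrev u i i' l hl
        rw [extend_of_le _ hl, extend_of_le _ (segFlip_le a2 hl)] at this
        exact this
    -- Step `l` of the segment becomes step `i + i' - 1 - l`, traversed backwards between exchanged
    -- copies; `he` says that its weight is unchanged.
    · let τ : ℕ → ℕ := fun l => if i ≤ l ∧ l < i' then i + i' - 1 - l else l
      refine Finset.prod_nbij' τ τ ?_ ?_ ?_ ?_ ?_
      · intro l hl; simp only [τ, Finset.mem_range] at hl ⊢; split_ifs <;> omega
      · intro l hl; simp only [τ, Finset.mem_range] at hl ⊢; split_ifs <;> omega
      · intro l hl; simp only [τ, Finset.mem_range] at hl ⊢; split_ifs <;> omega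
      · intro l hl; simp only [τ, Finset.mem_range] at hl ⊢; split_ifs <;> omega
      · intro l hl
        rw [Finset.mem_range] at hl
        simp only [τ]
        split_ifs with hh
        · rw [extend_revSeg _ _ (by omega), if_pos (by omega), extend_revSeg _ _ (by omega),
            if_pos (by omega), he]
          congr 2 <;> omega
        · rw [hout l (by omega) (by omega), hout (l + 1) (by omega) (by omega)]
  refine Finset.sum_involution (fun u _ => g u) ?_ ?_ ?_ (fun u _ => hinv u)
  · intro u _
    by_cases hu : f u = 0
    · have : f (g u) = 0 := by
        by_contra h
        exact h (by have := hfg (g u) h; rw [hinv] at this; rw [← this, hu])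
      change f u + f (g u) = 0
      rw [hu, this, add_zero]
    · change f u + f (g u) = 0
      rw [hfg u hu, CharTwo.add_self_eq_zero]
  · intro u hu hfu hgu
    change f u ≠ 0 at hfu
    obtain ⟨i, i', hs⟩ := exists_isSeg (v := fun l => π (extend u l)) (j := j) (by
      have := (Finset.mem_filter.1 hu).2
      simp only [Function.Injective, not_forall] at this
      obtain ⟨a, b, hab, hne⟩ := this
      rcases lt_or_gt_of_ne hne with h | h
      · exact ⟨a, b, h, by omega, by
          rw [extend_of_le u (show (a : ℕ) ≤ j by omega), extend_of_le u (show (b : ℕ) ≤ j by omega)]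
          exact hab⟩
      · exact ⟨b, a, h, by omega, by
          rw [extend_of_le u (show (b : ℕ) ≤ j by omega), extend_of_le u (show (a : ℕ) ≤ j by omega)]
          exact hab.symm⟩)
    have a1 := hs.1
    have a2 := hs.2.1
    have a3 := hs.2.2.1
    simp only at a3
    have hrep' : ∀ l l', l ≤ j → l' ≤ j → π (extend u l) = π (extend u l') → ¬ T (extend u l) →
        l = l' := by
      intro l l' hl hl' h1 h2
      rw [extend_of_le u hl] at h1 h2
      rw [extend_of_le u hl'] at h1
      simpa using hrep u hfu _ _ h1 h2
    by_cases hTi : T (extend u i)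
    · rw [hg u i i' ⟨hs, hTi⟩] at hgu
      have hTi' : T (extend u i') := (hTπ _ _ a3).1 hTi
      have b1 := (heval _ _ (hne u hfu i (by omega))).2.2.1 hTi
      have hlt : i + 1 < i' := by
        rcases Nat.lt_or_ge (i + 1) i' with h | h
        · exact h
        · exact absurd hTi' (by rwa [show i' = i + 1 by omega])
      -- At a fixed point the two outermost interior states lie over the same labelled vertex.
      -- Labelled vertices are not repeated, so the interior is a single state fixed by `bar`; but
      -- `bar` fixes only unlabelled states.
      have b2 : bar (extend u (i' - 1)) = extend u (i + 1) := by
        have := congrArg (fun u => extend u (i + 1)) hgu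
        rw [extend_revSeg _ _ (by omega), if_pos (by omega)] at this
        rw [← this]; congr 2; omega
      have b3 := hrep' (i + 1) (i' - 1) (by omega) (by omega) (by rw [← b2, hπ]) b1
      rw [← b3] at b2
      exact b1 ((hT _).1 b2)
    · exact absurd (hrep' i i' (by omega) a2 a3 hTi) (by omega)
  · intro u hu
    rw [Finset.mem_filter] at hu ⊢
    refine ⟨Finset.mem_univ _, fun hinj => hu.2 ?_⟩
    by_cases h : ∃ s, P u s
    · obtain ⟨⟨i, i'⟩, hs⟩ := h
      rw [hg u i i' hs] at hinj
      obtain ⟨a1, a2, a3, -, -⟩ := (hP u i i' hs).1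
      simp only at a1 a2 a3
      rw [extend_of_le _ (by omega), extend_of_le _ (by omega)] at a3
      have := hinj a3
      simp at this
      omega
    · rwa [hg' u h] at hinj

end Walks

/-! ### The walk polynomial of a bipartite graph -/

section WalkPolynomial

variable {A : Type*} [CommRing A]

/-- Entries of the powers of the matrix `N` of size `M`. -/
def powW (N : ℕ → ℕ → A) (M : ℕ) : ℕ → ℕ → ℕ → A
  | 0, p, q => if p = q then 1 else 0
  | j + 1, p, q => ∑ r ∈ Finset.range M, powW N M j p r * N r q

/-- The label of a vertex on the labelled side, restricted to the label set `X`. -/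
def labelW (n m : ℕ) (sd : ℕ → Bool) (x : ℕ → ℕ → A) (X u : ℕ) : A :=
  if sd u then bitSum m X fun i => x (n + 2 + i) u else 1

/-- Admissible pairs of states; `2 * u` and `2 * u + 1` are the two copies of the vertex `u`. -/
def okay (n k : ℕ) (sd : ℕ → Bool) (X p q : ℕ) : Bool :=
  (p % 2 == 0 || sd (p / 2)) && (q % 2 == 0 || sd (q / 2)) &&
    -- The parity rule at the source. For even `k` a walk must begin on the labelled side. For odd
    -- `k` a walk beginning on the other side visits only `m - 1` labelled vertices, and the test
    -- for label `0` acts as the missing linear form.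
    (p / 2 != n || sd (q / 2) || (k % 2 == 1 && X.testBit 0))

/-- With both copies first the variable follows the direction of travel; as soon as a second copy is
involved it belongs to the opposite direction. -/
def varW (x : ℕ → ℕ → A) (p q : ℕ) : A :=
  if p % 2 + q % 2 = 0 then x (p / 2) (q / 2) else x (q / 2) (p / 2)

/-- Step weights ignore adjacency, so one stored table serves the edges present at the start as well
as those inserted later. -/
def stepW (n k m : ℕ) (sd : ℕ → Bool) (x : ℕ → ℕ → A) (X p q : ℕ) : A :=
  if okay n k sd X p q then labelW n m sd x X (p / 2) * varW x p q else 0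

/-- Adjacency with a source `n` and a sink `n + 1`. -/
def extAdj (n : ℕ) (g : ℕ → ℕ → Bool) (u v : ℕ) : Bool :=
  (decide (u < n) && decide (v < n) && g u v) || (u == n && decide (v < n)) ||
    (decide (u < n) && v == n + 1)

def edgeW (n k m : ℕ) (sd : ℕ → Bool) (g : ℕ → ℕ → Bool) (x : ℕ → ℕ → A) (X p q : ℕ) : A :=
  if extAdj n g (p / 2) (q / 2) then stepW n k m sd x X p q else 0

/-- The sieved sum over all walks with `k` vertices. -/
def walkPoly (n k m : ℕ) (sd : ℕ → Bool) (g : ℕ → ℕ → Bool) (x : ℕ → ℕ → A) : A :=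
  ∑ X ∈ Finset.range (2 ^ m),
    powW (edgeW n k m sd g x X) (2 * (n + 2)) (k + 1) (2 * n) (2 * (n + 1))

theorem powW_congr {N N' : ℕ → ℕ → A} {M : ℕ} (h : ∀ p < M, ∀ q < M, N p q = N' p q) (j : ℕ) :
    ∀ p < M, ∀ q < M, powW N M j p q = powW N' M j p q := by
  induction j with
  | zero => intros; rfl
  | succ j ih =>
    intro p hp q hq
    refine Finset.sum_congr rfl fun r hr => ?_
    rw [ih p hp r (Finset.mem_range.1 hr), h r (Finset.mem_range.1 hr) q hq]

/-- Row indices below `n + 2` belong to vertices, the source and the sink, the next `m` to labels;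
no other variable is ever used. -/
theorem walkPoly_congr {n k m : ℕ} {sd : ℕ → Bool} {g : ℕ → ℕ → Bool} {x x' : ℕ → ℕ → A}
    (h : ∀ u < n + 2 + m, ∀ v < n + 2, x u v = x' u v) :
    walkPoly n k m sd g x = walkPoly n k m sd g x' := by
  refine Finset.sum_congr rfl fun X _ => powW_congr (fun p hp q hq => ?_) _ _ (by omega) _ (by omega)
  have h1 : varW x p q = varW x' p q := by
    unfold varW
    rw [h _ (by omega) _ (by omega), h (q / 2) (by omega) _ (by omega)]
  have h2 : labelW n m sd x X (p / 2) = labelW n m sd x' X (p / 2) := by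
    unfold labelW bitSum
    split_ifs
    · refine Finset.sum_congr rfl fun i hi => ?_
      simp only
      rw [h (n + 2 + i) (by have := Finset.mem_range.1 hi; omega) _ (by omega)]
    · rfl
  simp only [edgeW, stepW, h1, h2]

theorem map_walkPoly {B : Type*} [CommRing B] (φ : A →+* B) (n k m : ℕ) (sd : ℕ → Bool)
    (g : ℕ → ℕ → Bool) (x : ℕ → ℕ → A) :
    φ (walkPoly n k m sd g x) = walkPoly n k m sd g fun u v => φ (x u v) := by
  have hN : ∀ X p q, φ (edgeW n k m sd g x X p q) =
      edgeW n k m sd g (fun u v => φ (x u v)) X p q := by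
    intro X p q
    simp only [edgeW, stepW, labelW, bitSum, varW]
    split_ifs <;> simp [map_sum, apply_ite φ]
  have hp : ∀ X M j p q, φ (powW (edgeW n k m sd g x X) M j p q) =
      powW (edgeW n k m sd g (fun u v => φ (x u v)) X) M j p q := by
    intro X M j
    induction j with
    | zero => intro p q; simp only [powW]; split_ifs <;> simp
    | succ j ih => intro p q; simp only [powW, map_sum, map_mul, ih, hN]
  simp only [walkPoly, map_sum, hp]

/-- Each of the `k + 1` steps contributes at most one label form and one step variable. -/
theorem totalDegree_walkPoly_le {σ R : Type*} [CommRing R] {n k m : ℕ} {sd : ℕ → Bool}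
    {g : ℕ → ℕ → Bool} {x : ℕ → ℕ → MvPolynomial σ R} (hx : ∀ u v, (x u v).totalDegree ≤ 1) :
    (walkPoly n k m sd g x).totalDegree ≤ 2 * k + 2 := by
  have hN : ∀ X p q, (edgeW n k m sd g x X p q).totalDegree ≤ 2 := by
    intro X p q
    unfold edgeW stepW
    split_ifs
    · refine (MvPolynomial.totalDegree_mul _ _).trans (Nat.add_le_add (b := 1) (d := 1) ?_ ?_)
      · unfold labelW bitSum
        split_ifs
        · refine MvPolynomial.totalDegree_finsetSum_le fun i _ => ?_
          split_ifs
          exacts [hx _ _, by simp]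
        · simp
      · unfold varW; split_ifs <;> exact hx _ _
    all_goals simp
  have hp : ∀ X M j p q, (powW (edgeW n k m sd g x X) M j p q).totalDegree ≤ 2 * j := by
    intro X M j
    induction j with
    | zero => intro p q; simp only [powW]; split_ifs <;> simp
    | succ j ih =>
      intro p q
      refine MvPolynomial.totalDegree_finsetSum_le fun r _ => ?_
      exact (MvPolynomial.totalDegree_mul _ _).trans (Nat.add_le_add (ih p r) (hN X r q))
  exact MvPolynomial.totalDegree_finsetSum_le fun X _ => (hp X _ _ _ _).trans (by omega)

theorem powW_eq_pow (N : ℕ → ℕ → A) (M j : ℕ) (p q : Fin M) :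
    powW N M j p q = ((Matrix.of fun p q : Fin M => N p q) ^ j) p q := by
  induction j generalizing q with
  | zero => simp [powW, Matrix.one_apply, Fin.ext_iff]
  | succ j ih =>
    rw [pow_succ, Matrix.mul_apply]
    simp only [powW, Finset.sum_range, ih, Matrix.of_apply]

open Matrix in
theorem powW_add_two (N : ℕ → ℕ → A) {M j s t : ℕ} (hs : s < M) (ht : t < M) :
    powW N M (j + 2) s t = ∑ u : Fin (j + 1) → Fin M, N s (u 0) *
      (∏ l ∈ Finset.range j, N ↑(extend u l) ↑(extend u (l + 1))) * N (u (Fin.last j)) t := by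
  have h1 : ∀ u : Fin (j + 1) → Fin M,
      ∏ l ∈ Finset.range j, N ↑(extend u l) ↑(extend u (l + 1)) =
      ∏ i : Fin j, (Matrix.of fun p q : Fin M => N p q) (u i.castSucc) (u i.succ) := by
    intro u
    rw [Finset.prod_range]
    refine Finset.prod_congr rfl fun i _ => ?_
    rw [extend_of_le u (by omega), extend_of_le u (by omega)]
    rfl
  simp only [h1]
  rw [Matrix.sum_walks (Matrix.of fun p q : Fin M => N p q) (fun p => N p t) j fun p => N s p,
    powW_eq_pow N M (j + 2) ⟨s, hs⟩ ⟨t, ht⟩, pow_succ', pow_succ]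
  simp only [Matrix.mul_apply, dotProduct, mulVec, Matrix.of_apply]

/-- The part of the weight of a step that does not depend on the label set. -/
def innerW (n : ℕ) (sd : ℕ → Bool) (g : ℕ → ℕ → Bool) (x : ℕ → ℕ → A) (p q : ℕ) : A :=
  if p / 2 < n ∧ q / 2 < n ∧ g (p / 2) (q / 2) ∧ (p % 2 = 0 ∨ sd (p / 2)) ∧
    (q % 2 = 0 ∨ sd (q / 2)) then varW x p q else 0

def startW (n : ℕ) (sd : ℕ → Bool) (x : ℕ → ℕ → A) (p : ℕ) : A :=
  if p / 2 < n ∧ (p % 2 = 0 ∨ sd (p / 2)) then varW x (2 * n) p else 0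

def endW (n : ℕ) (sd : ℕ → Bool) (x : ℕ → ℕ → A) (p : ℕ) : A :=
  if p / 2 < n ∧ (p % 2 = 0 ∨ sd (p / 2)) then varW x p (2 * (n + 1)) else 0

def startBit (k : ℕ) (sd : ℕ → Bool) (X p : ℕ) : A :=
  if sd (p / 2) ∨ (k % 2 = 1 ∧ X.testBit 0) then 1 else 0

def sieveW (n k m : ℕ) (sd : ℕ → Bool) (x : ℕ → ℕ → A) {j M : ℕ} (u : Fin (j + 1) → Fin M) : A :=
  ∑ X ∈ Finset.range (2 ^ m), startBit k sd X (u 0) * ∏ l, labelW n m sd x X ((u l : ℕ) / 2)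

variable {n k m : ℕ} {sd : ℕ → Bool} {g : ℕ → ℕ → Bool} {x : ℕ → ℕ → A}

theorem edgeW_source (hsd : ∀ u, sd u → u < n) (X p : ℕ) :
    edgeW n k m sd g x X (2 * n) p = startBit k sd X p * startW n sd x p := by
  have h0 : sd n = false := by
    by_contra h; exact lt_irrefl n (hsd n (by simpa using h))
  by_cases hp : p / 2 < n
  · rcases hs : sd (p / 2) <;> rcases Nat.mod_two_eq_zero_or_one p with h2 | h2 <;>
    rcases Nat.mod_two_eq_zero_or_one k with hk | hk <;> rcases hX : X.testBit 0 <;>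
    simp [edgeW, startBit, startW, extAdj, stepW, okay, labelW, h0, hp, hs, h2, hk, hX]
  · have h1 : sd (p / 2) = false := by
      by_contra h; exact hp (hsd _ (by simpa using h))
    simp [edgeW, startW, extAdj, hp]

theorem edgeW_sink (X p : ℕ) : edgeW n k m sd g x X p (2 * (n + 1)) =
    labelW n m sd x X (p / 2) * endW n sd x p := by
  by_cases hp : p / 2 < n
  · have h1 : p / 2 ≠ n := hp.ne
    by_cases hs : p % 2 = 0 ∨ sd (p / 2) = true
    · have h2 : okay n k sd X p (2 * (n + 1)) = true := by
        simp [okay, h1]; simpa using hs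
      have h3 : 2 * (n + 1) / 2 = n + 1 := by omega
      simp [edgeW, endW, extAdj, stepW, h2, hp, hs, h3]
    · have h2 : okay n k sd X p (2 * (n + 1)) = false := by
        simp only [not_or] at hs
        simp [okay, hs.1, hs.2]
      simp [edgeW, endW, stepW, h2, hs]
  · simp [edgeW, endW, extAdj, hp]

theorem edgeW_inner {p q : ℕ} (hp : p / 2 < n) (hq : q / 2 < n) (X : ℕ) :
    edgeW n k m sd g x X p q = labelW n m sd x X (p / 2) * innerW n sd g x p q := by
  have h1 : p / 2 ≠ n := hp.ne
  have h2 : q / 2 ≠ n + 1 := by omega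
  by_cases hs : (p % 2 = 0 ∨ sd (p / 2) = true) ∧ (q % 2 = 0 ∨ sd (q / 2) = true)
  · have h3 : okay n k sd X p q = true := by
      simp [okay, h1]; simpa using hs
    by_cases hg : g (p / 2) (q / 2) = true
    · simp [edgeW, innerW, extAdj, stepW, h3, hp, hq, hs.1, hs.2, hg]
    · simp [edgeW, innerW, extAdj, hg, h1, h2]
  · have h3 : okay n k sd X p q = false := by
      by_contra h
      simp [okay] at h
      tauto
    have h4 : ¬ (p / 2 < n ∧ q / 2 < n ∧ g (p / 2) (q / 2) ∧ (p % 2 = 0 ∨ sd (p / 2)) ∧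
      (q % 2 = 0 ∨ sd (q / 2))) := by tauto
    rw [innerW, if_neg h4]
    simp [edgeW, stepW, h3]

theorem edgeW_ne_zero {X p q : ℕ} (h : edgeW n k m sd g x X p q ≠ 0) :
    p / 2 ≤ n ∧ q / 2 ≠ n := by
  have : extAdj n g (p / 2) (q / 2) = true := by
    by_contra h'
    exact h (by simp only [edgeW, if_neg h'])
  simp only [extAdj, Bool.or_eq_true, Bool.and_eq_true, decide_eq_true_eq, beq_iff_eq] at this
  omega

/-- The label set enters the weight of a walk only through the start bit and the label forms.
Factoring these out lets the sum over `X` be taken for each walk separately, which yields `sieveW`.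
-/
theorem walk_term (hsd : ∀ u, sd u → u < n) {j M : ℕ} (X : ℕ) (u : Fin (j + 1) → Fin M) :
    edgeW n k m sd g x X (2 * n) (u 0) * (∏ l ∈ Finset.range j,
      edgeW n k m sd g x X ↑(extend u l) ↑(extend u (l + 1))) *
      edgeW n k m sd g x X (u (Fin.last j)) (2 * (n + 1)) =
    startW n sd x (u 0) * endW n sd x (u (Fin.last j)) *
      (startBit k sd X (u 0) * ∏ l, labelW n m sd x X ((u l : ℕ) / 2)) *
      ∏ l ∈ Finset.range j, innerW n sd g x ↑(extend u l) ↑(extend u (l + 1)) := by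
  have h0 : extend u 0 = u 0 := extend_of_le u (Nat.zero_le j)
  have hj : extend u j = u (Fin.last j) := extend_of_le u le_rfl
  by_cases hall : ∀ l ≤ j, (↑(extend u l) : ℕ) / 2 < n
  · rw [edgeW_source hsd, edgeW_sink]
    have h1 : ∏ l ∈ Finset.range j, edgeW n k m sd g x X ↑(extend u l) ↑(extend u (l + 1)) =
        (∏ l ∈ Finset.range j, labelW n m sd x X ((↑(extend u l) : ℕ) / 2)) *
        ∏ l ∈ Finset.range j, innerW n sd g x ↑(extend u l) ↑(extend u (l + 1)) := by
      rw [← Finset.prod_mul_distrib]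
      refine Finset.prod_congr rfl fun l hl => ?_
      have := Finset.mem_range.1 hl
      exact edgeW_inner (hall l (by omega)) (hall (l + 1) (by omega)) X
    have h2 : ∏ l, labelW n m sd x X ((u l : ℕ) / 2) =
        (∏ l ∈ Finset.range j, labelW n m sd x X ((↑(extend u l) : ℕ) / 2)) *
          labelW n m sd x X ((u (Fin.last j) : ℕ) / 2) := by
      rw [Fin.prod_univ_castSucc, Finset.prod_range]
      congr 1
      refine Finset.prod_congr rfl fun i _ => ?_
      rw [extend_of_le u (by omega)]; rfl
    rw [h1, h2]; ring
  · push Not at hall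
    obtain ⟨l, hl, hln⟩ := hall
    -- If some state is not over a vertex of the graph, both sides vanish: on the left it would have
    -- to be enterable, hence not over the source, and leavable, hence over an index at most `n`.
    trans 0
    · by_contra hne
      have hprod := right_ne_zero_of_mul (left_ne_zero_of_mul hne)
      have hstep : ∀ i < j, edgeW n k m sd g x X ↑(extend u i) ↑(extend u (i + 1)) ≠ 0 :=
        fun i hi h => hprod (Finset.prod_eq_zero (Finset.mem_range.2 hi) h)
      have hin : (↑(extend u l) : ℕ) / 2 ≠ n := by
        rcases Nat.eq_zero_or_pos l with rfl | hpos
        · rw [h0]; exact (edgeW_ne_zero (left_ne_zero_of_mul (left_ne_zero_of_mul hne))).2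
        · have := (edgeW_ne_zero (hstep (l - 1) (by omega))).2
          rwa [show l - 1 + 1 = l by omega] at this
      have hout : (↑(extend u l) : ℕ) / 2 ≤ n := by
        rcases Nat.lt_or_ge l j with h | h
        · exact (edgeW_ne_zero (hstep l h)).1
        · obtain rfl : l = j := le_antisymm hl h
          rw [hj]; exact (edgeW_ne_zero (right_ne_zero_of_mul hne)).1
      omega
    · symm
      rcases Nat.eq_zero_or_pos l with rfl | hpos
      · have : startW n sd x (u 0) = 0 := by
          rw [h0] at hln
          simp [startW, hln]
        simp [this]
      · rw [Finset.prod_eq_zero (Finset.mem_range.2 (show l - 1 < j by omega)), mul_zero]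
        rw [show l - 1 + 1 = l by omega]
        rw [innerW, if_neg (by omega)]

theorem walkPoly_eq_sum (hsd : ∀ u, sd u → u < n) {j : ℕ} (hk : k = j + 1) :
    walkPoly n k m sd g x = ∑ u : Fin (j + 1) → Fin (2 * (n + 2)),
      (startW n sd x (u 0) * endW n sd x (u (Fin.last j)) * sieveW n k m sd x u) *
      ∏ l ∈ Finset.range j, innerW n sd g x ↑(extend u l) ↑(extend u (l + 1)) := by
  subst hk
  simp only [walkPoly]
  simp only [powW_add_two _ (show 2 * n < 2 * (n + 2) by omega)
    (show 2 * (n + 1) < 2 * (n + 2) by omega)]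
  rw [Finset.sum_comm]
  refine Finset.sum_congr rfl fun u _ => ?_
  simp only [walk_term hsd, sieveW, Finset.mul_sum, Finset.sum_mul]

theorem card_filter_alternating {j : ℕ} {f : Fin (j + 1) → Bool} {b : Bool}
    (hf : ∀ l, f l = (b ^^ ((l : ℕ) % 2 == 1))) :
    (Finset.univ.filter fun l => f l = true).card = if b then (j + 2) / 2 else (j + 1) / 2 := by
  simp only [hf]
  clear hf f
  induction j with
  | zero => cases b <;> decide
  | succ j ih =>
    rw [Finset.card_filter, Fin.sum_univ_castSucc, ← Finset.card_filter]
    simp only [Fin.val_castSucc, Fin.val_last]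
    rw [ih]
    rcases Nat.mod_two_eq_zero_or_one (j + 1) with h | h <;> cases b <;> simp [h] <;> omega

/-- Sides alternate along the walk, so the number of label forms is known: it is at most `m`, and
exactly `m - 1` if `k` is odd and the walk starts unlabelled. In that case the start bit is itself a
linear form, bringing the number to `m`; for even `k` it is zero. A repeated labelled vertex gives
two equal forms. -/
theorem sieveW_eq_zero [CharP A 2] {j M : ℕ} (hk : k = j + 1) (hm : m = (k + 1) / 2)
    {u : Fin (j + 1) → Fin M}
    (halt : ∀ l < j, sd ((↑(extend u (l + 1)) : ℕ) / 2) = !sd ((↑(extend u l) : ℕ) / 2))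
    {l l' : Fin (j + 1)} (hne : l ≠ l') (hl : sd ((u l : ℕ) / 2))
    (hll : (u l : ℕ) / 2 = (u l' : ℕ) / 2) : sieveW n k m sd x u = 0 := by
  classical
  have hpar : ∀ i ≤ j, sd ((↑(extend u i) : ℕ) / 2) = (sd ((u 0 : ℕ) / 2) ^^ (i % 2 == 1)) := by
    intro i
    induction i with
    | zero => intro _; rw [extend_of_le u (Nat.zero_le j)]; simp
    | succ i ih =>
      intro hi
      rw [halt i (by omega), ih (by omega)]
      rcases Nat.mod_two_eq_zero_or_one i with h | h <;>
        simp [h, Nat.add_mod]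
  have hcard := card_filter_alternating (j := j) (f := fun l => sd ((u l : ℕ) / 2))
    (b := sd ((u 0 : ℕ) / 2)) (fun l => by
      have := hpar l (by omega)
      rwa [extend_of_le u (by omega)] at this)
  set J := Finset.univ.filter fun l => sd ((u l : ℕ) / 2) = true with hJ
  have hprod : ∀ X, ∏ l, labelW n m sd x X ((u l : ℕ) / 2) =
      ∏ l ∈ J, bitSum m X fun i => x (n + 2 + i) ((u l : ℕ) / 2) := by
    intro X
    rw [hJ, Finset.prod_filter]
    refine Finset.prod_congr rfl fun l _ => ?_
    simp [labelW]
  have hlJ : l ∈ J := by simp [hJ, hl]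
  have hlJ' : l' ∈ J := by simp [hJ, ← hll, hl]
  simp only [sieveW, hprod]
  rcases hs : sd ((u 0 : ℕ) / 2)
  · by_cases hko : k % 2 = 1
    · have hm0 : 0 < m := by omega
      have hbit : ∀ X, (startBit k sd X (u 0) : A) = bitSum m X fun i => if i = 0 then 1 else 0 := by
        intro X
        rw [bitSum, Finset.sum_eq_single 0]
        · simp [startBit, hs, hko]
        · intro i _ hi; simp [hi]
        · intro h; exact absurd (Finset.mem_range.2 hm0) h
      -- The extra index `none` carries the form selecting label `0`, that is, the start bit.
      let a : Option (Fin (j + 1)) → ℕ → A := fun o => o.elim (fun i => if i = 0 then 1 else 0)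
        fun l i => x (n + 2 + i) ((u l : ℕ) / 2)
      rw [← sum_prod_bitSum_eq_zero_of_eq (m := m) (Finset.insertNone J) (by
        rw [Finset.card_insertNone, hcard, hs]; simp; omega) a (x := some l) (y := some l')
        (by simpa using hlJ) (by simpa using hlJ') (by simpa using hne) (by simp [a, hll])]
      refine Finset.sum_congr rfl fun X _ => ?_
      rw [Finset.prod_insertNone, hbit]
      simp [a]
    · refine Finset.sum_eq_zero fun X _ => ?_
      simp [startBit, hs, hko]
  · have hbit : ∀ X, (startBit k sd X (u 0) : A) = 1 := by intro X; simp [startBit, hs]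
    simp only [hbit, one_mul]
    exact sum_prod_bitSum_eq_zero_of_eq J (by rw [hcard, hs]; simp; omega) _ hlJ hlJ' hne
      (by simp only [hll])

theorem innerW_ne_zero {p q : ℕ} (h : innerW n sd g x p q ≠ 0) :
    p / 2 < n ∧ q / 2 < n ∧ g (p / 2) (q / 2) ∧ (p % 2 = 0 ∨ sd (p / 2)) ∧
      (q % 2 = 0 ∨ sd (q / 2)) := by
  by_contra h'
  exact h (by rw [innerW, if_neg h'])

/-- Exchange the two copies of a labelled vertex. -/
def swapCopy (sd : ℕ → Bool) (p : ℕ) : ℕ :=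
  if sd (p / 2) then (if p % 2 = 0 then p + 1 else p - 1) else p

theorem swapCopy_div (p : ℕ) : swapCopy sd p / 2 = p / 2 := by
  unfold swapCopy; split_ifs <;> omega

theorem swapCopy_swapCopy (p : ℕ) : swapCopy sd (swapCopy sd p) = p := by
  have := swapCopy_div (sd := sd) p
  rw [swapCopy, this]
  unfold swapCopy
  split_ifs <;> omega

/-- Exactly one end of an edge is labelled, so exchanging copies flips the case distinction in
`varW`, and reversing the step exchanges its arguments; the two effects compensate. -/
theorem innerW_swapCopy (hg : ∀ u v, g u v = g v u)
    (hbip : ∀ u v, u < n → v < n → g u v → sd u ≠ sd v) (p q : ℕ) :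
    innerW n sd g x (swapCopy sd q) (swapCopy sd p) = innerW n sd g x p q := by
  unfold innerW
  simp only [swapCopy_div]
  have hval : ∀ p, (swapCopy sd p % 2 = 0 ∨ sd (p / 2) = true) ↔ (p % 2 = 0 ∨ sd (p / 2) = true) := by
    intro p
    unfold swapCopy
    by_cases h : sd (p / 2) = true <;> simp [h]
  by_cases h : p / 2 < n ∧ q / 2 < n ∧ g (p / 2) (q / 2) ∧ (p % 2 = 0 ∨ sd (p / 2)) ∧
      (q % 2 = 0 ∨ sd (q / 2))
  · rw [if_pos h, if_pos (by rw [hval, hval, hg]; tauto)]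
    obtain ⟨h1, h2, h3, h4, h5⟩ := h
    have := hbip _ _ h1 h2 h3
    unfold varW
    rw [swapCopy_div, swapCopy_div]
    unfold swapCopy
    rcases hsp : sd (p / 2) <;> rcases hsq : sd (q / 2) <;>
      simp only [hsp, hsq, Bool.false_eq_true, or_false, ne_eq, not_true_eq_false,
        if_true, if_false] at h4 h5 this ⊢
    all_goals split_ifs <;> first | rfl | omega
  · rw [if_neg h, if_neg (by rw [hval, hval, hg]; tauto)]

/-- Non-injective walks sum to zero, so some injective walk has a nonzero term, and nonzero step
weights force its consecutive vertices to be adjacent. This holds over every ring of characteristic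
two, hence for every evaluation of the variables: a positive answer is never wrong. -/
theorem exists_path_of_walkPoly_ne_zero [CharP A 2] (hsd : ∀ u, sd u → u < n)
    (hg : ∀ u v, g u v = g v u) (hbip : ∀ u v, u < n → v < n → g u v → sd u ≠ sd v) {j : ℕ}
    (hk : k = j + 1) (hm : m = (k + 1) / 2) (h : walkPoly n k m sd g x ≠ 0) :
    ∃ v : ℕ → ℕ, (∀ l ≤ j, v l < n) ∧ (∀ l < j, g (v l) (v (l + 1))) ∧
      ∀ l ≤ j, ∀ l' ≤ j, v l = v l' → l = l' := by
  classical
  rw [walkPoly_eq_sum hsd hk, ← Finset.sum_filter_not_add_sum_filter _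
    (fun u : Fin (j + 1) → Fin (2 * (n + 2)) => Function.Injective (fun l => (u l : ℕ) / 2))] at h
  have hzero := sum_noninjective_walks_eq_zero (A := A) (j := j) (Q := Fin (2 * (n + 2)))
    (fun p => (p : ℕ) / 2)
    (fun p => ⟨swapCopy sd p, by have := swapCopy_div (sd := sd) p; omega⟩)
    (fun p => sd ((p : ℕ) / 2) = false) (fun p => (p : ℕ) % 2 = 0 ∨ sd ((p : ℕ) / 2) = true)
    (fun p q => innerW n sd g x p q)
    (fun u => startW n sd x (u 0) * endW n sd x (u (Fin.last j)) * sieveW n k m sd x u)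
    (fun p => Fin.ext (swapCopy_swapCopy _)) (fun p => swapCopy_div _)
    (fun p => by
      rw [Fin.ext_iff]
      simp only [swapCopy]
      rcases sd ((p : ℕ) / 2)
      · simp
      · simp; split_ifs <;> omega)
    (fun p q hpq => by rw [hpq])
    (fun p q h1 h2 h3 h4 => by
      rw [← h4] at h3
      simp [h1] at h2 h3
      exact Fin.ext (by omega))
    (fun p q hne => by
      obtain ⟨h1, h2, h3, h4, h5⟩ := innerW_ne_zero hne
      refine ⟨h4, h5, ?_⟩
      have := hbip _ _ h1 h2 h3
      revert this
      rcases sd ((p : ℕ) / 2) <;> rcases sd ((q : ℕ) / 2) <;> simp)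
    (fun p q => innerW_swapCopy hg hbip _ _)
    (fun u u' ρ h0 hl hρ => by
      simp only [h0, hl]
      congr 1
      simp only [sieveW, h0, hρ]
      refine Finset.sum_congr rfl fun X _ => ?_
      rw [Equiv.prod_comp ρ fun l => labelW n m sd x X ((u l : ℕ) / 2)])
    (fun u hu l l' hll hT => by
      by_contra hne
      refine hu ?_
      -- Nonzero inner weights make the walk alternate between the sides, which is what the count in
      -- `sieveW_eq_zero` relies on.
      have halt : ∀ i < j, sd ((↑(extend u (i + 1)) : ℕ) / 2) = !sd ((↑(extend u i) : ℕ) / 2) := by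
        intro i hi
        have : innerW n sd g x ↑(extend u i) ↑(extend u (i + 1)) ≠ 0 := fun h0 =>
          hu (by rw [Finset.prod_eq_zero (Finset.mem_range.2 hi) h0, mul_zero])
        obtain ⟨h1, h2, h3, -⟩ := innerW_ne_zero this
        have := hbip _ _ h1 h2 h3
        revert this
        rcases sd ((↑(extend u (i + 1)) : ℕ) / 2) <;> rcases sd ((↑(extend u i) : ℕ) / 2) <;> simp
      rw [sieveW_eq_zero hk hm halt hne (by simpa using hT) hll, mul_zero, zero_mul])
  have hadd : ∀ a b : A, a + b ≠ 0 → a = 0 → b ≠ 0 := fun a b h ha hb => h (by rw [ha, hb, add_zero])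
  obtain ⟨u, hu, hne⟩ := Finset.exists_ne_zero_of_sum_ne_zero (hadd _ _ h (by convert hzero))
  have hinj := (Finset.mem_filter.1 hu).2
  have hstep : ∀ l < j, innerW n sd g x ↑(extend u l) ↑(extend u (l + 1)) ≠ 0 := fun l hl h0 =>
    hne (by rw [Finset.prod_eq_zero (Finset.mem_range.2 hl) h0, mul_zero])
  have hstart : startW n sd x (u 0) ≠ 0 :=
    left_ne_zero_of_mul (left_ne_zero_of_mul (left_ne_zero_of_mul hne))
  refine ⟨fun l => (↑(extend u l) : ℕ) / 2, fun l hl => ?_,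
    fun l hl => (innerW_ne_zero (hstep l hl)).2.2.1, fun l hl l' hl' hll => ?_⟩
  · simp only
    rcases Nat.eq_zero_or_pos l with rfl | hpos
    · by_contra hlt
      rw [extend_of_le u (Nat.zero_le j)] at hlt
      exact hstart (by rw [startW, if_neg fun h => hlt h.1])
    · have := (innerW_ne_zero (hstep (l - 1) (by omega))).2.1
      rwa [show l - 1 + 1 = l by omega] at this
  · simp only at hll
    rw [extend_of_le u hl, extend_of_le u hl'] at hll
    simpa using hinj hll

/-- Values of the variables for which the path `v` contributes the only nonzero term. -/
def pathVar (n j : ℕ) (v : ℕ → ℕ) (a b : ℕ) : ZMod 2 :=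
  open Classical in
  if (a = n ∧ b = v 0) ∨ (a = v j ∧ b = n + 1) ∨ (∃ l < j, a = v l ∧ b = v (l + 1)) ∨
    (∃ l ≤ j, b = v l ∧ a = n + 2 + (l + 1) / 2) then 1 else 0

/-- The evaluation admits only the source step, the sink step and forward edges of the path, and
gives the labelled vertex at position `l` the single label `(l + 1) / 2`. Then the walk along `v`
through first copies, with the full label set, is the only surviving term. -/
theorem walkPoly_pathVar (hsd : ∀ u, sd u → u < n)
    (hbip : ∀ u v, u < n → v < n → g u v → sd u ≠ sd v) {j : ℕ}
    (hk : k = j + 1) (hm : m = (k + 1) / 2) {v : ℕ → ℕ} (hv : ∀ l ≤ j, v l < n)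
    (hgv : ∀ l < j, g (v l) (v (l + 1))) (hinj : ∀ l ≤ j, ∀ l' ≤ j, v l = v l' → l = l')
    (hstart : k % 2 = 0 → sd (v 0)) : walkPoly n k m sd g (pathVar n j v) = 1 := by
  have hx0 : ∀ a b, pathVar n j v a b ≠ 0 → (a = n ∧ b = v 0) ∨ (a = v j ∧ b = n + 1) ∨
      (∃ l < j, a = v l ∧ b = v (l + 1)) ∨ (∃ l ≤ j, b = v l ∧ a = n + 2 + (l + 1) / 2) := by
    intro a b h
    by_contra h'
    exact h (by rw [pathVar, if_neg h'])
  have hx1 : ∀ a b, ((a = n ∧ b = v 0) ∨ (a = v j ∧ b = n + 1) ∨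
      (∃ l < j, a = v l ∧ b = v (l + 1)) ∨ (∃ l ≤ j, b = v l ∧ a = n + 2 + (l + 1) / 2)) →
      pathVar n j v a b = 1 := by
    intro a b h
    rw [pathVar, if_pos h]
  have hxin : ∀ a b, a < n → b < n → pathVar n j v a b ≠ 0 →
      ∃ l < j, a = v l ∧ b = v (l + 1) := by
    intro a b ha hb h
    rcases hx0 a b h with h | h | h | ⟨l, -, -, h⟩
    · omega
    · omega
    · exact h
    · omega
  let u₀ : Fin (j + 1) → Fin (2 * (n + 2)) := fun l =>
    ⟨2 * v l, by have := hv l (by omega); omega⟩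
  have hu₀ : ∀ l ≤ j, (↑(extend u₀ l) : ℕ) = 2 * v l := fun l hl => by
    rw [extend_of_le _ hl]
  rw [walkPoly_eq_sum hsd hk, Finset.sum_eq_single u₀]
  · have h0 : (u₀ 0 : ℕ) = 2 * v 0 := rfl
    have hj : (u₀ (Fin.last j) : ℕ) = 2 * v j := rfl
    have e1 : startW n sd (pathVar n j v) (u₀ 0) = 1 := by
      have := hv 0 (by omega)
      rw [startW, h0, if_pos (by omega), varW, if_pos (by omega)]
      refine hx1 _ _ (.inl (by omega))
    have e2 : endW n sd (pathVar n j v) (u₀ (Fin.last j)) = 1 := by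
      have := hv j le_rfl
      rw [endW, hj, if_pos (by omega), varW, if_pos (by omega)]
      refine hx1 _ _ (.inr (.inl (by omega)))
    have e3 : ∏ l ∈ Finset.range j,
        innerW n sd g (pathVar n j v) ↑(extend u₀ l) ↑(extend u₀ (l + 1)) = 1 := by
      refine Finset.prod_eq_one fun l hl => ?_
      have hl := Finset.mem_range.1 hl
      have h1 := hv l (by omega)
      have h2 := hv (l + 1) (by omega)
      rw [hu₀ l (by omega), hu₀ (l + 1) (by omega), innerW, varW]
      simp only [Nat.mul_div_cancel_left _ (show 0 < 2 by norm_num), Nat.mul_mod_right]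
      rw [if_pos ⟨h1, h2, hgv l hl, .inl trivial, .inl trivial⟩, if_pos trivial]
      exact hx1 _ _ (.inr (.inr (.inl ⟨l, hl, rfl, rfl⟩)))
    have hpar : ∀ i ≤ j, sd (v i) = (sd (v 0) ^^ (i % 2 == 1)) := by
      intro i
      induction i with
      | zero => intro _; simp
      | succ i ih =>
        intro hi
        have := hbip _ _ (hv i (by omega)) (hv (i + 1) hi) (hgv i (by omega))
        have h2 : sd (v (i + 1)) = !sd (v i) := by
          revert this; rcases sd (v i) <;> rcases sd (v (i + 1)) <;> simp
        rw [h2, ih (by omega)]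
        rcases Nat.mod_two_eq_zero_or_one i with h | h <;> simp [h, Nat.add_mod]
    have hlab : ∀ X, ∀ l ≤ j, labelW n m sd (pathVar n j v) X (v l) =
        if sd (v l) = true ∧ X.testBit ((l + 1) / 2) = false then 0 else 1 := by
      intro X l hl
      have hvl := hv l hl
      unfold labelW bitSum
      by_cases hs : sd (v l) = true
      -- A labelled vertex at an odd position means an unlabelled start, which `hstart` allows only
      -- for odd `k`; this keeps the label below `m`.
      · have hlm : (l + 1) / 2 < m := by
          have := hpar l hl
          rw [hs] at this
          rcases Nat.mod_two_eq_zero_or_one l with h | h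
          · omega
          · rcases Nat.mod_two_eq_zero_or_one k with hk2 | hk2
            · simp [h, hstart hk2] at this
            · omega
        rw [if_pos hs, Finset.sum_eq_single ((l + 1) / 2)]
        · simp only
          rw [hx1 _ _ (.inr (.inr (.inr ⟨l, hl, rfl, rfl⟩)))]
          rcases X.testBit ((l + 1) / 2) <;> simp [hs]
        · intro i _ hi
          have : pathVar n j v (n + 2 + i) (v l) = 0 := by
            by_contra h
            rcases hx0 _ _ h with h | h | ⟨l', hl', h, -⟩ | ⟨l', hl', h, h'⟩
            · omega
            · omega
            · have := hv l' (by omega); omega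
            · have := hinj _ hl _ hl' h; subst this; omega
          simp [this]
        · intro h; exact absurd (Finset.mem_range.2 hlm) h
      · rw [if_neg hs, if_neg (by tauto)]
    have e4 : sieveW n k m sd (pathVar n j v) u₀ = 1 := by
      have hprod : ∀ X, ∏ l, labelW n m sd (pathVar n j v) X ((u₀ l : ℕ) / 2) =
          ∏ l ∈ Finset.range (j + 1), labelW n m sd (pathVar n j v) X (v l) := by
        intro X
        rw [Finset.prod_range]
        refine Finset.prod_congr rfl fun l _ => ?_
        simp [u₀]
      simp only [sieveW, hprod]
      have hm0 : 0 < m := by omega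
      have h2m : 0 < 2 ^ m := by positivity
      -- A surviving `X` contains `(l + 1) / 2` for every labelled position `l`, and label `0`
      -- through the start bit if the path starts unlabelled. Together these are all `m` labels, so
      -- `X` is the full set `2 ^ m - 1`.
      rw [Finset.sum_eq_single (2 ^ m - 1)]
      · rw [Finset.prod_eq_one, mul_one, startBit, if_pos]
        · rw [h0, show 2 * v 0 / 2 = v 0 by omega, Nat.testBit_two_pow_sub_one]
          rcases Nat.mod_two_eq_zero_or_one k with hk2 | hk2
          · exact .inl (hstart hk2)
          · exact .inr ⟨hk2, by simpa using hm0⟩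
        · intro l hl
          have hl := Finset.mem_range.1 hl
          rw [hlab _ l (by omega), if_neg]
          rintro ⟨hs, hb⟩
          rw [Nat.testBit_two_pow_sub_one] at hb
          have := hpar l (by omega)
          rw [hs] at this
          simp only [decide_eq_false_iff_not] at hb
          rcases Nat.mod_two_eq_zero_or_one l with h | h
          · omega
          · rcases Nat.mod_two_eq_zero_or_one k with hk2 | hk2
            · simp [h, hstart hk2] at this
            · omega
      · intro X hX hne
        by_contra hterm
        refine hne (Nat.eq_of_testBit_eq fun i => ?_)
        rw [Nat.testBit_two_pow_sub_one]
        have hb : startBit k sd X (u₀ 0) ≠ (0 : ZMod 2) := left_ne_zero_of_mul hterm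
        have hl : ∀ l ≤ j, sd (v l) = true → X.testBit ((l + 1) / 2) = true := by
          intro l hl hs
          by_contra hbit
          refine right_ne_zero_of_mul hterm (Finset.prod_eq_zero (Finset.mem_range.2
            (show l < j + 1 by omega)) ?_)
          rw [hlab X l hl, if_pos ⟨hs, by simpa using hbit⟩]
        rcases Nat.lt_or_ge i m with him | him
        · simp only [him, decide_true]
          rcases hs : sd (v 0)
          · rcases Nat.eq_zero_or_pos i with rfl | hpos
            · by_contra hbit
              refine hb ?_
              rw [startBit, if_neg]
              rw [h0, show 2 * v 0 / 2 = v 0 by omega, hs]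
              simpa using fun _ => hbit
            · have hk2 : k % 2 = 1 := by
                by_contra h
                have := hstart (by omega)
                rw [hs] at this
                simp at this
              have := hl (2 * i - 1) (by omega) (by
                rw [hpar _ (by omega), hs, show (2 * i - 1) % 2 = 1 by omega]; rfl)
              rwa [show (2 * i - 1 + 1) / 2 = i by omega] at this
          · have := hl (2 * i) (by omega) (by
              rw [hpar _ (by omega), hs, show (2 * i) % 2 = 0 by omega]; rfl)
            rwa [show (2 * i + 1) / 2 = i by omega] at this
        · rw [Nat.testBit_eq_false_of_lt ((Finset.mem_range.1 hX).trans_le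
            (Nat.pow_le_pow_right (by norm_num) him))]
          simp [him]
      · intro h; exact absurd (Finset.mem_range.2 (by omega)) h
    rw [e1, e2, e3, e4]; ring
  · intro u _ hne
    by_contra hterm
    refine hne ?_
    have h1 := left_ne_zero_of_mul (left_ne_zero_of_mul hterm)
    have hs := left_ne_zero_of_mul h1
    have ht := right_ne_zero_of_mul h1
    have hstep : ∀ l < j,
        innerW n sd g (pathVar n j v) ↑(extend u l) ↑(extend u (l + 1)) ≠ 0 := fun l hl h0 =>
      hterm (by rw [Finset.prod_eq_zero (Finset.mem_range.2 hl) h0, mul_zero])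
    have hedge : ∀ l < j, ∃ i < j,
        ((↑(extend u l) : ℕ) / 2 = v i ∧ (↑(extend u (l + 1)) : ℕ) / 2 = v (i + 1) ∧
          (↑(extend u (l + 1)) : ℕ) % 2 = 0) ∨
        ((↑(extend u l) : ℕ) / 2 = v (i + 1) ∧ (↑(extend u (l + 1)) : ℕ) / 2 = v i) := by
      intro l hl
      obtain ⟨a1, a2, a3, a4, a5⟩ := innerW_ne_zero (hstep l hl)
      have hw := hstep l hl
      rw [innerW, if_pos ⟨a1, a2, a3, a4, a5⟩, varW] at hw
      split_ifs at hw with hc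
      · obtain ⟨i, hi, h1, h2⟩ := hxin _ _ a1 a2 hw
        exact ⟨i, hi, .inl ⟨h1, h2, by omega⟩⟩
      · obtain ⟨i, hi, h1, h2⟩ := hxin _ _ a2 a1 hw
        exact ⟨i, hi, .inr ⟨h2, h1⟩⟩
    have hfirst : (u 0 : ℕ) / 2 = v 0 ∧ (u 0 : ℕ) % 2 = 0 := by
      unfold startW at hs
      split_ifs at hs with hc
      · unfold varW at hs
        split_ifs at hs with hc'
        · refine ⟨?_, by omega⟩
          rcases hx0 _ _ hs with h | h | ⟨l', hl', h, -⟩ | ⟨l', hl', h, h'⟩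
          · exact h.2
          · omega
          · have := hv l' (by omega); omega
          · omega
        · exfalso
          rcases hx0 _ _ hs with h | h | ⟨l', hl', -, h⟩ | ⟨l', hl', h, h'⟩
          · omega
          · omega
          · have := hv (l' + 1) (by omega); omega
          · omega
      · exact absurd rfl hs
    have hlast : (u (Fin.last j) : ℕ) / 2 = v j := by
      unfold endW at ht
      split_ifs at ht with hc
      · unfold varW at ht
        split_ifs at ht with hc'
        · rcases hx0 _ _ ht with h | h | ⟨l', hl', -, h⟩ | ⟨l', hl', h, h'⟩
          · omega
          · exact h.1
          · have := hv (l' + 1) (by omega); omega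
          · have := hv l' (by omega); omega
        · exfalso
          rcases hx0 _ _ ht with h | h | ⟨l', hl', h, -⟩ | ⟨l', hl', h, h'⟩
          · omega
          · omega
          · have := hv l' (by omega); omega
          · omega
      · exact absurd rfl ht
    -- Every step of a surviving walk moves one position forwards or backwards along the path, so
    -- after `l` steps the position is at most `l`.
    have hup : ∀ l ≤ j, ∃ i ≤ l, (↑(extend u l) : ℕ) / 2 = v i := by
      intro l
      induction l with
      | zero => intro _; exact ⟨0, le_rfl, by rw [extend_of_le u (Nat.zero_le j)]; exact hfirst.1⟩
      | succ l ih =>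
        intro hl
        obtain ⟨i, hi, h⟩ := ih (by omega)
        obtain ⟨i', hi', ⟨h1, h2, -⟩ | ⟨h1, h2⟩⟩ := hedge l (by omega)
        · have := hinj i (by omega) i' (by omega) (by omega)
          exact ⟨i' + 1, by omega, h2⟩
        · have := hinj i (by omega) (i' + 1) (by omega) (by omega)
          exact ⟨i', by omega, h2⟩
    -- The walk ends at position `j` after `j` steps, which leaves no room for a backward step.
    -- Going down from the end determines every vertex.
    have hdown : ∀ l ≤ j, (↑(extend u (j - l)) : ℕ) / 2 = v (j - l) := by
      intro l
      induction l with
      | zero => intro _; rw [Nat.sub_zero, extend_of_le u le_rfl]; exact hlast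
      | succ l ih =>
        intro hl
        have h1 := ih (by omega)
        obtain ⟨i, hi, h⟩ := hup (j - (l + 1)) (by omega)
        obtain ⟨i', hi', h2⟩ := hedge (j - (l + 1)) (by omega)
        rw [show j - (l + 1) + 1 = j - l by omega] at h2
        rcases h2 with ⟨h2, h3, -⟩ | ⟨h2, h3⟩
        · have := hinj (i' + 1) (by omega) (j - l) (by omega) (by omega)
          rw [h2]; congr 1; omega
        · have := hinj i' (by omega) (j - l) (by omega) (by omega)
          have := hinj (i' + 1) (by omega) i (by omega) (by omega)
          omega
    have hall : ∀ l ≤ j, (↑(extend u l) : ℕ) / 2 = v l := fun l hl => by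
      have := hdown (j - l) (by omega)
      rwa [show j - (j - l) = l by omega] at this
    funext l
    refine Fin.ext ?_
    have hlj : (l : ℕ) ≤ j := by omega
    have h1 := hall l hlj
    rw [extend_of_le u hlj] at h1
    -- A forward step through a second copy would use the variable of the backward edge, which is
    -- zero.
    have h2 : (u l : ℕ) % 2 = 0 := by
      rcases Nat.eq_zero_or_pos (l : ℕ) with h | h
      · rw [show l = 0 from Fin.ext h]; exact hfirst.2
      · obtain ⟨i', hi', ⟨-, -, h3⟩ | ⟨h2, h3⟩⟩ := hedge (l - 1) (by omega)
        · rw [show (l : ℕ) - 1 + 1 = l by omega, extend_of_le u hlj] at h3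
          exact h3
        · rw [show (l : ℕ) - 1 + 1 = l by omega, hall l hlj] at h3
          rw [hall _ (by omega)] at h2
          have := hinj _ (by omega) _ (by omega) h2
          have := hinj _ (by omega) _ (by omega) h3
          omega
    change (u l : ℕ) = 2 * v l
    simp only [Fin.eta] at h1
    omega
  · intro h; exact absurd (Finset.mem_univ _) h

end WalkPolynomial

/-! ### Random evaluation points -/

section Random

open Polynomial WordRAM MeasureTheory

/-- The polynomial of degree less than `q` whose coefficients are the bits of `b` from position
`a * D` on. -/
noncomputable def bitPoly (q D : ℕ) (b : ℕ → Bool) (a : ℕ) : (ZMod 2)[X] :=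
  ∑ d ∈ Finset.range q, if b (a * D + d) then X ^ d else 0

theorem coeff_bitPoly (q D : ℕ) (b : ℕ → Bool) (a d : ℕ) :
    (bitPoly q D b a).coeff d = if d < q ∧ b (a * D + d) then 1 else 0 := by
  simp only [bitPoly, finsetSum_coeff, apply_ite (fun p : (ZMod 2)[X] => p.coeff d), coeff_X_pow,
    coeff_zero]
  by_cases hd : d < q
  · rw [Finset.sum_eq_single d]
    · simp [hd]
    · intro i _ hi; simp [hi.symm]
    · intro h; exact absurd (Finset.mem_range.2 hd) h
  · rw [if_neg (by tauto)]
    refine Finset.sum_eq_zero fun i hi => ?_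
    have := Finset.mem_range.1 hi
    simp [show d ≠ i by omega]

theorem natDegree_bitPoly_le (q D : ℕ) (b : ℕ → Bool) (a : ℕ) : (bitPoly q D b a).natDegree ≤ q := by
  rw [natDegree_le_iff_coeff_eq_zero]
  intro d hd
  rw [coeff_bitPoly, if_neg (by omega)]

theorem coinMeasure_cylinder {ι : Type*} [Fintype ι] (φ : ι → ℕ) (hφ : Function.Injective φ)
    (b : ι → Bool) : coinMeasure {ω | ∀ i, ω (φ i) = b i} = (2⁻¹ : ENNReal) ^ Fintype.card ι := by
  classical
  have h : {ω : ℕ → Bool | ∀ i, ω (φ i) = b i} =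
      Set.pi (Finset.univ.image φ : Finset ℕ) (fun j => {Function.extend φ b (fun _ => true) j}) := by
    ext ω
    simp [Set.mem_pi, hφ.extend_apply]
  rw [h, coinMeasure, Measure.infinitePi_pi _ (fun _ _ => MeasurableSet.of_discrete),
    Finset.prod_image (fun _ _ _ _ h => hφ h)]
  simp [Finset.card_univ]

theorem coinMeasure_le_card {ι : Type*} [Fintype ι] (φ : ι → ℕ) (hφ : Function.Injective φ)
    (B : Finset (ι → Bool)) : coinMeasure {ω | (fun i => ω (φ i)) ∈ B} ≤
      B.card * (2⁻¹ : ENNReal) ^ Fintype.card ι := by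
  have h : {ω : ℕ → Bool | (fun i => ω (φ i)) ∈ B} = ⋃ b ∈ B, {ω | ∀ i, ω (φ i) = b i} := by
    ext ω
    simp only [Set.mem_ofPred_eq, Set.mem_iUnion, exists_prop]
    constructor
    · exact fun h => ⟨_, h, fun i => rfl⟩
    · rintro ⟨b, hb, h⟩
      rwa [show (fun i => ω (φ i)) = b from funext h]
  rw [h]
  refine (measure_biUnion_finset_le B _).trans ?_
  simp [coinMeasure_cylinder φ hφ]

/-- Schwartz–Zippel over the domain `(ZMod 2)[X]`, with the `2 ^ q` polynomials of degree less than
`q` as sample set. The variables read disjoint blocks of coins because `q ≤ D`, so they are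
independent and uniform, and counting zeros bounds the probability. -/
theorem coinMeasure_aeval_eq_zero_le {N q D t : ℕ} (hqD : q ≤ D) {P : MvPolynomial (Fin N) (ZMod 2)}
    (hP : P ≠ 0) (ht : P.totalDegree ≤ t) :
    coinMeasure {ω | MvPolynomial.aeval (fun a : Fin N => bitPoly q D ω a) P = 0} ≤
      t * (2⁻¹ : ENNReal) ^ q := by
  classical
  let ψ : (Fin q → Bool) → (ZMod 2)[X] := fun s => ∑ d : Fin q, if s d then X ^ (d : ℕ) else 0
  have hψc : ∀ s (d : Fin q), (ψ s).coeff d = if s d then 1 else 0 := by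
    intro s d
    simp only [ψ, finsetSum_coeff, apply_ite (fun p : (ZMod 2)[X] => p.coeff d), coeff_X_pow,
      coeff_zero]
    rw [Finset.sum_eq_single d]
    · simp
    · intro i _ hi; simp [Fin.val_inj, hi.symm]
    · simp
  have hψ : Function.Injective ψ := by
    intro s s' h
    funext d
    have := congrArg (fun p => p.coeff (d : ℕ)) h
    simp only [hψc] at this
    revert this
    cases s d <;> cases s' d <;> simp
  let S : Finset (ZMod 2)[X] := Finset.univ.image ψ
  have hS : S.card = 2 ^ q := by
    rw [Finset.card_image_of_injective _ hψ]; simp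
  let φ : Fin N × Fin q → ℕ := fun p => (p.1 : ℕ) * D + p.2
  have hφ : Function.Injective φ := by
    rintro ⟨a, d⟩ ⟨a', d'⟩ h
    have hd : (d : ℕ) < D := d.2.trans_le hqD
    have hd' : (d' : ℕ) < D := d'.2.trans_le hqD
    simp only [φ] at h
    have h1 : (a : ℕ) = a' := by
      have := congrArg (· / D) h
      simpa [Nat.add_div_of_dvd_right, Nat.mul_add_div, Nat.div_eq_of_lt hd, Nat.div_eq_of_lt hd',
        (show 0 < D by omega), mul_comm _ D] using this
    rw [h1] at h
    exact Prod.ext (Fin.ext h1) (Fin.ext (by simpa using h))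
  let val : (Fin N × Fin q → Bool) → (Fin N → (ZMod 2)[X]) := fun b a => ψ fun d => b (a, d)
  have hvalω : ∀ ω : ℕ → Bool, val (fun i => ω (φ i)) = fun a : Fin N => bitPoly q D ω a := by
    intro ω
    funext a
    simp only [val, ψ, φ, bitPoly, Finset.sum_range]
  have hval : Function.Injective val := by
    intro b b' h
    funext ⟨a, d⟩
    exact congrFun (hψ (congrFun h a)) d
  -- The coefficients are moved into the domain from which the points are drawn; `C` is injective,
  -- so `p` is still nonzero.
  let p : MvPolynomial (Fin N) (ZMod 2)[X] := MvPolynomial.map C P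
  have hp : p ≠ 0 := by
    intro h
    exact hP (MvPolynomial.map_injective C C_injective (by rw [map_zero]; exact h))
  have hpe : ∀ f : Fin N → (ZMod 2)[X], MvPolynomial.eval f p = MvPolynomial.aeval f P := by
    intro f
    rw [MvPolynomial.eval_map, MvPolynomial.aeval_def]; rfl
  have hpt : p.totalDegree ≤ t :=
    (Finset.sup_mono (MvPolynomial.support_map_subset _ _)).trans ht
  let B : Finset (Fin N × Fin q → Bool) :=
    Finset.univ.filter fun b => MvPolynomial.aeval (val b) P = 0
  have hsz := MvPolynomial.schwartz_zippel_totalDegree hp S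
  set Z := (Fintype.piFinset fun _ : Fin N => S).filter fun f => MvPolynomial.eval f p = 0 with hZ
  have hBZ : B.card ≤ Z.card := by
    refine Finset.card_le_card_of_injOn val (fun b hb => ?_) hval.injOn
    have hb := (Finset.mem_filter.1 hb).2
    refine Finset.mem_filter.2 ⟨?_, by rw [hpe]; exact hb⟩
    rw [Fintype.mem_piFinset]
    exact fun a => Finset.mem_image_of_mem _ (Finset.mem_univ _)
  have hnat : B.card * 2 ^ q ≤ t * 2 ^ (N * q) := by
    rw [hS, div_le_div_iff₀ (by positivity) (by positivity)] at hsz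
    have : Z.card * 2 ^ q ≤ p.totalDegree * (2 ^ q) ^ N := by exact_mod_cast hsz
    calc B.card * 2 ^ q ≤ Z.card * 2 ^ q := Nat.mul_le_mul_right _ hBZ
      _ ≤ p.totalDegree * (2 ^ q) ^ N := this
      _ ≤ t * 2 ^ (N * q) := by
        rw [← pow_mul, mul_comm q N]; exact Nat.mul_le_mul_right _ hpt
  have hev : {ω | MvPolynomial.aeval (fun a : Fin N => bitPoly q D ω a) P = 0} =
      {ω : ℕ → Bool | (fun i => ω (φ i)) ∈ B} := by
    ext ω
    simp [B, hvalω]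
  rw [hev]
  refine (coinMeasure_le_card φ hφ B).trans ?_
  have hcard : Fintype.card (Fin N × Fin q) = N * q := by simp
  have hinv : ∀ a : ℕ, (2 : ENNReal) ^ a * 2⁻¹ ^ a = 1 := fun a => by
    rw [← mul_pow, ENNReal.mul_inv_cancel (by simp) (by simp), one_pow]
  have hnat' : (B.card : ENNReal) * 2 ^ q ≤ t * 2 ^ (N * q) := by exact_mod_cast hnat
  calc (B.card : ENNReal) * 2⁻¹ ^ Fintype.card (Fin N × Fin q)
      = (B.card * 2 ^ q) * 2⁻¹ ^ q * 2⁻¹ ^ (N * q) := by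
        rw [hcard, mul_assoc (B.card : ENNReal), hinv, mul_one]
    _ ≤ (t * 2 ^ (N * q)) * 2⁻¹ ^ q * 2⁻¹ ^ (N * q) := by gcongr
    _ = t * 2⁻¹ ^ q * (2 ^ (N * q) * 2⁻¹ ^ (N * q)) := by ring
    _ = t * 2⁻¹ ^ q := by rw [hinv, mul_one]

end Random

/-! ### Paths in graphs as injective sequences -/

section Paths

variable {n : ℕ}

open Classical in
noncomputable def adjB (H : SimpleGraph (Fin n)) (u v : ℕ) : Bool :=
  decide (∃ a b : Fin n, H.Adj a b ∧ u = a ∧ v = b)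

open Classical in
noncomputable def sideB (S : Finset (Fin n)) (u : ℕ) : Bool := decide (∃ a ∈ S, u = (a : ℕ))

theorem adjB_val (H : SimpleGraph (Fin n)) (a b : Fin n) : adjB H a b = true ↔ H.Adj a b := by
  simp only [adjB, decide_eq_true_eq]
  constructor
  · rintro ⟨a', b', h, h1, h2⟩
    rwa [Fin.ext h1, Fin.ext h2]
  · exact fun h => ⟨a, b, h, rfl, rfl⟩

theorem sideB_val (S : Finset (Fin n)) (a : Fin n) : sideB S a = true ↔ a ∈ S := by
  simp only [sideB, decide_eq_true_eq]
  constructor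
  · rintro ⟨a', h, h1⟩
    rwa [Fin.ext h1]
  · exact fun h => ⟨a, h, rfl⟩

theorem adjB_comm (H : SimpleGraph (Fin n)) (u v : ℕ) : adjB H u v = adjB H v u := by
  simp only [adjB, decide_eq_decide]
  constructor <;> rintro ⟨a, b, h, h1, h2⟩ <;> exact ⟨b, a, h.symm, h2, h1⟩

theorem sideB_lt (S : Finset (Fin n)) (u : ℕ) (h : sideB S u) : u < n := by
  simp only [sideB, decide_eq_true_eq] at h
  obtain ⟨a, -, rfl⟩ := h
  exact a.2

theorem sideB_ne_of_adjB {H : SimpleGraph (Fin n)} {S : Finset (Fin n)}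
    (h : H.IsBipartiteWith (S : Set (Fin n)) (S : Set (Fin n))ᶜ) (u v : ℕ) (hu : u < n) (hv : v < n)
    (huv : adjB H u v) : sideB S u ≠ sideB S v := by
  have hadj := (adjB_val H ⟨u, hu⟩ ⟨v, hv⟩).1 huv
  have h1 := sideB_val S ⟨u, hu⟩
  have h2 := sideB_val S ⟨v, hv⟩
  simp only at h1 h2
  intro heq
  rw [heq, h2] at h1
  have := h.mem_of_adj hadj
  simp at this
  tauto

theorem hasKPath_succ_iff (H : SimpleGraph (Fin n)) (j : ℕ) : HasKPath H (j + 1) ↔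
    ∃ v : ℕ → ℕ, (∀ l ≤ j, v l < n) ∧ (∀ l < j, adjB H (v l) (v (l + 1))) ∧
      ∀ l ≤ j, ∀ l' ≤ j, v l = v l' → l = l' := by
  constructor
  · rintro ⟨a, b, p, hp, hlen⟩
    rw [SimpleGraph.Walk.length_support] at hlen
    refine ⟨fun l => p.getVert l, fun l _ => (p.getVert l).2, fun l hl => ?_, fun l hl l' hl' h => ?_⟩
    · exact (adjB_val H _ _).2 (p.adj_getVert_succ (by omega))
    · exact hp.getVert_injOn (by simp; omega) (by simp; omega) (Fin.ext h)
  · rintro ⟨v, hv, hadj, hinj⟩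
    have hn : 0 < n := (Nat.zero_le _).trans_lt (hv 0 (Nat.zero_le _))
    let f : ℕ → Fin n := fun l => if h : v l < n then ⟨v l, h⟩ else ⟨0, hn⟩
    have hf : ∀ l ≤ j, (f l : ℕ) = v l := fun l hl => by simp [f, hv l hl]
    have key : ∀ l ≤ j, ∃ p : H.Walk (f 0) (f l), p.support = (List.range (l + 1)).map f := by
      intro l
      induction l with
      | zero => intro _; exact ⟨.nil, by simp⟩
      | succ l ih =>
        intro hl
        obtain ⟨p, hp⟩ := ih (by omega)
        have h : H.Adj (f l) (f (l + 1)) := by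
          rw [← adjB_val, hf l (by omega), hf (l + 1) hl]; exact hadj l (by omega)
        refine ⟨p.concat h, ?_⟩
        rw [SimpleGraph.Walk.support_concat, hp, List.range_succ (n := l + 1)]
        simp
    obtain ⟨p, hp⟩ := key j le_rfl
    refine ⟨_, _, p, ?_, by simp [hp]⟩
    rw [SimpleGraph.Walk.isPath_def, hp]
    refine List.Nodup.map_on (fun a ha b hb h => ?_) List.nodup_range
    rw [List.mem_range] at ha hb
    refine hinj a (by omega) b (by omega) ?_
    rw [← hf a (by omega), ← hf b (by omega), h]

end Paths

/-! ### Detecting paths by evaluating the walk polynomial at random points. -/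

section Detection

open Polynomial WordRAM MeasureTheory

variable {n : ℕ}

theorem exists_walkPoly_pathVar {H : SimpleGraph (Fin n)} {S : Finset (Fin n)} {k : ℕ} (hk : 0 < k)
    (hbip : H.IsBipartiteWith (S : Set (Fin n)) (S : Set (Fin n))ᶜ) (hpath : HasKPath H k) :
    ∃ x : ℕ → ℕ → ZMod 2, walkPoly n k ((k + 1) / 2) (sideB S) (adjB H) x = 1 := by
  obtain ⟨j, rfl⟩ : ∃ j, k = j + 1 := ⟨k - 1, by omega⟩
  obtain ⟨v, hv, hadj, hinj⟩ := (hasKPath_succ_iff H j).1 hpath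
  have hb := fun u v => sideB_ne_of_adjB hbip u v
  by_cases hs : (j + 1) % 2 = 0 → sideB S (v 0) = true
  · exact ⟨_, walkPoly_pathVar (sideB_lt S) hb rfl rfl hv hadj hinj hs⟩
  -- For even `k` the two ends of a path lie on different sides, so a path with an unlabelled start
  -- is reversed.
  · push Not at hs
    refine ⟨_, walkPoly_pathVar (v := fun l => v (j - l)) (sideB_lt S) hb rfl rfl
      (fun l hl => hv _ (by omega)) (fun l hl => ?_) (fun l hl l' hl' h => ?_) (fun _ => ?_)⟩
    · rw [adjB_comm]
      have := hadj (j - (l + 1)) (by omega)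
      rwa [show j - (l + 1) + 1 = j - l by omega] at this
    · have := hinj _ (by omega) _ (by omega) h
      omega
    · have hpar : ∀ i ≤ j, sideB S (v i) = (i % 2 == 1) := by
        intro i
        induction i with
        | zero => intro _; simpa using hs.2
        | succ i ih =>
          intro hi
          have h1 := hb _ _ (hv i (by omega)) (hv (i + 1) hi) (hadj i (by omega))
          rw [ih (by omega)] at h1
          rcases Nat.mod_two_eq_zero_or_one i with h | h <;>
            simp [h, Nat.add_mod] at h1 ⊢ <;> simpa using h1
      rw [Nat.sub_zero, hpar j le_rfl, show j % 2 = 1 by omega]; rfl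

/-- The variables of the walk polynomial, evaluated at random polynomials. -/
noncomputable def randVar (n m q D : ℕ) (ω : ℕ → Bool) (u v : ℕ) : (ZMod 2)[X] :=
  if u * (n + 2) + v < (n + 2 + m) * (n + 2) then bitPoly q D ω (u * (n + 2) + v) else 0

/-- The numbering `u * (n + 2) + v` is faithful for `v < n + 2`, and by `walkPoly_congr` no other
variables matter. -/
noncomputable def genericVar (n m u v : ℕ) :
    MvPolynomial (Fin ((n + 2 + m) * (n + 2))) (ZMod 2) :=
  if h : u * (n + 2) + v < (n + 2 + m) * (n + 2) then .X ⟨_, h⟩ else 0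

theorem walkPoly_randVar (k m q D : ℕ) (sd : ℕ → Bool) (g : ℕ → ℕ → Bool) (ω : ℕ → Bool) :
    walkPoly n k m sd g (randVar n m q D ω) =
      MvPolynomial.aeval (fun a : Fin ((n + 2 + m) * (n + 2)) => bitPoly q D ω a)
        (walkPoly n k m sd g (genericVar n m)) := by
  rw [← AlgHom.coe_toRingHom, map_walkPoly]
  congr 1
  funext u v
  simp only [randVar, genericVar]
  split_ifs with h <;> simp

theorem totalDegree_walkPoly_genericVar (k m : ℕ) (sd : ℕ → Bool) (g : ℕ → ℕ → Bool) :
    (walkPoly n k m sd g (genericVar n m)).totalDegree ≤ 2 * k + 2 :=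
  totalDegree_walkPoly_le fun u v => by
    unfold genericVar; split_ifs <;> simp [MvPolynomial.totalDegree_X]

/-- This bound determines the number `D` of coefficients kept in the tables: truncation loses
nothing in the final value. -/
theorem natDegree_walkPoly_randVar (k m q D : ℕ) (sd : ℕ → Bool) (g : ℕ → ℕ → Bool)
    (ω : ℕ → Bool) : (walkPoly n k m sd g (randVar n m q D ω)).natDegree ≤ (2 * k + 2) * q := by
  rw [walkPoly_randVar]
  exact MvPolynomial.aeval_natDegree_le _ (totalDegree_walkPoly_genericVar k m sd g) _
    fun a => natDegree_bitPoly_le q D ω a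

theorem hasKPath_of_walkPoly_ne_zero {H : SimpleGraph (Fin n)} {S : Finset (Fin n)} {k : ℕ}
    (hk : 0 < k) (hbip : H.IsBipartiteWith (S : Set (Fin n)) (S : Set (Fin n))ᶜ)
    {x : ℕ → ℕ → (ZMod 2)[X]}
    (h : walkPoly n k ((k + 1) / 2) (sideB S) (adjB H) x ≠ 0) : HasKPath H k := by
  obtain ⟨j, rfl⟩ : ∃ j, k = j + 1 := ⟨k - 1, by omega⟩
  exact (hasKPath_succ_iff H j).2 (exists_path_of_walkPoly_ne_zero (sideB_lt S) (adjB_comm H)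
    (fun u v => sideB_ne_of_adjB hbip u v) rfl rfl h)

/-- The generic walk polynomial is nonzero because a path provides an evaluation in `ZMod 2` with
value one; the rest is Schwartz–Zippel for degree `2 * k + 2`. -/
theorem coinMeasure_walkPoly_eq_zero_le {H : SimpleGraph (Fin n)} {S : Finset (Fin n)}
    {k q D : ℕ} (hk : 0 < k) (hqD : q ≤ D)
    (hbip : H.IsBipartiteWith (S : Set (Fin n)) (S : Set (Fin n))ᶜ) (hpath : HasKPath H k) :
    coinMeasure {ω | walkPoly n k ((k + 1) / 2) (sideB S) (adjB H)
      (randVar n ((k + 1) / 2) q D ω) = 0} ≤ ((2 * k + 2 : ℕ) : ENNReal) * (2⁻¹ : ENNReal) ^ q := by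
  simp only [walkPoly_randVar]
  refine coinMeasure_aeval_eq_zero_le hqD ?_ (totalDegree_walkPoly_genericVar _ _ _ _)
  obtain ⟨x, hx⟩ := exists_walkPoly_pathVar hk hbip hpath
  set m := (k + 1) / 2
  intro h0
  let y : Fin ((n + 2 + m) * (n + 2)) → ZMod 2 := fun a => x (a / (n + 2)) (a % (n + 2))
  have h1 := congrArg (MvPolynomial.eval y) h0
  rw [map_walkPoly, map_zero] at h1
  rw [walkPoly_congr (x' := x), hx] at h1
  · exact one_ne_zero h1
  · intro u hu v hv
    have hlt : u * (n + 2) + v < (n + 2 + m) * (n + 2) := by nlinarith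
    simp only [genericVar, dif_pos hlt, MvPolynomial.eval_X, y]
    congr 1
    · rw [mul_comm, Nat.mul_add_div (by omega), Nat.div_eq_of_lt hv, add_zero]
    · rw [mul_comm, Nat.mul_add_mod, Nat.mod_eq_of_lt hv]

end Detection

/-! ### Tables of polynomials over the field with two elements -/

namespace WordRAM

open Polynomial

section Bits

theorem val_two_lt (a : ZMod 2) : a.val < 2 := ZMod.val_lt a

theorem val_two_xor (a b : ZMod 2) : a.val ^^^ b.val = (a + b).val := by
  revert a b; decide

theorem val_two_and (a b : ZMod 2) : a.val &&& b.val = (a * b).val := by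
  revert a b; decide

theorem xorSum_val {f : ℕ → ℕ} {g : ℕ → ZMod 2} {n : ℕ} (h : ∀ i < n, f i = (g i).val) :
    xorSum f n = (∑ i ∈ Finset.range n, g i).val := by
  induction n with
  | zero => simp [xorSum]
  | succ n ih =>
    rw [xorSum, ih fun i hi => h i (by omega), h n (by omega), Finset.sum_range_succ,
      val_two_xor]

/-- Multiplication of truncated polynomials. -/
theorem xorSum_mul_coeff {F G : (ZMod 2)[X]} {f g : ℕ → ℕ} {d D : ℕ} (hd : d < D)
    (hf : ∀ a ≤ d, f a = (F.coeff a).val) (hg : ∀ a ≤ d, g a = (G.coeff (d - a)).val) :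
    xorSum (fun a => (if a < d + 1 then 1 else 0) * (f a &&& g a)) D = ((F * G).coeff d).val := by
  rw [xorSum_val (g := fun a => if a < d + 1 then F.coeff a * G.coeff (d - a) else 0)]
  · congr 1
    rw [coeff_mul, Finset.Nat.sum_antidiagonal_eq_sum_range_succ_mk, ← Finset.sum_filter]
    refine Finset.sum_congr ?_ fun _ _ => rfl
    ext a
    simp only [Finset.mem_filter, Finset.mem_range]
    omega
  · intro a _
    by_cases ha : a < d + 1
    · rw [if_pos ha, if_pos ha, one_mul, hf a (by omega), hg a (by omega), val_two_and]
    · rw [if_neg ha, if_neg ha, zero_mul, ZMod.val_zero]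

end Bits

section Encoding

theorem encode_div {D d : ℕ} (a : ℕ) (h : d < D) : (a * D + d) / D = a := by
  rw [mul_comm, Nat.mul_add_div (by omega), Nat.div_eq_of_lt h, add_zero]

theorem encode_mod {D d : ℕ} (a : ℕ) (h : d < D) : (a * D + d) % D = d := by
  rw [mul_comm, Nat.mul_add_mod, Nat.mod_eq_of_lt h]

theorem encode_lt {D d a c : ℕ} (ha : a < c) (h : d < D) : a * D + d < c * D :=
  calc a * D + d < a * D + D := by omega
    _ = (a + 1) * D := by ring
    _ ≤ c * D := Nat.mul_le_mul_right _ ha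

theorem encode_lt_encode {D d d' a a' : ℕ} (ha : a < a') (h : d < D) : a * D + d < a' * D + d' :=
  (encode_lt ha h).trans_le (Nat.le_add_right _ _)

theorem exists_encode {D a c : ℕ} (h : a < c * D) : ∃ b < c, ∃ d < D, a = b * D + d := by
  have hD : 0 < D := Nat.pos_of_ne_zero fun h0 => by simp [h0] at h
  exact ⟨a / D, (Nat.div_lt_iff_lt_mul hD).2 h, a % D, Nat.mod_lt _ hD,
    (Nat.div_add_mod' a D).symm⟩

end Encoding

namespace Expr

variable {mem : Arr → ℕ → ℕ} {reg : ℕ → ℕ}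

theorem eval_add (a b : Expr) : (a + b).eval mem reg = a.eval mem reg + b.eval mem reg := rfl
theorem eval_sub (a b : Expr) : (a - b).eval mem reg = a.eval mem reg - b.eval mem reg := rfl
theorem eval_mul (a b : Expr) : (a * b).eval mem reg = a.eval mem reg * b.eval mem reg := rfl
theorem eval_div (a b : Expr) : (a / b).eval mem reg = a.eval mem reg / b.eval mem reg := rfl
theorem eval_mod (a b : Expr) : (a % b).eval mem reg = a.eval mem reg % b.eval mem reg := rfl
theorem eval_xor (a b : Expr) : (a ^^^ b).eval mem reg = a.eval mem reg ^^^ b.eval mem reg := rfl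
theorem eval_and (a b : Expr) : (a &&& b).eval mem reg = a.eval mem reg &&& b.eval mem reg := rfl
theorem eval_ofNat (n : ℕ) : (no_index (OfNat.ofNat n) : Expr).eval mem reg = n := rfl
theorem eval_const (n : ℕ) : (const n).eval mem reg = n := rfl
theorem eval_var (r : ℕ) : (var r).eval mem reg = reg r := rfl
theorem eval_load (A : Arr) (e : Expr) : (load A e).eval mem reg = mem A (e.eval mem reg) := rfl
theorem eval_lt' (a b : Expr) : (op .lt a b).eval mem reg =
    if a.eval mem reg < b.eval mem reg then 1 else 0 := rfl
theorem eval_eq (a b : Expr) : (op .eq a b).eval mem reg =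
    if a.eval mem reg = b.eval mem reg then 1 else 0 := rfl
theorem eval_shr (a b : Expr) : (op .shr a b).eval mem reg =
    a.eval mem reg >>> b.eval mem reg := rfl
theorem eval_or (a b : Expr) : (op .or a b).eval mem reg =
    a.eval mem reg ||| b.eval mem reg := rfl
theorem eval_xsum (r rb : ℕ) (e : Expr) : (xsum r rb e).eval mem reg =
    xorSum (fun i => e.eval mem (Function.update reg r i)) (reg rb) := rfl

end Expr

theorem reach_assign_val {w : ℕ} {ω : ℕ → Bool} {β : ℕ} {σ : State} (hβ : 1 ≤ β)
    (hσ : Bounded β σ) {r x : ℕ} {e : Expr} (hwf : e.wf glob [] vis) (hw : β * e.size ≤ w)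
    (hx : e.eval σ.mem σ.reg = x) (hxβ : x < 2 ^ β) :
    Reach w ω (assign r e) σ (e.cost σ.reg + 1) (σ.setReg r x) ∧ Bounded β (σ.setReg r x) :=
  ⟨hx ▸ reach_assign hβ hσ hwf hw, hσ.setReg hxβ⟩

/-- The registers hold the parameters of an instance: `m` labels, random polynomials with `q`
coefficients, and `D` coefficients for each table entry. -/
structure Params (n k m q D : ℕ) (reg : ℕ → ℕ) : Prop where
  reg_n : reg 0 = n
  reg_k : reg 1 = k
  reg_n2 : reg 2 = n + 2
  reg_M : reg 3 = 2 * (n + 2)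
  reg_q : reg 4 = q
  reg_D : reg 5 = D
  reg_m : reg 6 = m
  reg_P : reg 7 = 2 ^ m
  reg_K : reg 8 = k + 2

theorem Params.congr {n k m q D : ℕ} {reg reg' : ℕ → ℕ} (h : Params n k m q D reg)
    (hr : ∀ r < 9, reg' r = reg r) : Params n k m q D reg' := by
  constructor <;> rw [hr _ (by norm_num)]
  exacts [h.reg_n, h.reg_k, h.reg_n2, h.reg_M, h.reg_q, h.reg_D, h.reg_m, h.reg_P, h.reg_K]

/-- Fill the array `A` with the values of `e`, up to the value of `sz`. -/
def table (A : Arr) (sz e : Expr) : Cmd := .seq (assign 9 sz) (fill A 14 9 e)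

section Table

variable {w : ℕ} {ω : ℕ → Bool} {β : ℕ}

theorem reach_table {σ : State} (hβ : 1 ≤ β) (hσ : Bounded β σ) {A : Arr} {sz e : Expr}
    {val : ℕ → ℕ} {N C : ℕ} (hwfs : sz.wf glob [] vis) (hwfe : e.wf glob [] (vis + 1))
    (hws : β * sz.size ≤ w) (hwe : β * e.size ≤ w) (hN : sz.eval σ.mem σ.reg = N)
    (hNβ : N < 2 ^ β) (hval : ∀ t < N, val t < 2 ^ β)
    (hE : ∀ t < N, e.eval (σ.fillMem A val t).mem
      (Function.update (Function.update σ.reg 9 N) 14 t) = val t)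
    (hC : ∀ t < N, e.cost (Function.update (Function.update σ.reg 9 N) 14 t) ≤ C) :
    Reach w ω (table A sz e) σ (sz.cost σ.reg + N * (C + 6) + 4)
      (((σ.setReg 9 N).fillMem A val N).setReg 14 N) := by
  have h1 := reach_assign (w := w) (ω := ω) (r := 9) hβ hσ hwfs hws
  rw [hN] at h1
  have h9 : (σ.setReg 9 N).reg 9 = N := by simp
  have h2 := reach_fill (w := w) (ω := ω) (A := A) (r := 14) (rb := 9) (C := C) (val := val) hβ
    (hσ.setReg (r := 9) hNβ) (by norm_num) (by norm_num) (by norm_num) hwfe hwe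
    (by rw [h9]; exact hval) (by rw [h9]; exact hE) (by rw [h9]; exact hC)
  rw [h9] at h2
  exact (h1.seq h2).mono (by omega)

/-- The array contains the first `D` coefficients of the polynomials `F a` for `a < c`. -/
def HasTable (D c : ℕ) (F : ℕ → (ZMod 2)[X]) (f : ℕ → ℕ) : Prop :=
  ∀ a < c, ∀ d < D, f (a * D + d) = ((F a).coeff d).val

/-- The coefficients of a family of polynomials, listed in blocks of `D`. -/
noncomputable def coeffList (D : ℕ) (F : ℕ → (ZMod 2)[X]) (t : ℕ) : ℕ :=
  ((F (t / D)).coeff (t % D)).val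

theorem coeffList_encode {D d : ℕ} (F : ℕ → (ZMod 2)[X]) (a : ℕ) (h : d < D) :
    coeffList D F (a * D + d) = ((F a).coeff d).val := by
  rw [coeffList, encode_div a h, encode_mod a h]

theorem coeffList_lt (hβ : 1 ≤ β) (D : ℕ) (F : ℕ → (ZMod 2)[X]) (t : ℕ) :
    coeffList D F t < 2 ^ β :=
  (val_two_lt _).trans_le (by simpa using Nat.pow_le_pow_right (n := 2) (by norm_num) hβ)

/-- The memory in `hE` is known only as far as the running loop guarantees: other arrays are
unchanged, and all entries with a smaller index `a` are complete. Recursive tables need no more. -/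
theorem reach_polyTable {σ : State} (hβ : 1 ≤ β) (hσ : Bounded β σ) {A : Arr} {sz e : Expr}
    {n k m q D c C T : ℕ} (hP : Params n k m q D σ.reg) (F : ℕ → (ZMod 2)[X])
    (hwfs : sz.wf glob [] vis) (hwfe : e.wf glob [] (vis + 1))
    (hws : β * sz.size ≤ w) (hwe : β * e.size ≤ w) (hN : sz.eval σ.mem σ.reg = c * D)
    (hNβ : c * D < 2 ^ β) (hT : sz.cost σ.reg + c * D * (C + 6) + 4 ≤ T)
    (hE : ∀ a < c, ∀ d < D, ∀ (mem : Arr → ℕ → ℕ) (reg : ℕ → ℕ), (∀ B ≠ A, mem B = σ.mem B) →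
      HasTable D a F (mem A) → (∀ r, r ≠ 9 → r ≠ 14 → reg r = σ.reg r) → Params n k m q D reg →
      reg 14 = a * D + d → e.eval mem reg = ((F a).coeff d).val)
    (hC : ∀ reg : ℕ → ℕ, (∀ r, r ≠ 9 → r ≠ 14 → reg r = σ.reg r) → Params n k m q D reg →
      e.cost reg ≤ C) :
    ∃ σ', Reach w ω (table A sz e) σ T σ' ∧ Bounded β σ' ∧
      HasTable D c F (σ'.mem A) ∧ (∀ B ≠ A, σ'.mem B = σ.mem B) ∧ σ'.coins = σ.coins ∧
      ∀ r, r ≠ 9 → r ≠ 14 → σ'.reg r = σ.reg r := by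
  have hr : ∀ t r, r ≠ 9 → r ≠ 14 →
      Function.update (Function.update σ.reg 9 (c * D)) 14 t r = σ.reg r := fun t r h9 h14 => by
    rw [Function.update_of_ne h14, Function.update_of_ne h9]
  have hP' := fun t => hP.congr fun r h => hr t r (by omega) (by omega)
  refine ⟨_, (reach_table hβ hσ (val := coeffList D F) hwfs hwfe hws hwe hN hNβ
    (fun t _ => coeffList_lt hβ D F t) (fun t ht => ?_) (fun t _ => hC _ (hr t) (hP' t))).mono hT,
    ?_, ?_, ?_, rfl, ?_⟩
  · obtain ⟨a, ha, d, hd, rfl⟩ := exists_encode ht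
    rw [coeffList_encode F a hd]
    refine hE a ha d hd _ _ (fun B hB => ?_) (fun a' ha' d' hd' => ?_) (hr _) (hP' _) (by simp)
    · simp [State.fillMem, Function.update_of_ne hB]
    · simp only [State.fillMem, Function.update_self]
      rw [if_pos (encode_lt_encode ha' hd'), coeffList_encode F a' hd']
  · exact ((hσ.setReg hNβ).fillMem fun t _ => coeffList_lt hβ D F t).setReg hNβ
  · intro a ha d hd
    simp only [State.fillMem, State.setReg_mem, Function.update_self]
    rw [if_pos (encode_lt ha hd), coeffList_encode F a hd]
  · intro B hB
    simp [State.fillMem, Function.update_of_ne hB]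
  · intro r h9 h14
    simp [Function.update_of_ne h9, Function.update_of_ne h14]

end Table

/-! ### The parameters of an instance -/

/-- Compute the parameters from `n` and `k`. -/
def setup (E : ℕ) : Cmd :=
  .seq (assign 2 (.var 0 + 2)) (.seq (assign 3 (2 * .var 2)) (.seq (assign 4 (.var 1 + .const E))
    (.seq (assign 5 ((2 * .var 1 + 2) * .var 4 + 1)) (.seq (assign 6 ((.var 1 + 1) / 2))
    (.seq (assign 8 (.var 1 + 2)) (.seq (.const 7 1) (.op .shl 7 7 6)))))))

theorem reach_setup {w : ℕ} {ω : ℕ → Bool} {β E n k : ℕ} {σ : State} (hβ : 1 ≤ β)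
    (hσ : Bounded β σ) (hw : β * (E + 100) ≤ w) (hn : σ.reg 0 = n) (hk : σ.reg 1 = k)
    (h3 : 2 * (n + 2) < 2 ^ β) (h5 : (2 * k + 2) * (k + E) + 1 < 2 ^ β)
    (h4 : k + E + 2 < 2 ^ β) (h7 : 2 ^ ((k + 1) / 2) < 2 ^ β) :
    ∃ σ', Reach w ω (setup E) σ 100 σ' ∧ Bounded β σ' ∧ 
      Params n k ((k + 1) / 2) (k + E) ((2 * k + 2) * (k + E) + 1) σ'.reg ∧ σ'.mem = σ.mem ∧
      σ'.coins = σ.coins ∧ ∀ r, 9 ≤ r → σ'.reg r = σ.reg r := by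
  have hβw : β ≤ w := le_trans (Nat.le_mul_of_pos_right β (by omega)) hw
  have hpw : 2 ^ β ≤ 2 ^ w := Nat.pow_le_pow_right (by norm_num) hβw
  have h1w : 1 < 2 ^ w := Nat.one_lt_two_pow (by omega)
  have hsz : ∀ s, s ≤ E + 100 → β * s ≤ w := fun s hs => (Nat.mul_le_mul_left _ hs).trans hw
  obtain ⟨a2, b2⟩ := reach_assign_val (w := w) (ω := ω) (r := 2) (e := .var 0 + 2) (x := n + 2)
    hβ hσ rfl (hsz _ (show 1 + (2 + 1) + 1 ≤ _ by omega))
    (by simp [Expr.eval_add, Expr.eval_var, Expr.eval_ofNat, hn]) (by omega)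
  obtain ⟨a3, b3⟩ := reach_assign_val (w := w) (ω := ω) (r := 3) (e := 2 * .var 2)
    (x := 2 * (n + 2)) hβ b2 rfl (hsz _ (show (2 + 1) + 1 + 1 ≤ _ by omega))
    (by simp [Expr.eval_mul, Expr.eval_var, Expr.eval_ofNat]) (by omega)
  obtain ⟨a4, b4⟩ := reach_assign_val (w := w) (ω := ω) (r := 4) (e := .var 1 + .const E)
    (x := k + E) hβ b3 rfl (hsz _ (show 1 + (E + 1) + 1 ≤ _ by omega))
    (by simp [Expr.eval_add, Expr.eval_var, Expr.eval_const, hk]) (by omega)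
  obtain ⟨a5, b5⟩ := reach_assign_val (w := w) (ω := ω) (r := 5)
    (e := (2 * .var 1 + 2) * .var 4 + 1) (x := (2 * k + 2) * (k + E) + 1) hβ b4 rfl
    (hsz _ (show (((2 + 1) + 1 + 1) + (2 + 1) + 1) + 1 + 1 + (1 + 1) + 1 ≤ _ by omega))
    (by simp [Expr.eval_add, Expr.eval_mul, Expr.eval_var, Expr.eval_ofNat, hk]) (by omega)
  obtain ⟨a6, b6⟩ := reach_assign_val (w := w) (ω := ω) (r := 6) (e := (.var 1 + 1) / 2)
    (x := (k + 1) / 2) hβ b5 rfl (hsz _ (show (1 + (1 + 1) + 1) + (2 + 1) + 1 ≤ _ by omega))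
    (by simp [Expr.eval_add, Expr.eval_div, Expr.eval_var, Expr.eval_ofNat, hk]) (by omega)
  obtain ⟨a8, b8⟩ := reach_assign_val (w := w) (ω := ω) (r := 8) (e := .var 1 + 2) (x := k + 2)
    hβ b6 rfl (hsz _ (show 1 + (2 + 1) + 1 ≤ _ by omega))
    (by simp [Expr.eval_add, Expr.eval_var, Expr.eval_ofNat, hk]) (by omega)
  refine ⟨_, (a2.seq (a3.seq (a4.seq (a5.seq (a6.seq (a8.seq (reach_const.seq (reach_op
    (by norm_num) (by norm_num))))))))).mono
    (show 6 + (6 + (6 + (18 + (10 + (6 + (1 + 1)))))) ≤ 100 by norm_num), ?_, ?_, rfl, rfl, ?_⟩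
  · refine (b8.setReg ?_).setReg ?_
    · rw [Nat.mod_eq_of_lt h1w]; exact Nat.one_lt_two_pow (by omega)
    · simpa [Op.eval, Nat.mod_eq_of_lt h1w, Nat.shiftLeft_eq, Nat.mod_eq_of_lt (h7.trans_le hpw)]
        using h7
  · constructor <;> simp [Op.eval, hn, hk, Nat.mod_eq_of_lt h1w, Nat.shiftLeft_eq,
      Nat.mod_eq_of_lt (h7.trans_le hpw)]
  · intro r hr
    simp [Function.update_of_ne (show r ≠ 2 by omega), Function.update_of_ne (show r ≠ 3 by omega),
      Function.update_of_ne (show r ≠ 4 by omega), Function.update_of_ne (show r ≠ 5 by omega),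
      Function.update_of_ne (show r ≠ 6 by omega), Function.update_of_ne (show r ≠ 7 by omega),
      Function.update_of_ne (show r ≠ 8 by omega)]

end WordRAM

/-! ### Powers of a matrix after an update -/

section Update

variable {A : Type*} [CommRing A]

/-- Split each walk containing a `Δ`-step at the last such step: before it the updated matrix acts,
after it only `N`. The proof is by induction on `j`, the new summand `i = j` being the walks whose
last step is a `Δ`-step. -/
theorem powW_add (N Δ : ℕ → ℕ → A) {M p q : ℕ} (hq : q < M) (j : ℕ) :
    powW (fun a b => N a b + Δ a b) M j p q = powW N M j p q +
      ∑ i ∈ Finset.range j, ∑ a ∈ Finset.range M, ∑ b ∈ Finset.range M,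
        powW (fun a b => N a b + Δ a b) M i p a * Δ a b * powW N M (j - 1 - i) b q := by
  induction j generalizing q with
  | zero => simp [powW]
  | succ j ih =>
    rw [Finset.sum_range_succ]
    have h1 : ∑ a ∈ Finset.range M, ∑ b ∈ Finset.range M,
        powW (fun a b => N a b + Δ a b) M j p a * Δ a b * powW N M (j + 1 - 1 - j) b q =
        ∑ a ∈ Finset.range M, powW (fun a b => N a b + Δ a b) M j p a * Δ a q := by
      refine Finset.sum_congr rfl fun a _ => ?_
      simp only [Nat.add_sub_cancel, Nat.sub_self, powW, mul_ite, mul_one, mul_zero]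
      rw [Finset.sum_ite_eq', if_pos (Finset.mem_range.2 hq)]
    have h2 : ∑ i ∈ Finset.range j, ∑ a ∈ Finset.range M, ∑ b ∈ Finset.range M,
        powW (fun a b => N a b + Δ a b) M i p a * Δ a b * powW N M (j + 1 - 1 - i) b q =
        ∑ r ∈ Finset.range M, (∑ i ∈ Finset.range j, ∑ a ∈ Finset.range M, ∑ b ∈ Finset.range M,
          powW (fun a b => N a b + Δ a b) M i p a * Δ a b * powW N M (j - 1 - i) b r) * N r q := by
      simp only [Finset.sum_mul]
      symm
      rw [Finset.sum_comm]
      refine Finset.sum_congr rfl fun i hi => ?_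
      rw [Finset.sum_comm]
      refine Finset.sum_congr rfl fun a _ => ?_
      rw [Finset.sum_comm]
      refine Finset.sum_congr rfl fun b _ => ?_
      have hi := Finset.mem_range.1 hi
      rw [show j + 1 - 1 - i = (j - 1 - i) + 1 by omega, powW, Finset.mul_sum]
      exact Finset.sum_congr rfl fun r _ => by ring
    rw [h1, h2, powW, powW, ← add_assoc, ← Finset.sum_add_distrib, ← Finset.sum_add_distrib]
    refine Finset.sum_congr rfl fun r hr => ?_
    rw [mul_add, ← add_mul, ← ih (Finset.mem_range.1 hr)]

theorem sum_range_eq_sum_comp {M B : ℕ} {p : ℕ → ℕ} (hp : ∀ b < B, p b < M)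
    (hinj : ∀ b < B, ∀ c < B, p b = p c → b = c) (f : ℕ → A)
    (hf : ∀ a < M, f a ≠ 0 → ∃ b < B, p b = a) :
    ∑ a ∈ Finset.range M, f a = ∑ b ∈ Finset.range B, f (p b) := by
  rw [← Finset.sum_image (f := f) (g := p) (s := Finset.range B)
    (fun b hb c hc h => hinj b (by simpa using hb) c (by simpa using hc) h)]
  symm
  refine Finset.sum_subset (fun a ha => ?_) (fun a ha hna => ?_)
  · obtain ⟨b, hb, rfl⟩ := Finset.mem_image.1 ha
    exact Finset.mem_range.2 (hp b (Finset.mem_range.1 hb))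
  · by_contra h
    obtain ⟨b, hb, rfl⟩ := hf a (Finset.mem_range.1 ha) h
    exact hna (Finset.mem_image_of_mem _ (Finset.mem_range.2 hb))

/-- Powers of a matrix that differs from `N` only in rows and columns listed by `p`. -/
theorem powW_update {N N' Δ : ℕ → ℕ → A} {M B s q : ℕ} {p : ℕ → ℕ} (hp : ∀ b < B, p b < M)
    (hinj : ∀ b < B, ∀ c < B, p b = p c → b = c)
    (hN : ∀ a < M, ∀ b < M, N' a b = N a b + Δ a b)
    (hΔ : ∀ a < M, ∀ b < M, Δ a b ≠ 0 → (∃ i < B, p i = a) ∧ ∃ i < B, p i = b)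
    (hs : s < M) (hq : q < M) (j : ℕ) :
    powW N' M j s q = powW N M j s q +
      ∑ i ∈ Finset.range j, ∑ b ∈ Finset.range B, ∑ c ∈ Finset.range B,
        powW N' M i s (p b) * (Δ (p b) (p c) * powW N M (j - 1 - i) (p c) q) := by
  rw [powW_congr hN j s hs q hq, powW_add N Δ hq j]
  congr 1
  refine Finset.sum_congr rfl fun i _ => ?_
  have hin : ∀ a < M, ∑ b ∈ Finset.range M,
      powW (fun a b => N a b + Δ a b) M i s a * Δ a b * powW N M (j - 1 - i) b q =
      ∑ c ∈ Finset.range B, powW N' M i s a * (Δ a (p c) * powW N M (j - 1 - i) (p c) q) := by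
    intro a ha
    rw [sum_range_eq_sum_comp hp hinj _ fun b hb h =>
      (hΔ a ha b hb fun h0 => h (by rw [h0]; ring)).2]
    refine Finset.sum_congr rfl fun c _ => ?_
    rw [powW_congr hN i s hs a ha, mul_assoc]
  rw [Finset.sum_congr rfl fun a ha => hin a (Finset.mem_range.1 ha)]
  refine sum_range_eq_sum_comp hp hinj _ fun a ha h => ?_
  obtain ⟨c, hc, hne⟩ := Finset.exists_ne_zero_of_sum_ne_zero h
  exact (hΔ a ha _ (hp c (Finset.mem_range.1 hc)) fun h0 => hne (by rw [h0]; ring)).1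

/-- In characteristic two inserting and deleting an edge are the same operation, namely adding its
step weight, so only the set of changed pairs matters. -/
theorem edgeW_eq_add [CharP A 2] {n k m : ℕ} {sd : ℕ → Bool} {g h : ℕ → ℕ → Bool}
    {x : ℕ → ℕ → A} (hg : ∀ u v, g u v → u < n ∧ v < n) (hh : ∀ u v, h u v → u < n ∧ v < n)
    (X p q : ℕ) : edgeW n k m sd h x X p q = edgeW n k m sd g x X p q +
      if (h (p / 2) (q / 2) ^^ g (p / 2) (q / 2)) then stepW n k m sd x X p q else 0 := by
  have h1 : ∀ f : ℕ → ℕ → Bool, (∀ u v, f u v → u < n ∧ v < n) → ∀ u v, extAdj n f u v =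
      (f u v ^^ ((u == n && decide (v < n)) || (decide (u < n) && v == n + 1))) := by
    intro f hf u v
    have := hf u v
    rcases hfv : f u v with _ | _
    · simp [extAdj, hfv]
    · obtain ⟨hu, hv⟩ := this hfv
      have h1 : u ≠ n := by omega
      have h2 : v ≠ n + 1 := by omega
      simp [extAdj, hfv, hu, hv, h1, h2]
  unfold edgeW
  rw [h1 h hh, h1 g hg]
  rcases h (p / 2) (q / 2) <;> rcases g (p / 2) (q / 2) <;>
    rcases ((p / 2 == n && decide (q / 2 < n)) || (decide (p / 2 < n) && q / 2 == n + 1)) <;>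
    simp [CharTwo.add_self_eq_zero]

end Update

/-! ### Evaluation and cost of table lookups, convolutions and Boolean expressions. -/

namespace WordRAM

open Polynomial

namespace Expr

variable {mem : Arr → ℕ → ℕ} {reg : ℕ → ℕ}

theorem cost_const (n : ℕ) : (const n).cost reg = 1 := rfl
theorem cost_ofNat (n : ℕ) : (no_index (OfNat.ofNat n) : Expr).cost reg = 1 := rfl
theorem cost_var (r : ℕ) : (var r).cost reg = 1 := rfl
theorem cost_op (o : Op) (a b : Expr) : (op o a b).cost reg = a.cost reg + b.cost reg + 3 := rfl
theorem cost_add (a b : Expr) : (a + b).cost reg = a.cost reg + b.cost reg + 3 := rfl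
theorem cost_sub (a b : Expr) : (a - b).cost reg = a.cost reg + b.cost reg + 3 := rfl
theorem cost_mul (a b : Expr) : (a * b).cost reg = a.cost reg + b.cost reg + 3 := rfl
theorem cost_div (a b : Expr) : (a / b).cost reg = a.cost reg + b.cost reg + 3 := rfl
theorem cost_mod (a b : Expr) : (a % b).cost reg = a.cost reg + b.cost reg + 3 := rfl
theorem cost_xor (a b : Expr) : (a ^^^ b).cost reg = a.cost reg + b.cost reg + 3 := rfl
theorem cost_and (a b : Expr) : (a &&& b).cost reg = a.cost reg + b.cost reg + 3 := rfl
theorem cost_load (A : Arr) (e : Expr) : (load A e).cost reg = e.cost reg + 1 := rfl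
theorem cost_xsum (r rb : ℕ) (e : Expr) :
    (xsum r rb e).cost reg = reg rb * (e.cost reg + 5) + 4 := rfl

attribute [simp] eval_add eval_sub eval_mul eval_div eval_mod eval_xor eval_and eval_ofNat
  eval_const eval_var eval_load eval_lt' eval_eq eval_shr eval_or
  cost_const cost_ofNat cost_var cost_op cost_add cost_sub cost_mul cost_div cost_mod cost_xor
  cost_and cost_load cost_xsum

/-- The entry `d` of the block `i` of a table; register `5` holds the length of the blocks. -/
def entry (A : Arr) (i d : Expr) : Expr := .load A (i * .var 5 + d)

/-- The coefficient `d` of the product of two polynomials with coefficients `f` and `g`, where `g`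
refers to the complementary position; `r` is the position. -/
def conv (r : ℕ) (d f g : Expr) : Expr :=
  .xsum r 5 (.op .lt (.var r) (d + 1) * (f &&& g))

theorem eval_entry {A : Arr} {i d : Expr} {D c i₀ d₀ : ℕ} {F : ℕ → (ZMod 2)[X]}
    (h5 : reg 5 = D) (h : HasTable D c F (mem A)) (hi : i.eval mem reg = i₀) (hic : i₀ < c)
    (hd : d.eval mem reg = d₀) (hdD : d₀ < D) :
    (entry A i d).eval mem reg = ((F i₀).coeff d₀).val := by
  rw [entry, eval_load, eval_add, eval_mul, eval_var, h5, hi, hd, h i₀ hic d₀ hdD]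

theorem eval_conv {r D d₀ : ℕ} {d f g : Expr} {F G : (ZMod 2)[X]} (h5 : reg 5 = D)
    (hd : ∀ a, d.eval mem (Function.update reg r a) = d₀) (hd₀ : d₀ < D)
    (hf : ∀ a ≤ d₀, f.eval mem (Function.update reg r a) = (F.coeff a).val)
    (hg : ∀ a ≤ d₀, g.eval mem (Function.update reg r a) = (G.coeff (d₀ - a)).val) :
    (conv r d f g).eval mem reg = ((F * G).coeff d₀).val := by
  rw [conv, eval_xsum, h5, ← xorSum_mul_coeff hd₀ hf hg]
  congr 1
  funext a
  simp [hd]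

theorem eval_xsum_val {r rb N : ℕ} {e : Expr} {F : ℕ → ZMod 2} (hN : reg rb = N)
    (h : ∀ i < N, e.eval mem (Function.update reg r i) = (F i).val) :
    (xsum r rb e).eval mem reg = (∑ i ∈ Finset.range N, F i).val := by
  rw [eval_xsum, hN, xorSum_val h]

@[simp] theorem cost_entry (A : Arr) (i d : Expr) :
    (entry A i d).cost reg = i.cost reg + d.cost reg + 8 := by
  simp only [entry, cost_load, cost_add, cost_mul, cost_var]; omega

@[simp] theorem cost_conv (r : ℕ) (d f g : Expr) :
    (conv r d f g).cost reg = reg 5 * (d.cost reg + f.cost reg + g.cost reg + 19) + 4 := by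
  simp only [conv, cost_xsum, cost_and, cost_add, cost_mul, cost_var, cost_op, cost_ofNat]; ring

end Expr

section Loops

variable {w : ℕ} {ω : ℕ → Bool}

/-- Turns an invariant into the sequence of states required by `reach_forLoop`, by choosing a
successor state in each iteration. -/
theorem reach_forLoop_of_invariant (hw : 1 ≤ w) {r rb N T : ℕ} {body : Cmd}
    (Inv : ℕ → State → Prop) (hne : r ≠ rb) (hr : r < vis) (hrb : rb < vis) (hNw : N < 2 ^ w)
    (hN : ∀ i σ, Inv i σ → σ.reg rb = N) {σ : State} (h0 : Inv 0 σ)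
    (hbody : ∀ i < N, ∀ σ, Inv i σ → ∃ σ', Reach w ω body (σ.setReg r i) T (σ'.setReg r i) ∧
      Inv (i + 1) σ') :
    ∃ σ', Reach w ω (forLoop r rb vis body) σ (N * (T + 4) + 3) (σ'.setReg r N) ∧ Inv N σ' := by
  classical
  choose! f hf using hbody
  let S : ℕ → State := fun i => Nat.rec σ (fun i s => f i s) i
  have hS : ∀ i, i ≤ N → Inv i (S i) := by
    intro i
    induction i with
    | zero => exact fun _ => h0
    | succ i ih => exact fun hi => (hf i (by omega) _ (ih (by omega))).2
  exact ⟨S N, reach_forLoop hw S hne hr hrb (fun i hi => hN i _ (hS i hi)) hNw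
    (fun i hi => (hf i hi _ (hS i hi.le)).1), hS N le_rfl⟩

end Loops

section Bits

theorem toNat_and (a b : Bool) : a.toNat &&& b.toNat = (a && b).toNat := by
  revert a b; decide

theorem toNat_or (a b : Bool) : a.toNat ||| b.toNat = (a || b).toNat := by
  revert a b; decide

theorem toNat_xor (a b : Bool) : a.toNat ^^^ b.toNat = (a ^^ b).toNat := by
  revert a b; decide

theorem one_sub_toNat (a : Bool) : 1 - a.toNat = (!a).toNat := by
  revert a; decide

theorem ite_eq_toNat (p : Prop) [Decidable p] : (if p then 1 else 0) = (decide p).toNat := by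
  by_cases h : p <;> simp [h]

theorem toNat_mul_val (a : Bool) (x : ZMod 2) : a.toNat * x.val = (if a then x else 0).val := by
  cases a <;> simp

theorem shiftRight_and_one (X i : ℕ) : (X >>> i) % 2 = (X.testBit i).toNat := by
  rw [Nat.toNat_testBit, Nat.shiftRight_eq_div_pow]

theorem coeff_one_val (d : ℕ) : ((1 : (ZMod 2)[X]).coeff d).val = (decide (d = 0)).toNat := by
  rw [coeff_one]
  by_cases h : d = 0 <;> simp [h, ZMod.val_one]

theorem coeff_ite (p : Prop) [Decidable p] (F : (ZMod 2)[X]) (d : ℕ) :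
    (if p then F else 0).coeff d = if p then F.coeff d else 0 := by
  split_ifs <;> simp

end Bits

end WordRAM

/-! ### The preprocessing -/

namespace WordRAM

open WordRAM.Expr
open scoped Polynomial

/-- The index of the current entry of a table, and its position within the entry. -/
def curIdx : Expr := .var 14 / .var 5
def curPos : Expr := .var 14 % .var 5

theorem eval_curIdx {mem : Arr → ℕ → ℕ} {reg : ℕ → ℕ} {a d D : ℕ} (h5 : reg 5 = D) (hd : d < D)
    (h : reg 14 = a * D + d) : curIdx.eval mem reg = a := by
  simp [curIdx, h5, h, encode_div a hd]

theorem eval_curPos {mem : Arr → ℕ → ℕ} {reg : ℕ → ℕ} {a d D : ℕ} (h5 : reg 5 = D) (hd : d < D)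
    (h : reg 14 = a * D + d) : curPos.eval mem reg = d := by
  simp [curPos, h5, h, encode_mod a hd]

@[simp] theorem cost_curIdx (reg : ℕ → ℕ) : curIdx.cost reg = 5 := rfl
@[simp] theorem cost_curPos (reg : ℕ → ℕ) : curPos.cost reg = 5 := rfl

/-- `n`, `k` and the tables for the walks in the given graph. -/
structure Stored (n k m D : ℕ) (sd : ℕ → Bool) (g : ℕ → ℕ → Bool) (x : ℕ → ℕ → (ZMod 2)[X])
    (mem : Arr → ℕ → ℕ) : Prop where
  size : mem (.data 0) 0 = n
  length : mem (.data 0) 1 = k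
  adj : ∀ u < n + 2, ∀ v < n + 2, mem (.data 1) (u * (n + 2) + v) = (extAdj n g u v).toNat
  step : HasTable D (2 ^ m * (2 * (n + 2)) * (2 * (n + 2)))
    (fun a => stepW n k m sd x (a / (2 * (n + 2)) / (2 * (n + 2))) (a / (2 * (n + 2)) % (2 * (n + 2)))
      (a % (2 * (n + 2)))) (mem (.data 2))
  pow : HasTable D (2 ^ m * (k + 2) * (2 * (n + 2)) * (2 * (n + 2)))
    (fun a => powW (edgeW n k m sd g x (a / (2 * (n + 2)) / (2 * (n + 2)) / (k + 2))) (2 * (n + 2))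
      (a / (2 * (n + 2)) / (2 * (n + 2)) % (k + 2)) (a / (2 * (n + 2)) % (2 * (n + 2)))
      (a % (2 * (n + 2)))) (mem (.data 3))

section Tables

variable {w : ℕ} {ω : ℕ → Bool} {β n k m q D : ℕ} {σ : State} {sd : ℕ → Bool}
  {g : ℕ → ℕ → Bool} {x : ℕ → ℕ → (ZMod 2)[X]}

def labelExpr : Expr :=
  .load (.work 1) (curIdx % .var 2) * .xsum 100 6 ((.op .shr (curIdx / .var 2) (.var 100)) % 2 *
    entry (.work 2) ((.var 2 + .var 100) * .var 2 + curIdx % .var 2) curPos) +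
  (1 - .load (.work 1) (curIdx % .var 2)) * .op .eq curPos 0

theorem reach_labelTable (hβ : 1 ≤ β) (hσ : Bounded β σ) (hP : Params n k m q D σ.reg)
    (hw : β * 1000 ≤ w) (hNβ : 2 ^ m * (n + 2) * D < 2 ^ β)
    (hsd : ∀ u, σ.mem (.work 1) u = (sd u).toNat)
    (hx : HasTable D ((n + 2 + m) * (n + 2)) (fun a => x (a / (n + 2)) (a % (n + 2)))
      (σ.mem (.work 2))) :
    ∃ σ', Reach w ω (table (.work 3) (.var 7 * .var 2 * .var 5) labelExpr) σ
        (2 ^ m * (n + 2) * D * (200 * (m + 1)) + 20) σ' ∧ Bounded β σ' ∧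
      HasTable D (2 ^ m * (n + 2)) (fun a => labelW n m sd x (a / (n + 2)) (a % (n + 2)))
        (σ'.mem (.work 3)) ∧ (∀ B ≠ .work 3, σ'.mem B = σ.mem B) ∧ σ'.coins = σ.coins ∧
      ∀ r, r ≠ 9 → r ≠ 14 → σ'.reg r = σ.reg r := by
  have hsz : ∀ s, s ≤ 1000 → β * s ≤ w := fun s hs => (Nat.mul_le_mul_left _ hs).trans hw
  refine reach_polyTable (C := 150 * (m + 1)) hβ hσ hP _ rfl rfl (hsz _ (by decide))
    (hsz _ (by decide)) (by simp [hP.reg_P, hP.reg_n2, hP.reg_D]) hNβ ?_ ?_ ?_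
  · have := Nat.mul_le_mul_left (2 ^ m * (n + 2) * D)
      (show 150 * (m + 1) + 6 ≤ 200 * (m + 1) by omega)
    simp only [cost_mul, cost_var]
    omega
  · intro a ha d hd mem reg hmem _ _ hR h14
    have hn2 : a % (n + 2) < n + 2 := Nat.mod_lt _ (by omega)
    have e1 : ∀ i, curIdx.eval mem (Function.update reg 100 i) = a :=
      fun i => eval_curIdx (by simpa using hR.reg_D) hd (by simpa using h14)
    have e2 : ∀ i, curPos.eval mem (Function.update reg 100 i) = d :=
      fun i => eval_curPos (by simpa using hR.reg_D) hd (by simpa using h14)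
    have e3 : curIdx.eval mem reg = a := eval_curIdx hR.reg_D hd h14
    have e4 : curPos.eval mem reg = d := eval_curPos hR.reg_D hd h14
    have e5 := eval_xsum_val (mem := mem) (reg := reg) (r := 100) (rb := 6)
      (e := (.op .shr (curIdx / .var 2) (.var 100)) % 2 *
        entry (.work 2) ((.var 2 + .var 100) * .var 2 + curIdx % .var 2) curPos)
      (F := fun i => if (a / (n + 2)).testBit i then (x (n + 2 + i) (a % (n + 2))).coeff d else 0)
      hR.reg_m (by
        intro i hi
        rw [eval_mul, eval_entry (by simpa using hR.reg_D) (hmem (.work 2) (by decide) ▸ hx)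
          (i₀ := (n + 2 + i) * (n + 2) + a % (n + 2)) (by simp [e1, hR.reg_n2])
          (encode_lt (by omega) hn2) (e2 i) hd]
        simp only [encode_div _ hn2, encode_mod _ hn2, eval_mod, eval_shr, eval_div, e1, eval_var,
          eval_ofNat, Function.update_self, Function.update_of_ne (show (2 : ℕ) ≠ 100 by decide),
          hR.reg_n2, shiftRight_and_one, toNat_mul_val])
    rw [labelExpr, eval_add, eval_mul, e5]
    simp only [eval_mul, eval_sub, eval_load, eval_mod, e3, eval_var, hR.reg_n2, eval_ofNat,
      eval_eq, e4, hmem (.work 1) (by decide), hsd, one_sub_toNat, ite_eq_toNat]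
    unfold labelW bitSum
    cases sd (a % (n + 2)) <;> simp [coeff_one_val, coeff_ite]
  · intro reg _ hR
    simp only [labelExpr, cost_add, cost_mul, cost_load, cost_mod, cost_curIdx, cost_var, cost_xsum,
      cost_op, cost_div, cost_ofNat, cost_entry, cost_sub, cost_curPos, hR.reg_m]
    omega

/-- Admissibility of the states `p` and `q` for the label set `X`. -/
def okayExpr (X p q : Expr) : Expr :=
  .op .or (.op .eq (p % 2) 0) (.load (.work 1) (p / 2)) &&&
  .op .or (.op .eq (q % 2) 0) (.load (.work 1) (q / 2)) &&&
  .op .or (.op .or (1 - .op .eq (p / 2) (.var 0)) (.load (.work 1) (q / 2)))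
    (.op .eq (.var 1 % 2) 1 &&& .op .eq (X % 2) 1)

theorem eval_okayExpr {mem : Arr → ℕ → ℕ} {reg : ℕ → ℕ} {X p q : Expr} (h0 : reg 0 = n)
    (h1 : reg 1 = k) (hsd : ∀ u, mem (.work 1) u = (sd u).toNat) :
    (okayExpr X p q).eval mem reg =
      (okay n k sd (X.eval mem reg) (p.eval mem reg) (q.eval mem reg)).toNat := by
  have he : ∀ a b : Expr, (Expr.op .eq a b).eval mem reg =
      (a.eval mem reg == b.eval mem reg).toNat := fun a b => by
    rw [eval_eq]
    by_cases h : eval mem a reg = eval mem b reg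
    · simp [h]
    · rw [if_neg h, beq_eq_false_iff_ne.2 h]; rfl
  simp only [okayExpr, eval_and, eval_or, he, eval_mod, eval_ofNat, eval_load, eval_div, hsd,
    eval_sub, eval_var, h0, h1, one_sub_toNat, toNat_or, toNat_and, okay, Nat.testBit_zero]
  congr 1

/-- The index of the variable of the states `p` and `q`. -/
def pairExpr (p q : Expr) : Expr :=
  .op .eq (p % 2 + q % 2) 0 * (p / 2 * .var 2 + q / 2) +
  (1 - .op .eq (p % 2 + q % 2) 0) * (q / 2 * .var 2 + p / 2)

def stepExpr : Expr :=
  okayExpr (curIdx / .var 3 / .var 3) (curIdx / .var 3 % .var 3) (curIdx % .var 3) *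
  conv 100 curPos
    (entry (.work 3) (curIdx / .var 3 / .var 3 * .var 2 + (curIdx / .var 3 % .var 3) / 2) (.var 100))
    (entry (.work 2) (pairExpr (curIdx / .var 3 % .var 3) (curIdx % .var 3)) (curPos - .var 100))

theorem reach_stepTable (hβ : 1 ≤ β) (hσ : Bounded β σ) (hP : Params n k m q D σ.reg)
    (hw : β * 1000 ≤ w) (hNβ : 2 ^ m * (2 * (n + 2)) * (2 * (n + 2)) * D < 2 ^ β)
    (hsd : ∀ u, σ.mem (.work 1) u = (sd u).toNat)
    (hx : HasTable D ((n + 2 + m) * (n + 2)) (fun a => x (a / (n + 2)) (a % (n + 2)))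
      (σ.mem (.work 2)))
    (hY : HasTable D (2 ^ m * (n + 2)) (fun a => labelW n m sd x (a / (n + 2)) (a % (n + 2)))
        (σ.mem (.work 3))) :
    ∃ σ', Reach w ω (table (.data 2) (.var 7 * .var 3 * .var 3 * .var 5) stepExpr) σ
        (2 ^ m * (2 * (n + 2)) * (2 * (n + 2)) * D * (600 * (D + 1)) + 20) σ' ∧ Bounded β σ' ∧
      HasTable D (2 ^ m * (2 * (n + 2)) * (2 * (n + 2)))
        (fun a => stepW n k m sd x (a / (2 * (n + 2)) / (2 * (n + 2)))
          (a / (2 * (n + 2)) % (2 * (n + 2))) (a % (2 * (n + 2)))) (σ'.mem (.data 2)) ∧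
      (∀ B ≠ .data 2, σ'.mem B = σ.mem B) ∧ σ'.coins = σ.coins ∧
      ∀ r, r ≠ 9 → r ≠ 14 → σ'.reg r = σ.reg r := by
  have hsz : ∀ s, s ≤ 1000 → β * s ≤ w := fun s hs => (Nat.mul_le_mul_left _ hs).trans hw
  refine reach_polyTable (C := 500 * (D + 1)) hβ hσ hP _ rfl rfl (hsz _ (by decide))
    (hsz _ (by decide)) (by simp [hP.reg_P, hP.reg_M, hP.reg_D]) hNβ ?_ ?_ ?_
  · have := Nat.mul_le_mul_left (2 ^ m * (2 * (n + 2)) * (2 * (n + 2)) * D)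
      (show 500 * (D + 1) + 6 ≤ 600 * (D + 1) by omega)
    simp only [cost_mul, cost_var]
    omega
  · intro a ha d hd mem reg hmem _ _ hR h14
    set M := 2 * (n + 2) with hM
    have hM0 : 0 < M := by omega
    have hp : a / M % M < M := Nat.mod_lt _ hM0
    have hq : a % M < M := Nat.mod_lt _ hM0
    have hX : a / M / M < 2 ^ m := by
      rw [Nat.div_div_eq_div_mul, Nat.div_lt_iff_lt_mul (by positivity), ← mul_assoc]; exact ha
    have e1 : ∀ i, curIdx.eval mem (Function.update reg 100 i) = a :=
      fun i => eval_curIdx (by simpa using hR.reg_D) hd (by simpa using h14)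
    have e2 : ∀ i, curPos.eval mem (Function.update reg 100 i) = d :=
      fun i => eval_curPos (by simpa using hR.reg_D) hd (by simpa using h14)
    have h3 : reg 3 = M := hR.reg_M
    have e3 : curIdx.eval mem reg = a := eval_curIdx hR.reg_D hd h14
    have hsd' : ∀ u, mem (.work 1) u = (sd u).toNat := by
      rw [hmem (.work 1) (by decide)]; exact hsd
    have hu : a / M % M / 2 < n + 2 := by omega
    have hv : a % M / 2 < n + 2 := by omega
    have hr : ∀ i, (Function.update reg 100 i) 2 = n + 2 := fun i => by simpa using hR.reg_n2
    have hr3 : ∀ i, (Function.update reg 100 i) 3 = M := fun i => by simpa using hR.reg_M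
    rw [stepExpr, eval_mul, eval_okayExpr hR.reg_n hR.reg_k hsd', eval_conv (D := D) (d₀ := d)
      (F := labelW n m sd x (a / M / M) (a / M % M / 2)) (G := varW x (a / M % M) (a % M))
      hR.reg_D e2 hd ?_ ?_]
    · simp only [eval_div, eval_mod, e3, eval_var, h3, toNat_mul_val, stepW, coeff_ite]
    · intro i hi
      rw [eval_entry (D := D) (by simpa using hR.reg_D) (hmem (.work 3) (by decide) ▸ hY)
        (i₀ := a / M / M * (n + 2) + a / M % M / 2)
        (by simp only [eval_add, eval_mul, eval_div, eval_mod, e1, eval_var, eval_ofNat, hr, hr3])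
        (encode_lt hX hu) (d₀ := i) (by simp) (by omega), encode_div _ hu, encode_mod _ hu]
    · intro i hi
      rw [eval_entry (D := D) (by simpa using hR.reg_D) (hmem (.work 2) (by decide) ▸ hx)
        (i₀ := if a / M % M % 2 + a % M % 2 = 0 then a / M % M / 2 * (n + 2) + a % M / 2 else
          a % M / 2 * (n + 2) + a / M % M / 2)
        (by
          simp only [pairExpr, eval_add, eval_mul, eval_div, eval_mod, e1, eval_var, eval_ofNat,
            eval_eq, eval_sub, hr, hr3]
          split_ifs <;> simp) ?_ (d₀ := d - i) (by simp [e2]) (by omega)]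
      · unfold varW
        split_ifs
        · rw [encode_div _ hv, encode_mod _ hv]
        · rw [encode_div _ hu, encode_mod _ hu]
      · split_ifs
        · exact encode_lt (by omega) hv
        · exact encode_lt (by omega) hu
  · intro reg _ hR
    simp only [stepExpr, okayExpr, pairExpr, cost_add, cost_mul, cost_load, cost_mod, cost_curIdx,
      cost_var, cost_op, cost_div, cost_ofNat, cost_entry, cost_sub, cost_curPos,
      cost_and, cost_conv, hR.reg_D]
    omega

/-- The first summand is the identity matrix for exponent `0`, the second the recursion for positive
exponents. For exponent `0` the truncated predecessor leads to meaningless lookups, which are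
multiplied by zero. -/
def powExpr : Expr :=
  .op .eq (curIdx / .var 3 / .var 3 % .var 8) 0 *
    (.op .eq (curIdx / .var 3 % .var 3) (curIdx % .var 3) * .op .eq curPos 0) +
  (1 - .op .eq (curIdx / .var 3 / .var 3 % .var 8) 0) *
  .xsum 100 3 (.load (.data 1) (.var 100 / 2 * .var 2 + (curIdx % .var 3) / 2) *
    conv 110 curPos
      (entry (.data 3) (((curIdx / .var 3 / .var 3 / .var 8 * .var 8 +
        (curIdx / .var 3 / .var 3 % .var 8 - 1)) * .var 3 + curIdx / .var 3 % .var 3) * .var 3 +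
          .var 100) (.var 110))
      (entry (.data 2) ((curIdx / .var 3 / .var 3 / .var 8 * .var 3 + .var 100) * .var 3 +
        curIdx % .var 3) (curPos - .var 110)))

theorem reach_powTable (hβ : 1 ≤ β) (hσ : Bounded β σ) (hP : Params n k m q D σ.reg)
    (hw : β * 1000 ≤ w) (hNβ : 2 ^ m * (k + 2) * (2 * (n + 2)) * (2 * (n + 2)) * D < 2 ^ β)
    (hadj : ∀ u < n + 2, ∀ v < n + 2, σ.mem (.data 1) (u * (n + 2) + v) = (extAdj n g u v).toNat)
    (hW : HasTable D (2 ^ m * (2 * (n + 2)) * (2 * (n + 2)))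
        (fun a => stepW n k m sd x (a / (2 * (n + 2)) / (2 * (n + 2)))
          (a / (2 * (n + 2)) % (2 * (n + 2))) (a % (2 * (n + 2)))) (σ.mem (.data 2))) :
    ∃ σ', Reach w ω (table (.data 3) (.var 7 * .var 8 * .var 3 * .var 3 * .var 5) powExpr) σ
        (2 ^ m * (k + 2) * (2 * (n + 2)) * (2 * (n + 2)) * D *
          (400 * (2 * (n + 2) * (D + 1))) + 30) σ' ∧ Bounded β σ' ∧
      HasTable D (2 ^ m * (k + 2) * (2 * (n + 2)) * (2 * (n + 2)))
        (fun a => powW (edgeW n k m sd g x (a / (2 * (n + 2)) / (2 * (n + 2)) / (k + 2)))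
          (2 * (n + 2)) (a / (2 * (n + 2)) / (2 * (n + 2)) % (k + 2))
          (a / (2 * (n + 2)) % (2 * (n + 2))) (a % (2 * (n + 2)))) (σ'.mem (.data 3)) ∧
      (∀ B ≠ .data 3, σ'.mem B = σ.mem B) ∧ σ'.coins = σ.coins ∧
      ∀ r, r ≠ 9 → r ≠ 14 → σ'.reg r = σ.reg r := by
  have hsz : ∀ s, s ≤ 1000 → β * s ≤ w := fun s hs => (Nat.mul_le_mul_left _ hs).trans hw
  refine reach_polyTable (C := 300 * (2 * (n + 2) * (D + 1))) hβ hσ hP _ rfl rfl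
    (hsz _ (by decide)) (hsz _ (by decide)) (by simp [hP.reg_P, hP.reg_M, hP.reg_D, hP.reg_K])
    hNβ ?_ ?_ ?_
  · have := Nat.mul_le_mul_left (2 ^ m * (k + 2) * (2 * (n + 2)) * (2 * (n + 2)) * D)
      (show 300 * (2 * (n + 2) * (D + 1)) + 6 ≤ 400 * (2 * (n + 2) * (D + 1)) by
        have : 1 ≤ 2 * (n + 2) * (D + 1) := Nat.mul_pos (by omega) (by omega)
        omega)
    simp only [cost_mul, cost_var]
    omega
  · intro a ha d hd mem reg hmem htab _ hR h14
    have hn2 : (2 * (n + 2)) / 2 = n + 2 := by omega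
    set M := 2 * (n + 2) with hM
    have hM0 : 0 < M := by omega
    set b := a / M with hb
    have hp : b % M < M := Nat.mod_lt _ hM0
    have hq : a % M < M := Nat.mod_lt _ hM0
    have hbM : b / M < 2 ^ m * (k + 2) := by
      rw [hb, Nat.div_div_eq_div_mul, Nat.div_lt_iff_lt_mul (by positivity), ← mul_assoc]
      exact ha
    set c := b / M with hc
    have hj : c % (k + 2) < k + 2 := Nat.mod_lt _ (by omega)
    have hX : c / (k + 2) < 2 ^ m := (Nat.div_lt_iff_lt_mul (by omega)).2 hbM
    have h3 : reg 3 = M := hR.reg_M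
    have e3 : curIdx.eval mem reg = a := eval_curIdx hR.reg_D hd h14
    have e4 : curPos.eval mem reg = d := eval_curPos hR.reg_D hd h14
    rw [powExpr, eval_add, eval_mul, eval_mul (1 - _)]
    simp only [eval_eq, eval_mod, eval_div, e3, e4, eval_var, h3, hR.reg_K, eval_ofNat,
      eval_mul, eval_sub, ← hb, ← hc]
    rcases hj0 : c % (k + 2) with _ | j
    · simp only [powW, if_pos, one_mul, Nat.sub_self, zero_mul, add_zero]
      by_cases hpq : b % M = a % M
      · simp [hpq, coeff_one_val, ite_eq_toNat]
      · simp [hpq]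
    · simp only [Nat.add_eq_zero_iff, one_ne_zero, and_false, if_false, zero_mul, Nat.sub_zero,
        one_mul, zero_add]
      rw [eval_xsum_val h3 (F := fun r => (powW (edgeW n k m sd g x (c / (k + 2))) M j (b % M) r
        * edgeW n k m sd g x (c / (k + 2)) r (a % M)).coeff d), powW, Polynomial.finsetSum_coeff]
      intro r hr
      set reg' := Function.update reg 100 r with hreg'
      have f0 : reg' 100 = r := by simp [hreg']
      have f5 : reg' 5 = D := by simpa [hreg'] using hR.reg_D
      have f2 : reg' 2 = n + 2 := by simpa [hreg'] using hR.reg_n2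
      have f3 : reg' 3 = M := by simpa [hreg'] using hR.reg_M
      have f8 : reg' 8 = k + 2 := by simpa [hreg'] using hR.reg_K
      have f14 : reg' 14 = a * D + d := by simpa [hreg'] using h14
      have e1 : ∀ i, curIdx.eval mem (Function.update reg' 110 i) = a :=
        fun i => eval_curIdx (by simpa using f5) hd (by simpa using f14)
      have e2 : ∀ i, curPos.eval mem (Function.update reg' 110 i) = d :=
        fun i => eval_curPos (by simpa using f5) hd (by simpa using f14)
      have hv : a % M / 2 < n + 2 := by omega
      rw [eval_mul, eval_conv (D := D) (d₀ := d)
        (F := powW (edgeW n k m sd g x (c / (k + 2))) M j (b % M) r)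
        (G := stepW n k m sd x (c / (k + 2)) r (a % M)) f5 e2 hd ?_ ?_]
      · simp only [eval_load, eval_add, eval_mul, eval_div, eval_var, eval_ofNat, eval_mod, f0, f2,
          f3, eval_curIdx f5 hd f14]
        rw [hmem (.data 1) (by decide), hadj _ (by omega) _ hv, toNat_mul_val, edgeW, ← coeff_ite,
          mul_ite, mul_zero]
      · intro i hi
        -- In the numbering of entries the exponent is more significant than both states, so the
        -- entries of exponent `j` for the same label set are already in the table when exponent `j
        -- + 1` is computed.
        have hlt : ((c / (k + 2) * (k + 2) + j) * M + b % M) * M + r < a := by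
          have h1 : a = (((c / (k + 2) * (k + 2) + (j + 1)) * M + b % M) * M + a % M) := by
            rw [← hj0, Nat.div_add_mod', hc, Nat.div_add_mod', hb, Nat.div_add_mod']
          conv_rhs => rw [h1]
          exact encode_lt_encode (encode_lt_encode (by omega) hp) hr
        rw [eval_entry (D := D) (by simpa using f5) htab
          (i₀ := ((c / (k + 2) * (k + 2) + j) * M + b % M) * M + r)
          (by simp [e1, f0, f3, f8, ← hb, ← hc, hj0]) hlt (d₀ := i) (by simp) (by omega)]
        simp only [encode_div _ hr, encode_mod _ hr, encode_div _ hp, encode_mod _ hp,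
          encode_div _ (show j < k + 2 by omega), encode_mod _ (show j < k + 2 by omega)]
      · intro i hi
        rw [eval_entry (D := D) (by simpa using f5) (hmem (.data 2) (by decide) ▸ hW)
          (i₀ := (c / (k + 2) * M + r) * M + a % M)
          (by simp [e1, f0, f3, f8, ← hb, ← hc]) (encode_lt (encode_lt hX hr) hq) (d₀ := d - i)
          (by simp [e2]) (by omega)]
        simp only [encode_div _ hr, encode_mod _ hr, encode_div _ hq, encode_mod _ hq]
  · intro reg _ hR
    simp only [powExpr, cost_add, cost_mul, cost_load, cost_mod, cost_curIdx,
      cost_var, cost_xsum, cost_op, cost_div, cost_ofNat, cost_entry, cost_sub, cost_curPos,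
      cost_conv, hR.reg_D, hR.reg_M]
    have h1 : 1 ≤ 2 * (n + 2) * (D + 1) := Nat.mul_pos (by omega) (by omega)
    nlinarith

end Tables

end WordRAM

/-! ### Random points, adjacency, and the complete preprocessing program. -/

namespace WordRAM

open WordRAM.Expr
open scoped Polynomial

section Preprocess

variable {w : ℕ} {ω : ℕ → Bool} {β n k m q D : ℕ} {σ : State} {sd : ℕ → Bool}
  {g : ℕ → ℕ → Bool} {x : ℕ → ℕ → (ZMod 2)[X]}

/-- The random coefficients. -/
def randomTable : Cmd :=
  .seq (assign 9 ((.var 2 + .var 6) * .var 2 * .var 5))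
    (fillRandom (.work 2) 14 9 (.op .lt curPos (.var 4)))

/-- With no coins used before, cell `t` holds coin `t` if `t % D < q` and zero otherwise, which is
exactly the coefficient list of `bitPoly`. Each block consumes `D` coins, although only the first
`q` are kept. -/
theorem reach_randomTable (hβ : 1 ≤ β) (hσ : Bounded β σ) (hP : Params n k m q D σ.reg)
    (hw : β * 1000 ≤ w) (hNβ : (n + 2 + m) * (n + 2) * D < 2 ^ β) (hc : σ.coins = 0) :
    ∃ σ', Reach w ω randomTable σ ((n + 2 + m) * (n + 2) * D * 20 + 30) σ' ∧ Bounded β σ' ∧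
      HasTable D ((n + 2 + m) * (n + 2))
        (fun a => randVar n m q D ω (a / (n + 2)) (a % (n + 2))) (σ'.mem (.work 2)) ∧
      (∀ B ≠ .work 2, σ'.mem B = σ.mem B) ∧ ∀ r, r ≠ 9 → r ≠ 14 → σ'.reg r = σ.reg r := by
  have hsz : ∀ s, s ≤ 1000 → β * s ≤ w := fun s hs => (Nat.mul_le_mul_left _ hs).trans hw
  have hβ2 : 2 ≤ 2 ^ β := by simpa using Nat.pow_le_pow_right (n := 2) (by norm_num) hβ
  set N := (n + 2 + m) * (n + 2) * D with hN
  let val : ℕ → ℕ := fun t => if ω t = true ∧ t % D < q then 1 else 0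
  have hval : ∀ t, val t < 2 ^ β := fun t => by
    simp only [val]; split_ifs <;> omega
  obtain ⟨h1, hb1⟩ := reach_assign_val (w := w) (ω := ω) (r := 9) (x := N)
    (e := (.var 2 + .var 6) * .var 2 * .var 5) hβ hσ rfl (hsz _ (by decide))
    (by simp [hP.reg_n2, hP.reg_m, hP.reg_D, hN]) hNβ
  have h9 : (σ.setReg 9 N).reg 9 = N := by simp
  have h5 : ∀ t, Function.update (σ.setReg 9 N).reg 14 t 5 = D := fun t => by simpa using hP.reg_D
  have h4 : ∀ t, Function.update (σ.setReg 9 N).reg 14 t 4 = q := fun t => by simpa using hP.reg_q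
  have h2 := reach_fillRandom (w := w) (ω := ω) (A := .work 2) (r := 14) (rb := 9) (val := val)
    (e := .op .lt curPos (.var 4)) (C := 10) hβ hb1 (by norm_num) (by norm_num) (by norm_num) rfl
    (hsz _ (by decide)) (fun t _ => hval t)
    (fun t _ => by
      have h14 : Function.update (σ.setReg 9 N).reg 14 t 14 = t := by simp
      simp only [State.setReg_coins, hc, zero_add, eval_lt', curPos, eval_mod, eval_var, h5, h4,
        h14, val]
      by_cases c1 : ω t = true <;> by_cases c2 : t % D < q <;> simp [c1, c2])
    (fun t _ => by simp)
  rw [h9] at h2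
  refine ⟨_, (h1.seq h2).mono ?_, ?_, ?_, ?_, ?_⟩
  · simp only [cost_add, cost_mul, cost_var]; omega
  · have := ((hb1.fillMem (A := .work 2) (N := N) fun t _ => hval t).setReg (r := 14) hNβ)
    exact ⟨this.reg, this.mem⟩
  · intro a ha d hd
    simp only [State.fillMem, State.setReg_mem, Function.update_self]
    rw [if_pos (encode_lt ha hd), randVar, Nat.div_add_mod', if_pos ha, coeff_bitPoly]
    simp only [val, encode_mod a hd, and_comm (a := d < q)]
    split_ifs <;> rfl
  · intro B hB
    simp [State.fillMem, Function.update_of_ne hB]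
  · intro r h9 h14
    simp [Function.update_of_ne h9, Function.update_of_ne h14]

def adjExpr : Expr :=
  .op .lt (.var 14 / .var 2) (.var 0) * .op .lt (.var 14 % .var 2) (.var 0) *
    .load (.work 0) (.var 0 * (.var 14 / .var 2) + .var 14 % .var 2) +
  .op .eq (.var 14 / .var 2) (.var 0) * .op .lt (.var 14 % .var 2) (.var 0) +
  .op .lt (.var 14 / .var 2) (.var 0) * .op .eq (.var 14 % .var 2) (.var 0 + 1)

theorem reach_adjTable (hβ : 1 ≤ β) (hσ : Bounded β σ) (hP : Params n k m q D σ.reg)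
    (hw : β * 1000 ≤ w) (hNβ : (n + 2) * (n + 2) < 2 ^ β)
    (hg : ∀ u < n, ∀ v < n, σ.mem (.work 0) (n * u + v) = (g u v).toNat) :
    ∃ σ', Reach w ω (table (.data 1) (.var 2 * .var 2) adjExpr) σ
        ((n + 2) * (n + 2) * 200 + 30) σ' ∧ Bounded β σ' ∧
      (∀ u < n + 2, ∀ v < n + 2,
        σ'.mem (.data 1) (u * (n + 2) + v) = (extAdj n g u v).toNat) ∧
      (∀ B ≠ .data 1, σ'.mem B = σ.mem B) ∧ ∀ r, r ≠ 9 → r ≠ 14 → σ'.reg r = σ.reg r := by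
  have hsz : ∀ s, s ≤ 1000 → β * s ≤ w := fun s hs => (Nat.mul_le_mul_left _ hs).trans hw
  have hβ2 : 2 ≤ 2 ^ β := by simpa using Nat.pow_le_pow_right (n := 2) (by norm_num) hβ
  set N := (n + 2) * (n + 2) with hN
  let val : ℕ → ℕ := fun t => (extAdj n g (t / (n + 2)) (t % (n + 2))).toNat
  have hval : ∀ t, val t < 2 ^ β := fun t => by
    have := Bool.toNat_lt (extAdj n g (t / (n + 2)) (t % (n + 2)))
    simp only [val]; omega
  refine ⟨_, (reach_table (C := 150) (N := N) (val := val) hβ hσ rfl rfl (hsz _ (by decide))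
    (hsz _ (by decide)) (by simp [hP.reg_n2, hN]) hNβ (fun t _ => hval t) (fun t _ => ?_)
    (fun t _ => ?_)).mono ?_, ?_, ?_, ?_, ?_⟩
  · have h14 : Function.update (Function.update σ.reg 9 N) 14 t 14 = t := by simp
    have h2 : Function.update (Function.update σ.reg 9 N) 14 t 2 = n + 2 := by
      simpa using hP.reg_n2
    have h0 : Function.update (Function.update σ.reg 9 N) 14 t 0 = n := by simpa using hP.reg_n
    have hm : (σ.fillMem (.data 1) val t).mem (.work 0) = σ.mem (.work 0) := by
      simp [State.fillMem]
    simp only [adjExpr, eval_add, eval_mul, eval_lt', eval_eq, eval_div, eval_mod, eval_load,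
      eval_var, eval_ofNat, h14, h2, h0, hm, val]
    generalize t / (n + 2) = u
    generalize t % (n + 2) = v
    by_cases hu : u < n
    · have hu' : u ≠ n := by omega
      by_cases hv : v < n
      · have hv' : v ≠ n + 1 := by omega
        simp [extAdj, hu, hv, hu', hv', hg u hu v hv, beq_eq_false_iff_ne.2 hu',
          beq_eq_false_iff_ne.2 hv']
      · by_cases hv' : v = n + 1
        · simp [extAdj, hu, hu', hv', beq_eq_false_iff_ne.2 hu']
        · simp [extAdj, hu, hv, hu', hv', beq_eq_false_iff_ne.2 hu', beq_eq_false_iff_ne.2 hv']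
    · by_cases hu' : u = n
      · by_cases hv : v < n <;> simp [extAdj, hu', hv]
      · simp [extAdj, hu, hu', beq_eq_false_iff_ne.2 hu']
  · simp only [adjExpr, cost_add, cost_mul, cost_load, cost_mod, cost_var, cost_op, cost_div,
      cost_ofNat]
    omega
  · simp only [cost_mul, cost_var]; omega
  · exact ((hσ.setReg hNβ).fillMem fun t _ => hval t).setReg hNβ
  · intro u hu v hv
    simp only [State.fillMem, State.setReg_mem, Function.update_self, val]
    rw [if_pos (encode_lt hu hv), encode_div u hv, encode_mod u hv]
  · intro B hB
    simp [State.fillMem, Function.update_of_ne hB]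
  · intro r h9 h14
    simp [Function.update_of_ne h9, Function.update_of_ne h14]

/-- The preprocessing. -/
def preprocess (E : ℕ) : Cmd :=
  .seq (setup E) (.seq randomTable
    (.seq (table (.work 3) (.var 7 * .var 2 * .var 5) labelExpr)
    (.seq (table (.data 1) (.var 2 * .var 2) adjExpr)
    (.seq (table (.data 2) (.var 7 * .var 3 * .var 3 * .var 5) stepExpr)
    (.seq (table (.data 3) (.var 7 * .var 8 * .var 3 * .var 3 * .var 5) powExpr)
    (.seq (put (.data 0) 0 (.var 0)) (put (.data 0) 1 (.var 1))))))))

open Classical in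
theorem inputState_adj (k : ℕ) (G : SimpleGraph (Fin n)) (S : Finset (Fin n)) {u v : ℕ}
    (hv : v < n) :
    (SensitivityOracle.inputState k G S).mem (.work 0) (n * u + v) = (adjB G u v).toNat := by
  have h : (∃ a b : Fin n, G.Adj a b ∧ n * u + v = n * (a : ℕ) + b) ↔
      ∃ a b : Fin n, G.Adj a b ∧ u = a ∧ v = b := by
    refine exists_congr fun a => exists_congr fun b => and_congr_right fun _ => ⟨fun h => ?_, ?_⟩
    · rw [mul_comm, mul_comm n] at h
      have h1 := congrArg (· / n) h
      have h2 := congrArg (· % n) h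
      simp only [encode_div _ hv, encode_div _ b.2, encode_mod _ hv, encode_mod _ b.2] at h1 h2
      exact ⟨h1, h2⟩
    · rintro ⟨rfl, rfl⟩; rfl
  simp only [SensitivityOracle.inputState, adjB]
  by_cases hp : ∃ a b : Fin n, G.Adj a b ∧ u = a ∧ v = b
  · rw [if_pos (h.2 hp), decide_eq_true hp]; rfl
  · rw [if_neg (mt h.1 hp), decide_eq_false hp]; rfl

theorem inputState_side (k : ℕ) (G : SimpleGraph (Fin n)) (S : Finset (Fin n)) (u : ℕ) :
    (SensitivityOracle.inputState k G S).mem (.work 1) u = (sideB S u).toNat := by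
  simp only [SensitivityOracle.inputState, sideB]
  split_ifs with h <;> simp [h]

theorem bounded_inputState (hβ : 1 ≤ β) {k : ℕ} (G : SimpleGraph (Fin n)) (S : Finset (Fin n))
    (hn : n < 2 ^ β) (hk : k < 2 ^ β) : Bounded β (SensitivityOracle.inputState k G S) := by
  have hβ2 : 2 ≤ 2 ^ β := by simpa using Nat.pow_le_pow_right (n := 2) (by norm_num) hβ
  refine ⟨fun r _ => ?_, fun A i => ?_⟩
  · simp only [SensitivityOracle.inputState]; split_ifs <;> omega
  · simp only [SensitivityOracle.inputState]
    split
    · split_ifs <;> omega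
    · split_ifs <;> omega
    · omega

theorem reach_preprocess {E : ℕ} (hβ : 1 ≤ β) (G : SimpleGraph (Fin n)) (S : Finset (Fin n))
    (hm : m = (k + 1) / 2) (hq : q = k + E) (hD : D = (2 * k + 2) * (k + E) + 1)
    (h1 : (n + 2 + m) * (n + 2) * D < 2 ^ β)
    (h2 : 2 ^ m * (k + 2) * (2 * (n + 2)) * (2 * (n + 2)) * D < 2 ^ β) (h3 : k + E + 2 < 2 ^ β)
    (hw : β * (E + 1000) ≤ w) :
    ∃ σ', Reach w ω (preprocess E) (SensitivityOracle.inputState k G S)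
        (3000 * (2 ^ m * (k + 2) * (2 * (n + 2)) ^ 3 * (D * (D + 1)))) σ' ∧ Bounded β σ' ∧
      Stored n k m D (sideB S) (adjB G) (randVar n m q D ω) σ'.mem := by
  have hw' : β * 1000 ≤ w := (Nat.mul_le_mul_left _ (by omega)).trans hw
  have hsz : ∀ s, s ≤ 1000 → β * s ≤ w := fun s hs => (Nat.mul_le_mul_left _ hs).trans hw'
  have hD1 : 1 ≤ D := by omega
  set M := 2 * (n + 2) with hM
  have hM1 : 1 ≤ M := by omega
  have hP1 : 1 ≤ 2 ^ m := Nat.one_le_two_pow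
  have b1 : 2 ^ m * M * M * D ≤ 2 ^ m * (k + 2) * M * M * D := by
    gcongr; exact Nat.le_mul_of_pos_right _ (by omega)
  have b2 : 2 ^ m * (n + 2) * D ≤ 2 ^ m * M * M * D := by
    refine Nat.mul_le_mul_right _ ?_
    calc 2 ^ m * (n + 2) ≤ 2 ^ m * M := by gcongr; omega
      _ ≤ 2 ^ m * M * M := Nat.le_mul_of_pos_right _ hM1
  have b3 : (n + 2) * (n + 2) ≤ 2 ^ m * M * M * D :=
    calc (n + 2) * (n + 2) ≤ M * M := by gcongr <;> omega
      _ ≤ 2 ^ m * (M * M) := Nat.le_mul_of_pos_left _ hP1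
      _ = 2 ^ m * M * M := by ring
      _ ≤ _ := Nat.le_mul_of_pos_right _ hD1
  have b4 : M ≤ 2 ^ m * M * M * D :=
    calc M ≤ M * M := Nat.le_mul_of_pos_left _ hM1
      _ ≤ 2 ^ m * (M * M) := Nat.le_mul_of_pos_left _ hP1
      _ = 2 ^ m * M * M := by ring
      _ ≤ _ := Nat.le_mul_of_pos_right _ hD1
  have b5 : D ≤ 2 ^ m * M * M * D := Nat.le_mul_of_pos_left _ (by positivity)
  have b6 : 2 ^ m ≤ 2 ^ m * M * M * D := by
    rw [mul_assoc, mul_assoc]; exact Nat.le_mul_of_pos_right _ (by positivity)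
  obtain ⟨σ₁, r1, bd1, p1, m1, c1, -⟩ := reach_setup (w := w) (ω := ω) (E := E) (n := n) (k := k)
    hβ (bounded_inputState hβ G S (by omega) (by omega))
    ((Nat.mul_le_mul_left _ (by omega)).trans hw) rfl rfl (by omega) (by omega) h3
    (by rw [← hm]; omega)
  rw [← hm, ← hD, ← hq] at p1
  have hcong : ∀ {σ τ : State}, Params n k m q D σ.reg →
      (∀ r, r ≠ 9 → r ≠ 14 → τ.reg r = σ.reg r) → Params n k m q D τ.reg :=
    fun h h' => h.congr fun r hr => h' r (by omega) (by omega)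
  obtain ⟨σ₂, r2, bd2, t2, m2, g2⟩ := reach_randomTable (ω := ω) hβ bd1 p1 hw' h1 c1
  have p2 := hcong p1 g2
  obtain ⟨σ₃, r3, bd3, t3, m3, -, g3⟩ := reach_labelTable (ω := ω) (sd := sideB S) hβ bd2 p2 hw'
    (by omega) (fun u => by rw [m2 _ (by decide), m1]; exact inputState_side k G S u) t2
  have p3 := hcong p2 g3
  obtain ⟨σ₄, r4, bd4, t4, m4, g4⟩ := reach_adjTable (ω := ω) (g := adjB G) hβ bd3 p3 hw'
    (by omega) (fun u _ v hv => by
      rw [m3 _ (by decide), m2 _ (by decide), m1]; exact inputState_adj k G S hv)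
  have p4 := hcong p3 g4
  obtain ⟨σ₅, r5, bd5, t5, m5, -, g5⟩ := reach_stepTable (ω := ω) (sd := sideB S)
    (x := randVar n m q D ω) hβ bd4 p4 hw' (b1.trans_lt h2)
    (fun u => by
      rw [m4 _ (by decide), m3 _ (by decide), m2 _ (by decide), m1]
      exact inputState_side k G S u)
    (by rw [m4 _ (by decide), m3 _ (by decide)]; exact t2) (by rw [m4 _ (by decide)]; exact t3)
  have p5 := hcong p4 g5
  obtain ⟨σ₆, r6, bd6, t6, m6, -, g6⟩ := reach_powTable (ω := ω) (g := adjB G) hβ bd5 p5 hw' h2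
    (by rw [m5 _ (by decide)]; exact t4) t5
  have p6 := hcong p5 g6
  have r7 := reach_put (w := w) (ω := ω) (A := .data 0) (a := 0) (e := .var 0) hβ bd6 rfl rfl
    (hsz _ (by decide)) (hsz _ (by decide))
  simp only [eval_ofNat, eval_var, p6.reg_n] at r7
  have bd7 := bd6.setMem (A := .data 0) (i := 0) (x := n) (by omega)
  have r8 := reach_put (w := w) (ω := ω) (A := .data 0) (a := 1) (e := .var 1) hβ bd7 rfl rfl
    (hsz _ (by decide)) (hsz _ (by decide))
  simp only [eval_ofNat, eval_var, State.setMem_reg, p6.reg_k] at r8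
  refine ⟨_, (r1.seq (r2.seq (r3.seq (r4.seq (r5.seq (r6.seq (r7.seq r8))))))).mono ?_,
    bd7.setMem (by omega), ?_⟩
  · simp only [cost_ofNat, cost_var, ← hM]
    -- The order of the cost of the table of powers: each of its `2 ^ m * (k + 2) * M ^ 2 * D` cells
    -- adds up `M` convolution coefficients. All other stages are dominated by it.
    set U := 2 ^ m * (k + 2) * M ^ 3 * (D * (D + 1)) with hU
    have hU1 : 1 ≤ U := Nat.mul_pos (by positivity) (by positivity)
    have u1 : (n + 2 + m) * (n + 2) * D ≤ U := by
      calc (n + 2 + m) * (n + 2) * D ≤ ((k + 2) * M) * M * D := by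
            gcongr
            · have : (k + 2) * 1 ≤ (k + 2) * (n + 2) := by gcongr; omega
              have : 2 * (n + 2) ≤ (k + 2) * (n + 2) := by gcongr; omega
              rw [hM, mul_left_comm]; omega
            · omega
        _ = 1 * ((k + 2) * (M * M * D)) := by ring
        _ ≤ (2 ^ m * (M * (D + 1))) * ((k + 2) * (M * M * D)) := by
            gcongr; exact Nat.mul_pos hP1 (by positivity)
        _ = U := by rw [hU]; ring
    have u2 : 2 ^ m * (n + 2) * D * (m + 1) ≤ U := by
      calc 2 ^ m * (n + 2) * D * (m + 1) ≤ 2 ^ m * M * D * (k + 2) := by gcongr <;> omega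
        _ = 1 * (2 ^ m * M * D * (k + 2)) := by ring
        _ ≤ (M * M * (D + 1)) * (2 ^ m * M * D * (k + 2)) := by
            gcongr; exact Nat.mul_pos (by positivity) (by omega)
        _ = U := by rw [hU]; ring
    have u3 : (n + 2) * (n + 2) ≤ U := by
      calc (n + 2) * (n + 2) ≤ M * M := by gcongr <;> omega
        _ = 1 * (M * M) := by ring
        _ ≤ (2 ^ m * (k + 2) * M * D * (D + 1)) * (M * M) := by
            gcongr; exact Nat.mul_pos (by positivity) (by omega)
        _ = U := by rw [hU]; ring
    have u4 : 2 ^ m * M * M * D * (D + 1) ≤ U := by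
      calc 2 ^ m * M * M * D * (D + 1) = 1 * (2 ^ m * M * M * D * (D + 1)) := by ring
        _ ≤ ((k + 2) * M) * (2 ^ m * M * M * D * (D + 1)) := by
            gcongr; exact Nat.mul_pos (by positivity) (by omega)
        _ = U := by rw [hU]; ring
    have u5 : 2 ^ m * (k + 2) * M * M * D * (M * (D + 1)) = U := by rw [hU]; ring
    have e2 : 2 ^ m * (n + 2) * D * (200 * (m + 1)) = 200 * (2 ^ m * (n + 2) * D * (m + 1)) := by
      ring
    have e4 : 2 ^ m * M * M * D * (600 * (D + 1)) = 600 * (2 ^ m * M * M * D * (D + 1)) := by ring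
    have e5 : 2 ^ m * (k + 2) * M * M * D * (400 * (M * (D + 1))) =
      400 * (2 ^ m * (k + 2) * M * M * D * (M * (D + 1))) := by ring
    omega
  · constructor
    · simp [State.setMem]
    · simp [State.setMem]
    · simpa [State.setMem, m6 (.data 1) (by decide), m5 (.data 1) (by decide)] using t4
    · simpa [State.setMem, m6 (.data 2) (by decide)] using t5
    · simpa [State.setMem] using t6

end Preprocess

end WordRAM

/-! ### Reading the updates -/

namespace WordRAM

open WordRAM.Expr
open scoped Polynomial

section Updates

variable {n : ℕ}

theorem adjB_lt {H : SimpleGraph (Fin n)} {u v : ℕ} (h : adjB H u v) : u < n ∧ v < n := by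
  simp only [adjB, decide_eq_true_eq] at h
  obtain ⟨a, b, -, rfl, rfl⟩ := h
  exact ⟨a.2, b.2⟩

theorem adj_apply (H : SimpleGraph (Fin n)) (e : EdgeUpdate n) (a b : Fin n) :
    (e.apply H).Adj a b ↔ if a ≠ b ∧ (a = e.u ∧ b = e.v ∨ a = e.v ∧ b = e.u) then e.insert = true
      else H.Adj a b := by
  have h1 : s(a, b) = s(e.u, e.v) ↔ (a = e.u ∧ b = e.v ∨ a = e.v ∧ b = e.u) := by simp
  have h2 := fun h : a = b => H.irrefl (v := b) |> fun h' => show ¬ H.Adj a b by rwa [h]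
  rcases hi : e.insert with _ | _
  · simp only [EdgeUpdate.apply, hi, Bool.false_eq_true, if_false, SimpleGraph.deleteEdges_adj,
      Set.mem_singleton_iff, h1]
    split_ifs with h <;> tauto
  · simp only [EdgeUpdate.apply, hi, if_true, SimpleGraph.sup_adj, SimpleGraph.edge_adj]
    split_ifs with h
    · simp only [iff_true]
      exact .inr ⟨by tauto, h.1⟩
    · constructor
      · rintro (h' | h')
        · exact h'
        · exact absurd ⟨h'.2, by tauto⟩ h
      · exact .inl

/-- Effect of an update on the adjacency matrix: the entries for the edge and its reverse are
flipped if necessary, which has no effect on the diagonal. -/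
theorem adjB_apply (H : SimpleGraph (Fin n)) (e : EdgeUpdate n) (a b : ℕ) :
    adjB (e.apply H) a b = ((adjB H a b ^^
      (decide (a = e.u ∧ b = e.v) && (e.insert ^^ adjB H e.u e.v))) ^^
      (decide (a = e.v ∧ b = e.u) && (e.insert ^^ adjB H e.u e.v))) := by
  by_cases hab : a < n ∧ b < n
  · obtain ⟨a, rfl⟩ : ∃ a' : Fin n, a = a' := ⟨⟨a, hab.1⟩, rfl⟩
    obtain ⟨b, rfl⟩ : ∃ b' : Fin n, b = b' := ⟨⟨b, hab.2⟩, rfl⟩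
    have key := adj_apply H e a b
    rw [← adjB_val, ← adjB_val] at key
    simp only [Fin.val_inj]
    have hloop : ∀ c : Fin n, adjB H c c = false := fun c => by
      rw [← Bool.not_eq_true, adjB_val]; exact H.irrefl
    have hloop' : ∀ c : Fin n, adjB (e.apply H) c c = false := fun c => by
      rw [← Bool.not_eq_true, adjB_val]; exact (e.apply H).irrefl
    by_cases h1 : a = e.u ∧ b = e.v
    · obtain ⟨rfl, rfl⟩ := h1
      by_cases h2 : e.u = e.v
      · rw [h2, hloop, hloop']; simp
      · rw [if_pos ⟨h2, .inl ⟨rfl, rfl⟩⟩] at key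
        rw [Bool.eq_iff_iff, key]
        cases e.insert <;> cases adjB H e.u e.v <;> simp [h2]
    · by_cases h2 : a = e.v ∧ b = e.u
      · obtain ⟨rfl, rfl⟩ := h2
        have h3 : e.v ≠ e.u := fun h => h1 ⟨h, h.symm⟩
        rw [if_pos ⟨h3, .inr ⟨rfl, rfl⟩⟩] at key
        rw [Bool.eq_iff_iff, key, adjB_comm H e.v e.u]
        cases e.insert <;> cases adjB H e.u e.v <;> simp [h3]
      · simp only [h1, h2, or_self, and_false, if_false] at key
        simp only [h1, h2, decide_false, Bool.false_and, Bool.xor_false]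
        rw [Bool.eq_iff_iff, key]
  · have h1 : ¬ (a = e.u ∧ b = e.v) := fun h => hab ⟨h.1 ▸ e.u.2, h.2 ▸ e.v.2⟩
    have h2 : ¬ (a = e.v ∧ b = e.u) := fun h => hab ⟨h.1 ▸ e.v.2, h.2 ▸ e.u.2⟩
    have h3 : adjB H a b = false := by
      rw [← Bool.not_eq_true]; exact fun h => hab (adjB_lt h)
    have h4 : adjB (e.apply H) a b = false := by
      rw [← Bool.not_eq_true]; exact fun h => hab (adjB_lt h)
    simp [h1, h2, h3, h4]

end Updates

/-- The first `c` entries of `f` are distinct numbers less than `n`, and `g` is their indicator. -/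
structure Marks (n : ℕ) (f g : ℕ → ℕ) (c : ℕ) : Prop where
  lt : ∀ t < c, f t < n
  inj : ∀ s < c, ∀ t < c, f s = f t → s = t
  mark : ∀ t < c, g (f t) = 1
  zero : ∀ u, (∀ t < c, f t ≠ u) → g u = 0

theorem Marks.le {n c : ℕ} {f g : ℕ → ℕ} (h : Marks n f g c) : c ≤ n := by
  have := Finset.card_le_card_of_injOn (s := Finset.range c) (t := Finset.range n) f
    (fun t ht => by simpa using h.lt t (by simpa using ht))
    (fun s hs t ht => h.inj s (by simpa using hs) t (by simpa using ht))
  simpa using this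

/-- Writing `u` behind the list and then lengthening it by `1 - g u` needs no branching: if `u` is
already marked, the written cell stays outside the list. -/
theorem Marks.insert {n c u : ℕ} {f g : ℕ → ℕ} (h : Marks n f g c) (hu : u < n) :
    Marks n (Function.update f c u) (Function.update g u 1) (c + 1 - g u) ∧
      c ≤ c + 1 - g u ∧ ∃ t < c + 1 - g u, Function.update f c u t = u := by
  by_cases hex : ∃ t < c, f t = u
  · obtain ⟨t, ht, rfl⟩ := hex
    rw [h.mark t ht, Nat.add_sub_cancel]
    have hne : ∀ s < c, Function.update f c (f t) s = f s := fun s hs =>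
      Function.update_of_ne hs.ne _ _
    refine ⟨⟨fun s hs => ?_, fun s hs s' hs' => ?_, fun s hs => ?_, fun v hv => ?_⟩, le_rfl, t, ht,
      hne t ht⟩
    · rw [hne s hs]; exact h.lt s hs
    · rw [hne s hs, hne s' hs']; exact h.inj s hs s' hs'
    · rw [hne s hs, Function.update_apply]; split_ifs <;> [rfl; exact h.mark s hs]
    · rw [Function.update_of_ne]
      · exact h.zero v fun s hs => hne s hs ▸ hv s hs
      · rintro rfl; exact hv t ht (hne t ht)
  · push Not at hex
    rw [h.zero u hex, Nat.sub_zero]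
    have hne : ∀ s < c, Function.update f c u s = f s := fun s hs =>
      Function.update_of_ne hs.ne _ _
    have hc : Function.update f c u c = u := Function.update_self _ _ _
    refine ⟨⟨fun s hs => ?_, fun s hs s' hs' hss => ?_, fun s hs => ?_, fun v hv => ?_⟩, by omega,
      c, by omega, hc⟩
    · rcases Nat.lt_succ_iff_lt_or_eq.1 hs with hs | rfl
      · rw [hne s hs]; exact h.lt s hs
      · rwa [hc]
    · rcases Nat.lt_succ_iff_lt_or_eq.1 hs with hs | rfl <;>
        rcases Nat.lt_succ_iff_lt_or_eq.1 hs' with hs' | rfl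
      · rw [hne s hs, hne s' hs'] at hss; exact h.inj s hs s' hs' hss
      · rw [hne s hs, hc] at hss; exact absurd hss (hex s hs)
      · rw [hne s' hs', hc] at hss; exact absurd hss.symm (hex s' hs')
      · rfl
    · rcases Nat.lt_succ_iff_lt_or_eq.1 hs with hs | rfl
      · rw [hne s hs, Function.update_of_ne (hex s hs)]; exact h.mark s hs
      · rw [hc, Function.update_self]
    · rw [Function.update_of_ne]
      · exact h.zero v fun s hs => hne s hs ▸ hv s (by omega)
      · rintro rfl; exact hv c (by omega) hc

section Scan

variable {w : ℕ} {ω : ℕ → Bool} {β n k m q D : ℕ} {σ : State}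

/-- Append the vertex in register `22` to the list of touched vertices, unless it is marked. -/
def touch : Cmd :=
  .seq (put (.work 4) (.var 16) (.var 22)) (.seq
    (assign 16 (.var 16 + 1 - .load (.work 5) (.var 22))) (put (.work 5) (.var 22) 1))

theorem reach_touch (hβ : 1 ≤ β) (hσ : Bounded β σ) (hw : β * 1000 ≤ w) (hn : n + 2 < 2 ^ β)
    {u : ℕ} (h22 : σ.reg 22 = u) (hu : u < n)
    (hM : Marks n (σ.mem (.work 4)) (σ.mem (.work 5)) (σ.reg 16)) :
    ∃ σ', Reach w ω touch σ 40 σ' ∧ Bounded β σ' ∧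
      (∀ B, B ≠ .work 4 → B ≠ .work 5 → σ'.mem B = σ.mem B) ∧
      (∀ r ≠ 16, σ'.reg r = σ.reg r) ∧
      Marks n (σ'.mem (.work 4)) (σ'.mem (.work 5)) (σ'.reg 16) ∧
      σ.reg 16 ≤ σ'.reg 16 ∧ σ'.reg 16 ≤ σ.reg 16 + 1 ∧
      (∀ t < σ.reg 16, σ'.mem (.work 4) t = σ.mem (.work 4) t) ∧
      ∃ t < σ'.reg 16, σ'.mem (.work 4) t = u := by
  have hsz : ∀ s, s ≤ 1000 → β * s ≤ w := fun s hs => (Nat.mul_le_mul_left _ hs).trans hw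
  have hβ2 : 2 ≤ 2 ^ β := by simpa using Nat.pow_le_pow_right (n := 2) (by norm_num) hβ
  obtain ⟨hM', hle, hex⟩ := hM.insert hu
  have hc := hM'.le
  have r1 := reach_put (w := w) (ω := ω) (A := .work 4) (a := .var 16) (e := .var 22) hβ hσ rfl rfl
    (hsz _ (by decide)) (hsz _ (by decide))
  simp only [eval_var, h22, cost_var] at r1
  have b1 := hσ.setMem (A := .work 4) (i := σ.reg 16) (x := u) (by omega)
  obtain ⟨r2, b2⟩ := reach_assign_val (w := w) (ω := ω) (r := 16)
    (e := .var 16 + 1 - .load (.work 5) (.var 22)) (x := σ.reg 16 + 1 - σ.mem (.work 5) u) hβ b1 rfl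
    (hsz _ (by decide)) (by simp [State.setMem, h22]) (by omega)
  have r3 := reach_put (w := w) (ω := ω) (A := .work 5) (a := .var 22) (e := 1) hβ b2 rfl rfl
    (hsz _ (by decide)) (hsz _ (by decide))
  have h22' : ((σ.setMem (.work 4) (σ.reg 16) u).setReg 16
    (σ.reg 16 + 1 - σ.mem (.work 5) u)).reg 22 = u := by simpa using h22
  simp only [eval_var, h22', eval_ofNat] at r3
  refine ⟨_, (r1.seq (r2.seq r3)).mono (by simp), b2.setMem (by omega), ?_, ?_, ?_, ?_, ?_, ?_, ?_⟩
  · intro B h4 h5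
    simp [State.setMem, State.setReg, Function.update_of_ne h4, Function.update_of_ne h5]
  · intro r hr
    simp [Function.update_of_ne hr]
  · simpa [State.setMem, State.setReg] using hM'
  · simpa [State.setMem, State.setReg] using hle
  · simp [State.setMem, State.setReg]
  · intro t ht
    simp [State.setMem, State.setReg, Function.update_of_ne ht.ne]
  · simpa [State.setMem, State.setReg] using hex

/-- Flip the entries for the edge in the registers `18` and `19` if the content of register `20`
is not the current adjacency. -/
def toggle : Cmd :=
  .seq (assign 20 (.var 20 ^^^ (.load (.data 1) (.var 18 * .var 2 + .var 19) ^^^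
    .load (.work 3) (.var 18 * .var 2 + .var 19))))
  (.seq (put (.work 3) (.var 18 * .var 2 + .var 19)
    (.load (.work 3) (.var 18 * .var 2 + .var 19) ^^^ .var 20))
  (put (.work 3) (.var 19 * .var 2 + .var 18)
    (.load (.work 3) (.var 19 * .var 2 + .var 18) ^^^ .var 20)))

theorem encode_inj {D a b d e : ℕ} (hd : d < D) (he : e < D) (h : a * D + d = b * D + e) :
    a = b ∧ d = e := by
  have h1 := congrArg (· / D) h
  have h2 := congrArg (· % D) h
  simp only [encode_div _ hd, encode_div _ he, encode_mod _ hd, encode_mod _ he] at h1 h2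
  exact ⟨h1, h2⟩

/-- `f` is the current difference from the stored graph `g`, so `g ^^ f u v` is the current
adjacency and `δ` tells whether the update changes it. The second write reads the result of the
first; for `u = v` the two cancel, so loops have no effect. -/
theorem reach_toggle (hβ : 1 ≤ β) (hσ : Bounded β σ) (hw : β * 1000 ≤ w)
    (h2 : σ.reg 2 = n + 2) {u v : ℕ} {i g : Bool} {f : ℕ → ℕ → Bool} (hu : u < n + 2)
    (hv : v < n + 2) (h18 : σ.reg 18 = u) (h19 : σ.reg 19 = v) (h20 : σ.reg 20 = i.toNat)
    (hg : σ.mem (.data 1) (u * (n + 2) + v) = g.toNat)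
    (hf : ∀ a < n + 2, ∀ b < n + 2, σ.mem (.work 3) (a * (n + 2) + b) = (f a b).toNat) :
    ∃ σ', Reach w ω toggle σ 100 σ' ∧ Bounded β σ' ∧ (∀ B ≠ .work 3, σ'.mem B = σ.mem B) ∧
      (∀ r ≠ 20, σ'.reg r = σ.reg r) ∧
      ∀ a < n + 2, ∀ b < n + 2, σ'.mem (.work 3) (a * (n + 2) + b) = ((f a b ^^
        (decide (a = u ∧ b = v) && (i ^^ (g ^^ f u v)))) ^^
        (decide (a = v ∧ b = u) && (i ^^ (g ^^ f u v)))).toNat := by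
  have hsz : ∀ s, s ≤ 1000 → β * s ≤ w := fun s hs => (Nat.mul_le_mul_left _ hs).trans hw
  have hβ2 : 2 ≤ 2 ^ β := by simpa using Nat.pow_le_pow_right (n := 2) (by norm_num) hβ
  have hbit : ∀ b : Bool, b.toNat < 2 ^ β := fun b => (Bool.toNat_lt b).trans_le hβ2
  set δ := (i ^^ (g ^^ f u v)) with hδ
  obtain ⟨r1, b1⟩ := reach_assign_val (w := w) (ω := ω) (r := 20)
    (e := .var 20 ^^^ (.load (.data 1) (.var 18 * .var 2 + .var 19) ^^^
      .load (.work 3) (.var 18 * .var 2 + .var 19))) (x := δ.toNat) hβ hσ rfl (hsz _ (by decide))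
    (by simp [h18, h19, h20, h2, hg, hf u hu v hv, toNat_xor, hδ]) (hbit _)
  have r2 := reach_put (w := w) (ω := ω) (A := .work 3) (a := .var 18 * .var 2 + .var 19)
    (e := .load (.work 3) (.var 18 * .var 2 + .var 19) ^^^ .var 20) hβ b1 rfl rfl
    (hsz _ (by decide)) (hsz _ (by decide))
  have e1 : eval (σ.setReg 20 δ.toNat).mem (.var 18 * .var 2 + .var 19)
      (σ.setReg 20 δ.toNat).reg = u * (n + 2) + v := by simp [h18, h19, h2]
  have e2 : eval (σ.setReg 20 δ.toNat).mem
      (.load (.work 3) (.var 18 * .var 2 + .var 19) ^^^ .var 20)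
      (σ.setReg 20 δ.toNat).reg = (f u v ^^ δ).toNat := by
    simp [h18, h19, h2, hf u hu v hv, toNat_xor]
  rw [e1, e2] at r2
  have b2 := b1.setMem (A := .work 3) (i := u * (n + 2) + v) (hbit (f u v ^^ δ))
  set τ := (σ.setReg 20 δ.toNat).setMem (.work 3) (u * (n + 2) + v) (f u v ^^ δ).toNat with hτ
  have hτ3 : ∀ a < n + 2, ∀ b < n + 2, τ.mem (.work 3) (a * (n + 2) + b) =
      (f a b ^^ (decide (a = u ∧ b = v) && δ)).toNat := by
    intro a ha b hb
    simp only [hτ, State.setMem, State.setReg_mem, Function.update_self, Function.update_apply]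
    by_cases h : a = u ∧ b = v
    · simp [h]
    · rw [if_neg fun h' => h (encode_inj hb hv h'), hf a ha b hb]; simp [h]
  have r3 := reach_put (w := w) (ω := ω) (A := .work 3) (a := .var 19 * .var 2 + .var 18)
    (e := .load (.work 3) (.var 19 * .var 2 + .var 18) ^^^ .var 20) hβ b2 rfl rfl
    (hsz _ (by decide)) (hsz _ (by decide))
  have e3 : eval τ.mem (.var 19 * .var 2 + .var 18) τ.reg = v * (n + 2) + u := by
    simp [hτ, h18, h19, h2]
  have e4 : eval τ.mem (.load (.work 3) (.var 19 * .var 2 + .var 18) ^^^ .var 20) τ.reg =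
      ((f v u ^^ (decide (v = u ∧ u = v) && δ)) ^^ δ).toNat := by
    rw [eval_xor, eval_load, e3, hτ3 v hv u hu, eval_var, ← toNat_xor _ δ]
    simp [hτ]
  rw [e3, e4] at r3
  refine ⟨_, (r1.seq (r2.seq r3)).mono (by simp), b2.setMem (hbit _), ?_, ?_, ?_⟩
  · intro B hB
    simp [State.setMem, hτ, Function.update_of_ne hB]
  · intro r hr
    simp [hτ, Function.update_of_ne hr]
  · intro a ha b hb
    simp only [State.setMem, Function.update_self, Function.update_apply]
    by_cases h : a = v ∧ b = u
    · obtain ⟨rfl, rfl⟩ := h; simp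
    · rw [if_neg fun h' => h (encode_inj hb hu h'), hτ3 a ha b hb]; simp [h]

/-- Process the update whose index is in register `36`. -/
def scanStep : Cmd :=
  .seq (.load 18 (.work 1) 36) (.seq (.load 19 (.work 2) 36) (.seq (.load 20 (.work 0) 36)
    (.seq toggle (.seq (.load 22 (.work 1) 36) (.seq touch
    (.seq (.load 22 (.work 2) 36) touch))))))

/-- The arrays describe the difference between the graphs with adjacency matrices `g` and `h`. -/
structure Diff (n : ℕ) (g h : ℕ → ℕ → Bool) (σ : State) : Prop where
  flip : ∀ u < n + 2, ∀ v < n + 2, σ.mem (.work 3) (u * (n + 2) + v) = (h u v ^^ g u v).toNat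
  marks : Marks n (σ.mem (.work 4)) (σ.mem (.work 5)) (σ.reg 16)
  touched : ∀ u v, (h u v ^^ g u v) → (∃ t < σ.reg 16, σ.mem (.work 4) t = u) ∧
    ∃ t < σ.reg 16, σ.mem (.work 4) t = v

theorem reach_scanStep (hβ : 1 ≤ β) (hσ : Bounded β σ) (hw : β * 1000 ≤ w) (hn : n + 2 < 2 ^ β)
    (h2 : σ.reg 2 = n + 2) {g : ℕ → ℕ → Bool} {H : SimpleGraph (Fin n)} (e : EdgeUpdate n) {i : ℕ}
    (h36 : σ.reg 36 = i) (hi0 : σ.mem (.work 0) i = e.insert.toNat)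
    (hi1 : σ.mem (.work 1) i = e.u) (hi2 : σ.mem (.work 2) i = e.v)
    (hg : ∀ u < n, ∀ v < n, σ.mem (.data 1) (u * (n + 2) + v) = (g u v).toNat)
    (hS : Diff n g (adjB H) σ) :
    ∃ σ', Reach w ω scanStep σ 200 σ' ∧ Bounded β σ' ∧
      (∀ B, B ≠ .work 3 → B ≠ .work 4 → B ≠ .work 5 → σ'.mem B = σ.mem B) ∧
      (∀ r, r ≠ 16 → r ≠ 18 → r ≠ 19 → r ≠ 20 → r ≠ 22 → σ'.reg r = σ.reg r) ∧
      Diff n g (adjB (e.apply H)) σ' ∧ σ'.reg 16 ≤ σ.reg 16 + 2 := by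
  have hβ2 : 2 ≤ 2 ^ β := by simpa using Nat.pow_le_pow_right (n := 2) (by norm_num) hβ
  have hu := e.u.2
  have hv := e.v.2
  have hb : ∀ b : Bool, b.toNat < 2 ^ β := fun b => (Bool.toNat_lt b).trans_le hβ2
  have l1 := reach_load (w := w) (ω := ω) (σ := σ) (r := 18) (A := .work 1) (i := 36) (by norm_num)
  rw [h36, hi1] at l1
  have l2 := reach_load (w := w) (ω := ω) (σ := σ.setReg 18 e.u) (r := 19) (A := .work 2) (i := 36)
    (by norm_num)
  rw [show (σ.setReg 18 e.u).reg 36 = i by simpa using h36, State.setReg_mem, hi2] at l2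
  have l3 := reach_load (w := w) (ω := ω) (σ := (σ.setReg 18 e.u).setReg 19 e.v) (r := 20)
    (A := .work 0) (i := 36) (by norm_num)
  rw [show ((σ.setReg 18 e.u).setReg 19 e.v).reg 36 = i by simpa using h36, State.setReg_mem,
    State.setReg_mem, hi0] at l3
  have b3 : Bounded β (((σ.setReg 18 e.u).setReg 19 e.v).setReg 20 e.insert.toNat) :=
    ((hσ.setReg (by omega)).setReg (by omega)).setReg (hb _)
  set τ := ((σ.setReg 18 e.u).setReg 19 e.v).setReg 20 e.insert.toNat with hτ
  have hτr : ∀ r, r ≠ 18 → r ≠ 19 → r ≠ 20 → τ.reg r = σ.reg r := fun r h h' h'' => by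
    simp [hτ, Function.update_of_ne h, Function.update_of_ne h', Function.update_of_ne h'']
  obtain ⟨σ₁, r1, bd1, m1, g1, f1⟩ := reach_toggle (ω := ω) (n := n) hβ b3 hw
    (by rw [hτr 2 (by decide) (by decide) (by decide), h2]) (u := e.u) (v := e.v) (i := e.insert)
    (by omega) (by omega)
    (by simp [hτ]) (by simp [hτ]) (by simp [hτ]) (hg _ hu _ hv) hS.flip
  have hr1 : ∀ r, r ≠ 18 → r ≠ 19 → r ≠ 20 → σ₁.reg r = σ.reg r := fun r h h' h'' => by
    rw [g1 r h'', hτr r h h' h'']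
  have l4 := reach_load (w := w) (ω := ω) (σ := σ₁) (r := 22) (A := .work 1) (i := 36) (by norm_num)
  rw [hr1 36 (by decide) (by decide) (by decide), h36, m1 _ (by decide),
    show τ.mem (.work 1) i = e.u from hi1] at l4
  have hM1 : Marks n ((σ₁.setReg 22 e.u).mem (.work 4)) ((σ₁.setReg 22 e.u).mem (.work 5))
      ((σ₁.setReg 22 e.u).reg 16) := by
    have h16 : (σ₁.setReg 22 e.u).reg 16 = σ.reg 16 := by
      simpa using hr1 16 (by decide) (by decide) (by decide)
    rw [h16, State.setReg_mem, m1 _ (by decide), m1 _ (by decide)]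
    exact hS.marks
  obtain ⟨σ₂, r2, bd2, m2, g2, mk2, le2, le2', st2, ex2⟩ := reach_touch (ω := ω) hβ
    (bd1.setReg (r := 22) (x := e.u) (by omega)) hw hn (u := e.u) (by simp) hu hM1
  have hr2 : ∀ r, r ≠ 16 → r ≠ 18 → r ≠ 19 → r ≠ 20 → r ≠ 22 → σ₂.reg r = σ.reg r :=
    fun r h16 h h' h'' h22 => by
      rw [g2 r h16, State.setReg_reg, Function.update_of_ne h22, hr1 r h h' h'']
  have l5 := reach_load (w := w) (ω := ω) (σ := σ₂) (r := 22) (A := .work 2) (i := 36) (by norm_num)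
  rw [hr2 36 (by decide) (by decide) (by decide) (by decide) (by decide), h36,
    m2 _ (by decide) (by decide), State.setReg_mem, m1 _ (by decide),
    show τ.mem (.work 2) i = e.v from hi2] at l5
  obtain ⟨σ₃, r3, bd3, m3, g3, mk3, le3, le3', st3, ex3⟩ := reach_touch (ω := ω) hβ
    (bd2.setReg (r := 22) (x := e.v) (by omega)) hw hn (u := e.v) (by simp) hv (by simpa using mk2)
  have h16 : (σ₁.setReg 22 e.u).reg 16 = σ.reg 16 := by
    simpa using hr1 16 (by decide) (by decide) (by decide)
  have h16' : (σ₂.setReg 22 e.v).reg 16 = σ₂.reg 16 := by simp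
  rw [h16] at le2 le2' st2
  rw [h16'] at le3 le3' st3
  have hkeep : ∀ t < σ.reg 16, σ₃.mem (.work 4) t = σ.mem (.work 4) t := fun t ht => by
    rw [st3 t (by omega), State.setReg_mem, st2 t ht, State.setReg_mem, m1 _ (by decide)]
    rfl
  refine ⟨σ₃, (l1.seq (l2.seq (l3.seq (r1.seq (l4.seq (r2.seq (l5.seq r3))))))).mono (by norm_num),
    bd3, ?_, ?_, ⟨?_, mk3, ?_⟩, by omega⟩
  · intro B h3 h4 h5
    rw [m3 B h4 h5, State.setReg_mem, m2 B h4 h5, State.setReg_mem, m1 B h3]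
    rfl
  · intro r h16 h18 h19 h20 h22
    rw [g3 r h16, State.setReg_reg, Function.update_of_ne h22, hr2 r h16 h18 h19 h20 h22]
  · intro a ha b hb
    rw [m3 _ (by decide) (by decide), State.setReg_mem, m2 _ (by decide) (by decide),
      State.setReg_mem, f1 a ha b hb, adjB_apply]
    congr 1
    have hx : (g e.u e.v ^^ (adjB H e.u e.v ^^ g e.u e.v)) = adjB H e.u e.v := by
      cases g e.u e.v <;> cases adjB H e.u e.v <;> rfl
    rw [hx]
    generalize (decide (a = e.u ∧ b = e.v) && (e.insert ^^ adjB H e.u e.v)) = y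
    generalize (decide (a = e.v ∧ b = e.u) && (e.insert ^^ adjB H e.u e.v)) = z
    cases adjB H a b <;> cases g a b <;> cases y <;> cases z <;> rfl
  · intro a b hab
    have hu3 : ∃ t < σ₃.reg 16, σ₃.mem (.work 4) t = e.u := by
      obtain ⟨t, ht, h⟩ := ex2
      exact ⟨t, by omega, by rw [st3 t ht, State.setReg_mem, h]⟩
    by_cases h1 : a = e.u ∧ b = e.v
    · rw [h1.1, h1.2]; exact ⟨hu3, ex3⟩
    · by_cases h2 : a = e.v ∧ b = e.u
      · rw [h2.1, h2.2]; exact ⟨ex3, hu3⟩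
      · rw [adjB_apply] at hab
        simp only [h1, h2, decide_false, Bool.false_and, Bool.xor_false] at hab
        obtain ⟨⟨s, hs, h⟩, ⟨t, ht, h'⟩⟩ := hS.touched a b hab
        exact ⟨⟨s, by omega, by rw [hkeep s hs, h]⟩, ⟨t, by omega, by rw [hkeep t ht, h']⟩⟩

end Scan

end WordRAM

/-! ### Answering a query -/

namespace WordRAM

open WordRAM.Expr
open scoped Polynomial

section Scan

variable {w : ℕ} {ω : ℕ → Bool} {β n k m q D : ℕ} {σ : State}

theorem applyUpdates_take_succ (G : SimpleGraph (Fin n)) (L : List (EdgeUpdate n)) {i : ℕ}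
    (hi : i < L.length) :
    applyUpdates G (L.take (i + 1)) = (L[i]).apply (applyUpdates G (L.take i)) := by
  rw [List.take_add_one, List.getElem?_eq_getElem hi]
  simp only [applyUpdates, List.foldl_append, Option.toList_some, List.foldl_cons, List.foldl_nil]

theorem reach_scan (hβ : 1 ≤ β) (hσ : Bounded β σ) (hw : β * 1000 ≤ w) (hn : n + 2 < 2 ^ β)
    (hP : Params n k m q D σ.reg) (G : SimpleGraph (Fin n)) (L : List (EdgeUpdate n))
    (hL : L.length < 2 ^ w) (h35 : σ.reg 35 = L.length) (h16 : σ.reg 16 = 0)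
    (h3 : ∀ i, σ.mem (.work 3) i = 0) (h5 : ∀ i, σ.mem (.work 5) i = 0)
    (hLm : ∀ i, (hi : i < L.length) → σ.mem (.work 0) i = (L[i]).insert.toNat ∧
      σ.mem (.work 1) i = (L[i]).u ∧ σ.mem (.work 2) i = (L[i]).v)
    (hg : ∀ u < n, ∀ v < n, σ.mem (.data 1) (u * (n + 2) + v) = (adjB G u v).toNat) :
    ∃ σ', Reach w ω (forLoop 36 35 vis scanStep) σ (L.length * 204 + 3) σ' ∧ Bounded β σ' ∧
      Params n k m q D σ'.reg ∧
      (∀ B, B ≠ .work 3 → B ≠ .work 4 → B ≠ .work 5 → σ'.mem B = σ.mem B) ∧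
      Diff n (adjB G) (adjB (applyUpdates G L)) σ' ∧ σ'.reg 16 ≤ 2 * L.length := by
  have hβw : β ≤ w := le_trans (Nat.le_mul_of_pos_right β (by norm_num)) hw
  -- After `i` updates the arrays describe the difference between `G` and the graph after the first
  -- `i` updates; every update touches at most two new vertices.
  let Inv : ℕ → State → Prop := fun i τ => Bounded β τ ∧ Params n k m q D τ.reg ∧
    (∀ B, B ≠ .work 3 → B ≠ .work 4 → B ≠ .work 5 → τ.mem B = σ.mem B) ∧
    Diff n (adjB G) (adjB (applyUpdates G (L.take i))) τ ∧ τ.reg 16 ≤ 2 * i ∧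
    τ.reg 35 = L.length
  have hInv : ∀ i τ x, Inv i τ → Inv i (τ.setReg 36 x) := by
    rintro i τ x ⟨i1, i2, i3, i4, i5, i6⟩
    refine ⟨⟨fun r hr => ?_, i1.mem⟩, i2.congr fun r hr => ?_, i3, ⟨i4.flip, ?_, ?_⟩, ?_, ?_⟩
    · rw [State.setReg_reg, Function.update_of_ne (by omega)]; exact i1.reg r hr
    · rw [State.setReg_reg, Function.update_of_ne (by omega)]
    · simpa using i4.marks
    · simpa using i4.touched
    · simpa using i5
    · simpa using i6
  have hbody : ∀ i < L.length, ∀ τ, Inv i τ → ∃ τ', Reach w ω scanStep (τ.setReg 36 i) 200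
      (τ'.setReg 36 i) ∧ Inv (i + 1) τ' := by
    intro i hi τ hτ
    obtain ⟨i1, i2, i3, i4, i5, i6⟩ := hInv _ _ i hτ
    obtain ⟨e0, e1, e2⟩ := hLm i hi
    obtain ⟨τ', r, bd, mm, gg, df, le⟩ := reach_scanStep (ω := ω) hβ i1 hw hn i2.reg_n2
      (g := adjB G) (H := applyUpdates G (L.take i)) L[i] (i := i) (by simp)
      (by rw [i3 _ (by decide) (by decide) (by decide), e0])
      (by rw [i3 _ (by decide) (by decide) (by decide), e1])
      (by rw [i3 _ (by decide) (by decide) (by decide), e2])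
      (by rw [i3 _ (by decide) (by decide) (by decide)]; exact hg) i4
    have h36 : τ'.reg 36 = i := by
      rw [gg 36 (by decide) (by decide) (by decide) (by decide) (by decide)]; simp
    have hset : τ'.setReg 36 i = τ' := by
      rw [State.setReg, ← h36, Function.update_eq_self]
    refine ⟨τ', by rw [hset]; exact r, bd, i2.congr fun r hr => ?_, fun B b3 b4 b5 => ?_, ?_, ?_, ?_⟩
    · rw [gg r (by omega) (by omega) (by omega) (by omega) (by omega)]
    · rw [mm B b3 b4 b5, i3 B b3 b4 b5]
    · rw [applyUpdates_take_succ G L hi]; exact df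
    · omega
    · rw [gg 35 (by decide) (by decide) (by decide) (by decide) (by decide), i6]
  obtain ⟨σ', r, i⟩ := reach_forLoop_of_invariant (w := w) (ω := ω) (hβ.trans hβw) (r := 36)
    (rb := 35) (N := L.length) (T := 200) (body := scanStep) Inv (by norm_num) (by norm_num)
    (by norm_num) hL (fun i τ h => h.2.2.2.2.2) (σ := σ)
    ⟨hσ, hP, fun _ _ _ _ => rfl, ⟨fun u _ v _ => by simp [h3, applyUpdates],
      ⟨fun t ht => by omega, fun t ht => by omega, fun t ht => by omega, fun u _ => h5 u⟩,
      fun u v h => by simp [applyUpdates] at h⟩, by omega, h35⟩ hbody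
  obtain ⟨i1, i2, i3, i4, i5, -⟩ := hInv _ _ L.length i
  rw [List.take_length] at i4
  exact ⟨_, r, i1, i2, i3, i4, i5⟩

end Scan

/-! ### Walks from the source in the updated graph. -/

section Walks

variable {w : ℕ} {ω : ℕ → Bool} {β n k m q D : ℕ} {σ : State} {sd : ℕ → Bool}
  {g h : ℕ → ℕ → Bool} {x : ℕ → ℕ → (ZMod 2)[X]}

/-- The states of the vertices listed by `f`. -/
def listed (f : ℕ → ℕ) (b : ℕ) : ℕ := 2 * f (b / 2) + b % 2

def listedExpr (e : Expr) : Expr := 2 * .load (.work 4) (e / 2) + e % 2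

@[simp] theorem eval_listedExpr (mem : Arr → ℕ → ℕ) (reg : ℕ → ℕ) (e : Expr) :
    (listedExpr e).eval mem reg = listed (mem (.work 4)) (e.eval mem reg) := by
  simp [listedExpr, listed]

@[simp] theorem cost_listedExpr (reg : ℕ → ℕ) (e : Expr) :
    (listedExpr e).cost reg = 2 * e.cost reg + 16 := by
  simp [listedExpr]; omega

theorem listed_lt {f : ℕ → ℕ} {N A b : ℕ} (hf : ∀ t < A, f t < N) (hb : b < 2 * A) :
    listed f b < 2 * N := by
  have := hf (b / 2) (by omega)
  unfold listed; omega

theorem listed_inj {f : ℕ → ℕ} {A b c : ℕ} (hf : ∀ s < A, ∀ t < A, f s = f t → s = t)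
    (hb : b < 2 * A) (hc : c < 2 * A) (hbc : listed f b = listed f c) : b = c := by
  unfold listed at hbc
  have := hf (b / 2) (by omega) (c / 2) (by omega) (by omega)
  omega

theorem exists_listed {f : ℕ → ℕ} {A a : ℕ} (h : ∃ t < A, f t = a / 2) :
    ∃ b < 2 * A, listed f b = a := by
  obtain ⟨t, ht, h⟩ := h
  refine ⟨2 * t + a % 2, by omega, ?_⟩
  unfold listed
  rw [show (2 * t + a % 2) / 2 = t by omega, h]; omega

/-- The stored power plus the correction terms of `powW_update`, restricted to the row of the source
and to listed columns. Registers `100`, `110` and `120` run over the exponent and the two ends of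
the changed step; the nested convolutions multiply the three truncated polynomials. -/
def walkExpr : Expr :=
  entry (.data 3) (((curIdx / .var 21 / .var 8 * .var 8 + curIdx / .var 21 % .var 8) * .var 3 +
    2 * .var 0) * .var 3 + listedExpr (curIdx % .var 21)) curPos ^^^
  .xsum 100 8 (.op .lt (.var 100) (curIdx / .var 21 % .var 8) * .xsum 110 21 (.xsum 120 21
    (.load (.work 3) (listedExpr (.var 110) / 2 * .var 2 + listedExpr (.var 120) / 2) *
      conv 130 curPos
        (entry (.work 6) ((curIdx / .var 21 / .var 8 * .var 8 + .var 100) * .var 21 + .var 110)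
          (.var 130))
        (conv 140 (curPos - .var 130)
          (entry (.data 2) ((curIdx / .var 21 / .var 8 * .var 3 + listedExpr (.var 110)) * .var 3 +
            listedExpr (.var 120)) (.var 140))
          (entry (.data 3) (((curIdx / .var 21 / .var 8 * .var 8 +
            (curIdx / .var 21 % .var 8 - 1 - .var 100)) * .var 3 + listedExpr (.var 120)) * .var 3 +
            listedExpr (curIdx % .var 21)) (curPos - .var 130 - .var 140))))))

/-- The touched list, with the sink included by the caller, is closed under the recursion: a changed
step starts and ends at listed states, and everything after it is read from the stored powers. Hence
both the number of cells and the cost of each depend on the number `A` of listed vertices but not on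
`n`. -/
theorem reach_walkTable (hβ : 1 ≤ β) (hσ : Bounded β σ) (hP : Params n k m q D σ.reg)
    (hw : β * 1000 ≤ w) {A : ℕ} (hA : 0 < A) (h21 : σ.reg 21 = 2 * A)
    (hNβ : 2 ^ m * (k + 2) * (2 * A) * D < 2 ^ β)
    (hS : Stored n k m D sd g x σ.mem)
    (hg : ∀ u v, g u v → u < n ∧ v < n) (hh : ∀ u v, h u v → u < n ∧ v < n)
    (hflip : ∀ u < n + 2, ∀ v < n + 2,
      σ.mem (.work 3) (u * (n + 2) + v) = (h u v ^^ g u v).toNat)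
    (hlt : ∀ t < A, σ.mem (.work 4) t < n + 2)
    (hinj : ∀ s < A, ∀ t < A, σ.mem (.work 4) s = σ.mem (.work 4) t → s = t)
    (htouched : ∀ u v, (h u v ^^ g u v) → (∃ t < A, σ.mem (.work 4) t = u) ∧
      ∃ t < A, σ.mem (.work 4) t = v) :
    ∃ σ', Reach w ω (table (.work 6) (.var 7 * .var 8 * .var 21 * .var 5) walkExpr) σ
        (2 ^ m * (k + 2) * (2 * A) * D *
          (1000 * ((k + 2) * (2 * A) * (2 * A) * ((D + 1) * (D + 1)))) + 30) σ' ∧ Bounded β σ' ∧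
      HasTable D (2 ^ m * (k + 2) * (2 * A))
        (fun a => powW (edgeW n k m sd h x (a / (2 * A) / (k + 2))) (2 * (n + 2))
          (a / (2 * A) % (k + 2)) (2 * n) (listed (σ.mem (.work 4)) (a % (2 * A))))
        (σ'.mem (.work 6)) ∧
      (∀ B ≠ .work 6, σ'.mem B = σ.mem B) ∧ σ'.coins = σ.coins ∧
      ∀ r, r ≠ 9 → r ≠ 14 → σ'.reg r = σ.reg r := by
  have hsz : ∀ s, s ≤ 1000 → β * s ≤ w := fun s hs => (Nat.mul_le_mul_left _ hs).trans hw
  refine reach_polyTable (C := 900 * ((k + 2) * (2 * A) * (2 * A) * ((D + 1) * (D + 1)))) hβ hσ hP _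
    rfl rfl (hsz _ (by decide)) (hsz _ (by decide))
    (by simp [hP.reg_P, hP.reg_D, hP.reg_K, h21]) hNβ ?_ ?_ ?_
  · have h1 : 1 ≤ (k + 2) * (2 * A) * (2 * A) * ((D + 1) * (D + 1)) := by
      have : 0 < (k + 2) * (2 * A) * (2 * A) * ((D + 1) * (D + 1)) := by positivity
      omega
    have := Nat.mul_le_mul_left (2 ^ m * (k + 2) * (2 * A) * D)
      (show 900 * ((k + 2) * (2 * A) * (2 * A) * ((D + 1) * (D + 1))) + 6 ≤
        1000 * ((k + 2) * (2 * A) * (2 * A) * ((D + 1) * (D + 1))) by omega)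
    simp only [cost_mul, cost_var]
    omega
  · intro a ha d hd mem reg hmem htab hreg hR h14
    have h21' : reg 21 = 2 * A := by rw [hreg 21 (by decide) (by decide), h21]
    have e3 : curIdx.eval mem reg = a := eval_curIdx hR.reg_D hd h14
    have e4 : curPos.eval mem reg = d := eval_curPos hR.reg_D hd h14
    set f := σ.mem (.work 4) with hf
    have hmf : mem (.work 4) = f := hmem _ (by decide)
    have hS2 := hS.step
    have hS3 := hS.pow
    have hMn : 2 * n < 2 * (n + 2) := by omega
    have hpM : ∀ b < 2 * A, listed f b < 2 * (n + 2) := fun b hb => listed_lt hlt hb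
    have hd2 : ∀ b < 2 * A, listed f b / 2 < n + 2 := fun b hb => by have := hpM b hb; omega
    set M := 2 * (n + 2) with hM
    set B := 2 * A with hB
    have hB0 : 0 < B := by omega
    have hM0 : 0 < M := by omega
    have hb0 : a % B < B := Nat.mod_lt _ hB0
    have hbB : a / B < 2 ^ m * (k + 2) := (Nat.div_lt_iff_lt_mul hB0).2 ha
    set c := a / B with hc
    have hj : c % (k + 2) < k + 2 := Nat.mod_lt _ (by omega)
    have hX : c / (k + 2) < 2 ^ m := (Nat.div_lt_iff_lt_mul (by omega)).2 hbB
    set X := c / (k + 2) with hXd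
    set j := c % (k + 2) with hjd
    have hac : a = (X * (k + 2) + j) * B + a % B := by
      rw [hXd, hjd, Nat.div_add_mod', hc, Nat.div_add_mod']
    have hpow := powW_update (M := M) (B := B) (s := 2 * n) (q := listed f (a % B)) (p := listed f)
      (N := edgeW n k m sd g x X) (N' := edgeW n k m sd h x X)
      (Δ := fun p q => if (h (p / 2) (q / 2) ^^ g (p / 2) (q / 2)) then stepW n k m sd x X p q else 0)
      hpM (fun b hb c hc => listed_inj hinj hb hc)
      (fun p _ q _ => edgeW_eq_add hg hh X p q)
      (fun p _ q _ hne => by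
        have hx : (h (p / 2) (q / 2) ^^ g (p / 2) (q / 2)) = true := by
          by_contra h'; exact hne (if_neg h')
        exact ⟨exists_listed (htouched _ _ hx).1, exists_listed (htouched _ _ hx).2⟩)
      hMn (hpM _ hb0) j
    have e5 := eval_entry (mem := mem) (reg := reg) (A := .data 3)
      (i := ((curIdx / .var 21 / .var 8 * .var 8 + curIdx / .var 21 % .var 8) * .var 3 +
        2 * .var 0) * .var 3 + listedExpr (curIdx % .var 21)) (d := curPos) hR.reg_D
      (hmem (.data 3) (by decide) ▸ hS3) (i₀ := ((X * (k + 2) + j) * M + 2 * n) * M + listed f (a % B))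
      (by simp only [eval_add, eval_mul, eval_div, eval_mod, eval_var, eval_ofNat, e3, h21',
            hR.reg_K, hR.reg_M, hR.reg_n, eval_listedExpr, hmf, ← hc, ← hXd, ← hjd, ← hM])
      (encode_lt (encode_lt (encode_lt hX hj) hMn) (hpM _ hb0)) e4 hd
    simp only [encode_div _ (hpM _ hb0), encode_mod _ (hpM _ hb0), encode_div _ hMn,
      encode_mod _ hMn, encode_div _ hj, encode_mod _ hj] at e5
    rw [walkExpr, eval_xor, e5, eval_xsum_val hR.reg_K (F := fun i => if i < j then
      ∑ b ∈ Finset.range B, ∑ c ∈ Finset.range B,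
        (powW (edgeW n k m sd h x X) M i (2 * n) (listed f b) *
          ((if (h (listed f b / 2) (listed f c / 2) ^^ g (listed f b / 2) (listed f c / 2))
            then stepW n k m sd x X (listed f b) (listed f c) else 0) *
          powW (edgeW n k m sd g x X) M (j - 1 - i) (listed f c) (listed f (a % B)))).coeff d else 0)
      ?_, val_two_xor, hpow, Polynomial.coeff_add, Polynomial.finsetSum_coeff]
    · congr 2
      rw [← Finset.sum_filter]
      refine Finset.sum_congr ?_ fun i _ => ?_
      · ext i; simp only [Finset.mem_filter, Finset.mem_range]; omega
      · simp only [Polynomial.finsetSum_coeff]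
    · intro i hi
      rw [eval_mul, eval_lt', eval_var, Function.update_self]
      have hreg1 : ∀ r, r ≠ 100 → Function.update reg 100 i r = reg r := fun r hr =>
        Function.update_of_ne hr _ _
      have hjv : eval mem (curIdx / .var 21 % .var 8) (Function.update reg 100 i) = j := by
        simp only [eval_mod, eval_div, eval_var, hreg1 21 (by decide), hreg1 8 (by decide), h21',
          hR.reg_K, eval_curIdx (mem := mem) ((hreg1 5 (by decide)).trans hR.reg_D) hd
          ((hreg1 14 (by decide)).trans h14), ← hc, ← hjd]
      rw [hjv]
      -- The loop runs over all exponents because its bound must be a register. For `i ≥ j` the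
      -- lookups are meaningless but harmless, since the factor in front is zero.
      by_cases hij : i < j
      · rw [if_pos hij, if_pos hij, one_mul]
        refine eval_xsum_val (by rw [hreg1 21 (by decide), h21']) fun b hb => ?_
        refine eval_xsum_val (by rw [Function.update_of_ne (by decide), hreg1 21 (by decide), h21'])
          fun c' hc' => ?_
        set R := Function.update (Function.update (Function.update reg 100 i) 110 b) 120 c' with hRd
        have f100 : R 100 = i := by simp [hRd]
        have f110 : R 110 = b := by simp [hRd]
        have f120 : R 120 = c' := by simp [hRd]
        have fR : ∀ r < 100, R r = reg r := fun r hr => by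
          rw [hRd, Function.update_of_ne (by omega), Function.update_of_ne (by omega),
            Function.update_of_ne (by omega)]
        have g1 : ∀ α r, r ≠ 130 → Function.update R 130 α r = R r := fun α r hr =>
          Function.update_of_ne hr _ _
        have g2 : ∀ α α' r, r ≠ 140 → Function.update (Function.update R 130 α) 140 α' r =
          Function.update R 130 α r := fun α α' r hr => Function.update_of_ne hr _ _
        have fD : R 5 = D := by rw [fR 5 (by decide), hR.reg_D]
        have f14 : R 14 = a * D + d := by rw [fR 14 (by decide), h14]
        have i1 : ∀ α, eval mem curIdx (Function.update R 130 α) = a := fun α =>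
          eval_curIdx (by rw [g1 α 5 (by decide), fD]) hd (by rw [g1 α 14 (by decide), f14])
        have p1 : ∀ α, eval mem curPos (Function.update R 130 α) = d := fun α =>
          eval_curPos (by rw [g1 α 5 (by decide), fD]) hd (by rw [g1 α 14 (by decide), f14])
        have i2 : ∀ α α', eval mem curIdx (Function.update (Function.update R 130 α) 140 α') = a :=
          fun α α' => eval_curIdx (by rw [g2 α α' 5 (by decide), g1 α 5 (by decide), fD]) hd
            (by rw [g2 α α' 14 (by decide), g1 α 14 (by decide), f14])
        have p2 : ∀ α α', eval mem curPos (Function.update (Function.update R 130 α) 140 α') = d :=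
          fun α α' => eval_curPos (by rw [g2 α α' 5 (by decide), g1 α 5 (by decide), fD]) hd
            (by rw [g2 α α' 14 (by decide), g1 α 14 (by decide), f14])
        have hlb := hpM b hb
        have hlc := hpM c' hc'
        rw [eval_mul, eval_conv (D := D) (d₀ := d)
          (F := powW (edgeW n k m sd h x X) M i (2 * n) (listed f b))
          (G := stepW n k m sd x X (listed f b) (listed f c') *
            powW (edgeW n k m sd g x X) M (j - 1 - i) (listed f c') (listed f (a % B))) fD p1 hd ?_ ?_]
        · simp only [eval_load, eval_add, eval_mul, eval_div, eval_var, eval_ofNat, eval_listedExpr,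
            hmf, f110, f120, fR 2 (by decide), hR.reg_n2]
          rw [hmem (.work 3) (by decide), hflip _ (hd2 b hb) _ (hd2 c' hc'), toNat_mul_val,
            ← coeff_ite]
          congr 2
          split_ifs <;> simp
        · intro α hα
          -- Smaller exponents with the same label set come earlier in this table, so they are
          -- already available.
          have hlt' : (X * (k + 2) + i) * B + b < a := by
            conv_rhs => rw [hac]
            exact encode_lt_encode (by omega) hb
          rw [eval_entry (D := D) (by rw [g1 α 5 (by decide), fD]) htab
            (i₀ := (X * (k + 2) + i) * B + b)
            (by simp only [eval_add, eval_mul, eval_div, eval_var, i1, g1 α 21 (by decide),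
                  g1 α 8 (by decide), g1 α 100 (by decide), g1 α 110 (by decide), f100, f110,
                  fR 21 (by decide), fR 8 (by decide), h21', hR.reg_K, ← hc, ← hXd])
            hlt' (d₀ := α) (by simp) (by omega)]
          simp only [encode_div _ hb, encode_mod _ hb, encode_div _ (show i < k + 2 by omega),
            encode_mod _ (show i < k + 2 by omega)]
        · intro α hα
          refine eval_conv (D := D) (by rw [g1 α 5 (by decide), fD]) (fun α' => ?_) (by omega) ?_ ?_
          · simp only [eval_sub, eval_var, p2, g2 α α' 130 (by decide), Function.update_self]
          · intro α' hα'
            rw [eval_entry (D := D) (by rw [g2 α α' 5 (by decide), g1 α 5 (by decide), fD])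
              (hmem (.data 2) (by decide) ▸ hS2) (i₀ := (X * M + listed f b) * M + listed f c')
              (by simp only [eval_add, eval_mul, eval_div, eval_var, i2, eval_listedExpr, hmf,
                    g2 α α' 21 (by decide), g2 α α' 8 (by decide), g2 α α' 3 (by decide),
                    g2 α α' 110 (by decide), g2 α α' 120 (by decide), g1 α 21 (by decide),
                    g1 α 8 (by decide), g1 α 3 (by decide), g1 α 110 (by decide),
                    g1 α 120 (by decide), f110, f120, fR 21 (by decide), fR 8 (by decide),
                    fR 3 (by decide), h21', hR.reg_K, hR.reg_M, ← hc, ← hXd, ← hM])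
              (encode_lt (encode_lt hX hlb) hlc) (d₀ := α') (by simp) (by omega)]
            simp only [encode_div _ hlb, encode_mod _ hlb, encode_div _ hlc, encode_mod _ hlc]
          · intro α' hα'
            have hj' : j - 1 - i < k + 2 := by omega
            rw [eval_entry (D := D) (by rw [g2 α α' 5 (by decide), g1 α 5 (by decide), fD])
              (hmem (.data 3) (by decide) ▸ hS3)
              (i₀ := ((X * (k + 2) + (j - 1 - i)) * M + listed f c') * M + listed f (a % B))
              (by simp only [eval_add, eval_mul, eval_div, eval_mod, eval_sub, eval_var, eval_ofNat,
                    i2, eval_listedExpr, hmf,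
                    g2 α α' 21 (by decide), g2 α α' 8 (by decide), g2 α α' 3 (by decide),
                    g2 α α' 100 (by decide), g2 α α' 120 (by decide), g1 α 21 (by decide),
                    g1 α 8 (by decide), g1 α 3 (by decide), g1 α 100 (by decide),
                    g1 α 120 (by decide), f100, f120, fR 21 (by decide), fR 8 (by decide),
                    fR 3 (by decide), h21', hR.reg_K, hR.reg_M, ← hc, ← hXd, ← hjd, ← hM])
              (encode_lt (encode_lt (encode_lt hX hj') hlc) (hpM _ hb0)) (d₀ := d - α - α')
              (by simp only [eval_sub, eval_var, p2, g2 α α' 130 (by decide), Function.update_self])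
              (by omega)]
            simp only [encode_div _ (hpM _ hb0), encode_mod _ (hpM _ hb0), encode_div _ hlc,
              encode_mod _ hlc, encode_div _ hj', encode_mod _ hj']
      · rw [if_neg hij, if_neg hij, zero_mul, ZMod.val_zero]
  · intro reg hreg hR
    have h21' : reg 21 = 2 * A := by rw [hreg 21 (by decide) (by decide), h21]
    simp only [walkExpr, cost_add, cost_mul, cost_load, cost_mod, cost_curIdx,
      cost_var, cost_xsum, cost_op, cost_div, cost_ofNat, cost_entry, cost_sub, cost_curPos,
      cost_conv, cost_xor, cost_listedExpr, hR.reg_D, hR.reg_K, h21']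
    have hB : 1 ≤ 2 * A := by omega
    have hz : 1 ≤ k + 2 := by omega
    generalize 2 * A = B at hB ⊢
    generalize k + 2 = z at hz ⊢
    have l1 : z * B ≤ z * B * B := Nat.le_mul_of_pos_right _ hB
    have l2 : z ≤ z * B := Nat.le_mul_of_pos_right _ hB
    linarith [Nat.zero_le (z * B * B * (D * D)), Nat.zero_le (z * B * B * D)]

end Walks

end WordRAM

/-! ### Reading off the answer, and the complete query program. -/

namespace WordRAM

open WordRAM.Expr
open scoped Polynomial

section Answer

variable {w : ℕ} {ω : ℕ → Bool} {β n k m q D : ℕ} {σ : State} {sd : ℕ → Bool}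
  {g h : ℕ → ℕ → Bool} {x : ℕ → ℕ → (ZMod 2)[X]}

/-- Whether one of the coefficients up to the current one is nonzero. -/
def ansExpr : Expr :=
  .op .or ((1 - .op .eq (.var 14) 0) * .load (.work 7) (.var 14 - 1))
    (.xsum 100 7 (entry (.work 6) ((.var 100 * .var 8 + (.var 1 + 1)) * .var 21 + (.var 21 - 2))
      (.var 14)))

def answer : Cmd :=
  .seq (table (.work 7) (.var 5) ansExpr) (assign 0 (.load (.work 7) (.var 5 - 1)))

/-- The entry for exponent `k + 1` at the sink, summed over all `X`, is the walk polynomial. A table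
of prefix disjunctions of its coefficients ends with the answer, since the degree is below `D`. -/
theorem reach_answer (hβ : 1 ≤ β) (hσ : Bounded β σ) (hP : Params n k m q D σ.reg)
    (hw : β * 1000 ≤ w) (hDβ : D < 2 ^ β) {A : ℕ} (hA : 0 < A) (h21 : σ.reg 21 = 2 * A)
    {f : ℕ → ℕ} (hf : f (A - 1) = n + 1)
    (hT : HasTable D (2 ^ m * (k + 2) * (2 * A))
        (fun a => powW (edgeW n k m sd h x (a / (2 * A) / (k + 2))) (2 * (n + 2))
          (a / (2 * A) % (k + 2)) (2 * n) (listed f (a % (2 * A)))) (σ.mem (.work 6)))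
    (hdeg : (walkPoly n k m sd h x).natDegree < D) :
    ∃ σ', Reach w ω answer σ (D * (200 * (2 ^ m + 1)) + 30) σ' ∧
      (σ'.reg 0 ≠ 0 ↔ walkPoly n k m sd h x ≠ 0) := by
  classical
  have hsz : ∀ s, s ≤ 1000 → β * s ≤ w := fun s hs => (Nat.mul_le_mul_left _ hs).trans hw
  have hβ2 : 2 ≤ 2 ^ β := by simpa using Nat.pow_le_pow_right (n := 2) (by norm_num) hβ
  have hbit : ∀ b : Bool, b.toNat < 2 ^ β := fun b => (Bool.toNat_lt b).trans_le hβ2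
  set W := walkPoly n k m sd h x with hW
  let val : ℕ → ℕ := fun t => (decide (∃ d ≤ t, W.coeff d ≠ 0)).toNat
  have hval : ∀ t, val t < 2 ^ β := fun t => hbit _
  have r1 := reach_table (w := w) (ω := ω) (A := .work 7) (sz := .var 5) (e := ansExpr)
    (val := val) (N := D) (C := 100 * (2 ^ m + 1)) hβ hσ rfl rfl (hsz _ (by decide))
    (hsz _ (by decide)) (by simp [hP.reg_D]) hDβ (fun t _ => hval t) (fun t ht => ?_)
    (fun t _ => ?_)
  · have b1 := (((hσ.setReg (r := 9) hDβ).fillMem (A := .work 7) (N := D) fun t _ => hval t).setReg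
      (r := 14) hDβ)
    set τ := (((σ.setReg 9 D).fillMem (.work 7) val D).setReg 14 D) with hτ
    have r2 := reach_assign (w := w) (ω := ω) (r := 0) (e := .load (.work 7) (.var 5 - 1)) hβ b1 rfl
      (hsz _ (by decide))
    refine ⟨_, (r1.seq r2).mono ?_, ?_⟩
    · have : D * (100 * (2 ^ m + 1) + 6) ≤ D * (200 * (2 ^ m + 1)) :=
        Nat.mul_le_mul_left _ (by linarith [Nat.two_pow_pos m])
      simp only [cost_var, cost_load, cost_sub, cost_ofNat]; omega
    · have h5 : τ.reg 5 = D := by simpa [hτ] using hP.reg_D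
      have h7 : τ.mem (.work 7) (D - 1) = val (D - 1) := by
        simp only [hτ, State.fillMem, State.setReg_mem, Function.update_self]
        rw [if_pos (by omega)]
      simp only [State.setReg_reg, Function.update_self, eval_load, eval_sub, eval_var, eval_ofNat,
        h5, h7, val]
      rw [ne_eq, Bool.toNat_eq_zero, Bool.not_eq_false, decide_eq_true_eq]
      constructor
      · rintro ⟨d, -, hd⟩ h0
        rw [h0, Polynomial.coeff_zero] at hd
        exact hd rfl
      · intro hne
        exact ⟨W.natDegree, by omega, by simpa using hne⟩
  · set reg := Function.update (Function.update σ.reg 9 D) 14 t with hreg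
    set mem := (σ.fillMem (.work 7) val t).mem with hmem
    have hr : ∀ r, r ≠ 9 → r ≠ 14 → reg r = σ.reg r := fun r h9 h14 => by
      rw [hreg, Function.update_of_ne h14, Function.update_of_ne h9]
    have hR := hP.congr fun r hr9 => hr r (by omega) (by omega)
    have h14 : reg 14 = t := by simp [hreg]
    have h6 : mem (.work 6) = σ.mem (.work 6) := by simp [hmem, State.fillMem]
    have h7 : 0 < t → mem (.work 7) (t - 1) = val (t - 1) := fun ht0 => by
      simp only [hmem, State.fillMem, Function.update_self]
      rw [if_pos (by omega)]
    have e1 : (xsum 100 7 (entry (.work 6) ((.var 100 * .var 8 + (.var 1 + 1)) * .var 21 +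
        (.var 21 - 2)) (.var 14))).eval mem reg = (W.coeff t).val := by
      rw [hW, walkPoly, Polynomial.finsetSum_coeff]
      refine eval_xsum_val hR.reg_P fun X hX => ?_
      have f1 : ∀ r, r ≠ 100 → Function.update reg 100 X r = reg r := fun r hr =>
        Function.update_of_ne hr _ _
      have hb : 2 * A - 2 < 2 * A := by omega
      rw [eval_entry (D := D) (by rw [f1 5 (by decide), hR.reg_D]) (h6 ▸ hT)
        (i₀ := (X * (k + 2) + (k + 1)) * (2 * A) + (2 * A - 2))
        (by simp only [eval_add, eval_mul, eval_sub, eval_var, eval_ofNat, Function.update_self,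
              f1 8 (by decide), f1 1 (by decide), f1 21 (by decide), hR.reg_K, hR.reg_k,
              hr 21 (by decide) (by decide), h21])
        (encode_lt (encode_lt hX (by omega)) hb) (d₀ := t)
        (by rw [eval_var, f1 14 (by decide), h14]) ht]
      simp only [encode_div _ hb, encode_mod _ hb, encode_div _ (show k + 1 < k + 2 by omega),
        encode_mod _ (show k + 1 < k + 2 by omega)]
      -- The sink is the last listed vertex, and its first copy is the listed state `2 * A - 2`.
      rw [show listed f (2 * A - 2) = 2 * (n + 1) by
        rw [listed, show (2 * A - 2) / 2 = A - 1 by omega, hf]; omega]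
    rw [ansExpr, eval_or, e1]
    simp only [eval_mul, eval_sub, eval_eq, eval_var, eval_ofNat, eval_load, h14]
    have hbitc : (W.coeff t).val = (decide (W.coeff t ≠ 0)).toNat := by
      generalize W.coeff t = c
      revert c; decide
    have hex : (∃ d ≤ t, W.coeff d ≠ 0) ↔ (0 < t ∧ ∃ d ≤ t - 1, W.coeff d ≠ 0) ∨ W.coeff t ≠ 0 := by
      constructor
      · rintro ⟨d, hd, hne⟩
        rcases hd.lt_or_eq with h | rfl
        · exact .inl ⟨by omega, d, by omega, hne⟩
        · exact .inr hne
      · rintro (⟨_, d, hd, hne⟩ | hne)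
        · exact ⟨d, by omega, hne⟩
        · exact ⟨t, le_rfl, hne⟩
    rcases Nat.eq_zero_or_pos t with rfl | ht0
    · simp only [if_true, Nat.sub_self, zero_mul, Nat.zero_or, hbitc, val]
      simp
    · rw [if_neg ht0.ne', Nat.sub_zero, one_mul, h7 ht0, hbitc]
      simp only [val, toNat_or]
      congr 1
      rw [← Bool.decide_or]
      exact decide_eq_decide.2 (by rw [hex]; simp [ht0])
  · simp only [ansExpr, cost_add, cost_mul, cost_load, cost_var, cost_xsum, cost_op, cost_ofNat,
      cost_entry, cost_sub]
    have h7 : Function.update (Function.update σ.reg 9 D) 14 t 7 = 2 ^ m := by simpa using hP.reg_P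
    rw [h7]; omega

/-- The query. -/
def query (E : ℕ) : Cmd :=
  .seq (.op .and 35 0 0) (.seq (.const 0 0) (.seq (assign 0 (.load (.data 0) 0))
    (.seq (assign 1 (.load (.data 0) 1)) (.seq (setup E) (.seq (forLoop 36 35 vis scanStep)
    (.seq (put (.work 4) (.var 16) (.var 0 + 1)) (.seq (assign 21 (2 * .var 16 + 2))
    (.seq (table (.work 6) (.var 7 * .var 8 * .var 21 * .var 5) walkExpr) answer))))))))

theorem query_readOnly (E : ℕ) : (query E).DataReadOnly := by
  have h : ∀ j sz e, (table (.work j) sz e).DataReadOnly := fun j sz e =>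
    ⟨readOnly_assign _ _, readOnly_fill _ _ _ _⟩
  have ht : touch.DataReadOnly := ⟨readOnly_put _ _ _, readOnly_assign _ _, readOnly_put _ _ _⟩
  have hg : toggle.DataReadOnly := ⟨readOnly_assign _ _, readOnly_put _ _ _, readOnly_put _ _ _⟩
  have hs : scanStep.DataReadOnly := ⟨trivial, trivial, trivial, hg, trivial, ht, trivial, ht⟩
  exact ⟨trivial, trivial, readOnly_assign _ _, readOnly_assign _ _,
    ⟨readOnly_assign _ _, readOnly_assign _ _, readOnly_assign _ _, readOnly_assign _ _,
      readOnly_assign _ _, readOnly_assign _ _, trivial, trivial⟩,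
    readOnly_forLoop hs, readOnly_put _ _ _, readOnly_assign _ _, h _ _ _, h _ _ _,
    readOnly_assign _ _⟩

theorem bounded_queryState (hβ : 1 ≤ β) (hσ : Bounded β σ) (L : List (EdgeUpdate n))
    (hn : n < 2 ^ β) (A : Arr) (i : ℕ) :
    (SensitivityOracle.queryState σ L).mem A i < 2 ^ β := by
  have hβ2 : 2 ≤ 2 ^ β := by simpa using Nat.pow_le_pow_right (n := 2) (by norm_num) hβ
  simp only [SensitivityOracle.queryState]
  split
  · exact hσ.mem _ _
  · split <;> [split_ifs <;> omega; omega]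
  · split <;> [exact (Fin.is_lt _).trans hn; omega]
  · split <;> [exact (Fin.is_lt _).trans hn; omega]
  · omega

/-- Scanning leaves at most twice as many listed vertices as updates; the sink is appended, and the
walk table dominates the time. No coins are used, so the answer is determined by the coins of the
preprocessing. -/
theorem reach_query {E : ℕ} (hβ : 1 ≤ β) (hσ : Bounded β σ) (G : SimpleGraph (Fin n))
    (L : List (EdgeUpdate n)) (hL : L.length < 2 ^ w)
    (hm : m = (k + 1) / 2) (hq : q = k + E) (hD : D = (2 * k + 2) * (k + E) + 1)
    (h2 : 2 ^ m * (k + 2) * (2 * (n + 2)) * (2 * (n + 2)) * D < 2 ^ β) (h3 : k + E + 2 < 2 ^ β)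
    (hw : β * (E + 1000) ≤ w) (hS : Stored n k m D sd (adjB G) x σ.mem)
    (hdeg : (walkPoly n k m sd (adjB (applyUpdates G L)) x).natDegree < D) :
    ∃ σ', Reach w ω (query E) (SensitivityOracle.queryState σ L)
        (217000 * (max L.length 1 ^ 3 * (2 ^ m * (k + 2) ^ 2 * (D + 1) ^ 3))) σ' ∧
      (σ'.reg 0 ≠ 0 ↔ walkPoly n k m sd (adjB (applyUpdates G L)) x ≠ 0) := by
  have hw' : β * 1000 ≤ w := (Nat.mul_le_mul_left _ (by omega)).trans hw
  have hsz : ∀ s, s ≤ 1000 → β * s ≤ w := fun s hs => (Nat.mul_le_mul_left _ hs).trans hw'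
  have hD1 : 1 ≤ D := by omega
  have hP1 : 1 ≤ 2 ^ m := Nat.one_le_two_pow
  have c1 : 2 ^ m * (k + 2) * (2 * (n + 2)) * D < 2 ^ β := by
    refine lt_of_le_of_lt (Nat.mul_le_mul_right _ ?_) h2
    exact Nat.le_mul_of_pos_right _ (by omega)
  have c2 : 2 * (n + 2) < 2 ^ β := by
    refine lt_of_le_of_lt ?_ c1
    calc 2 * (n + 2) ≤ 2 ^ m * (k + 2) * (2 * (n + 2)) := Nat.le_mul_of_pos_left _ (by positivity)
      _ ≤ _ := Nat.le_mul_of_pos_right _ hD1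
  have c3 : D < 2 ^ β := lt_of_le_of_lt (Nat.le_mul_of_pos_left _ (by positivity)) c1
  have c4 : 2 ^ m < 2 ^ β := by
    refine lt_of_le_of_lt ?_ c1
    rw [mul_assoc, mul_assoc]
    exact Nat.le_mul_of_pos_right _ (by positivity)
  set σ₀ := SensitivityOracle.queryState σ L with hσ₀
  have hmem0 : ∀ A i, σ₀.mem A i < 2 ^ β := bounded_queryState hβ hσ L (by omega)
  -- The number of updates need not fit into `β` bits, so it is moved above `glob` and register `0`
  -- is cleared before any expression is evaluated.
  have r1 := reach_op (w := w) (ω := ω) (σ := σ₀) (o := .and) (r := 35) (a := 0) (b := 0)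
    (by norm_num) (by norm_num)
  have hv : Op.eval w .and (σ₀.reg 0) (σ₀.reg 0) = L.length := by
    change (L.length &&& L.length) % 2 ^ w = _
    rw [Nat.and_self, Nat.mod_eq_of_lt hL]
  rw [hv] at r1
  have r2 := reach_const (w := w) (ω := ω) (σ := σ₀.setReg 35 L.length) (r := 0) (c := 0)
  rw [Nat.zero_mod] at r2
  have hreg0 : ∀ r, r ≠ 35 → ((σ₀.setReg 35 L.length).setReg 0 0).reg r = 0 := fun r hr => by
    simp only [State.setReg_reg, Function.update_apply, hr, if_false]
    split_ifs with h
    · rfl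
    · exact if_neg h
  have b2 : Bounded β ((σ₀.setReg 35 L.length).setReg 0 0) :=
    ⟨fun r hr => by rw [hreg0 r (by omega)]; positivity, hmem0⟩
  obtain ⟨r3, b3⟩ := reach_assign_val (w := w) (ω := ω) (r := 0) (e := .load (.data 0) 0) (x := n)
    hβ b2 rfl (hsz _ (by decide)) (by
      simp only [eval_load, eval_ofNat, State.setReg_mem]; exact hS.size) (by omega)
  obtain ⟨r4, b4⟩ := reach_assign_val (w := w) (ω := ω) (r := 1) (e := .load (.data 0) 1) (x := k)
    hβ b3 rfl (hsz _ (by decide)) (by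
      simp only [eval_load, eval_ofNat, State.setReg_mem]; exact hS.length) (by omega)
  set σ₄ := (((σ₀.setReg 35 L.length).setReg 0 0).setReg 0 n).setReg 1 k with hσ₄
  obtain ⟨σ₅, r5, b5, p5, m5, -, g5⟩ := reach_setup (w := w) (ω := ω) (E := E) (n := n) (k := k)
    hβ b4 ((Nat.mul_le_mul_left _ (by omega)).trans hw) (by simp [hσ₄]) (by simp [hσ₄]) c2
    (by rw [← hD]; exact c3) h3 (by rw [← hm]; exact c4)
  rw [← hm, ← hD, ← hq] at p5
  have m5' : σ₅.mem = σ₀.mem := m5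
  obtain ⟨σ₆, r6, b6, p6, m6, d6, l6⟩ := reach_scan (ω := ω) hβ b5 hw' (by omega) p5 G L hL
    (by rw [g5 35 (by decide)]; simp [hσ₄])
    (by
      rw [g5 16 (by decide)]
      simpa [hσ₄] using hreg0 16 (by decide))
    (fun i => by rw [m5']; rfl) (fun i => by rw [m5']; rfl)
    (fun i hi => by
      rw [m5']
      simp only [hσ₀, SensitivityOracle.queryState, List.getElem?_eq_getElem hi]
      refine ⟨?_, trivial, trivial⟩
      cases (L[i]).insert <;> rfl)
    (fun u hu v hv => by
      rw [m5']
      have hu1 : u ≠ n := by omega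
      have hv1 : v ≠ n + 1 := by omega
      refine (hS.adj u (by omega) v (by omega)).trans ?_
      simp [extAdj, hu, hv, beq_eq_false_iff_ne.2 hu1, beq_eq_false_iff_ne.2 hv1])
  set c := σ₆.reg 16 with hc
  have hcn := d6.marks.le
  rw [← hc] at hcn
  -- The sink `n + 1` is written behind the touched vertices. These are all less than `n`, so the
  -- list stays free of repetitions.
  have r7 := reach_put (w := w) (ω := ω) (A := .work 4) (a := .var 16) (e := .var 0 + 1) hβ b6 rfl
    rfl (hsz _ (by decide)) (hsz _ (by decide))
  simp only [eval_var, eval_add, eval_ofNat, p6.reg_n, ← hc, cost_var, cost_add, cost_ofNat] at r7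
  have b7 := b6.setMem (A := .work 4) (i := c) (x := n + 1) (by omega)
  set σ₇ := σ₆.setMem (.work 4) c (n + 1) with hσ₇
  obtain ⟨r8, b8⟩ := reach_assign_val (w := w) (ω := ω) (r := 21) (e := 2 * .var 16 + 2)
    (x := 2 * (c + 1)) hβ b7 rfl (hsz _ (by decide)) (by simp [hσ₇, ← hc]; ring) (by omega)
  have m7 : ∀ B ≠ .work 4, (σ₇.setReg 21 (2 * (c + 1))).mem B = σ₆.mem B := fun B hB => by
    simp [hσ₇, State.setMem, Function.update_of_ne hB]
  have l7 : (σ₇.setReg 21 (2 * (c + 1))).mem (.work 4) =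
      Function.update (σ₆.mem (.work 4)) c (n + 1) := by
    simp [hσ₇, State.setMem]
  have hl : ∀ t < c, Function.update (σ₆.mem (.work 4)) c (n + 1) t = σ₆.mem (.work 4) t :=
    fun t ht => Function.update_of_ne ht.ne _ _
  have hl' : Function.update (σ₆.mem (.work 4)) c (n + 1) c = n + 1 := Function.update_self _ _ _
  have p8 : Params n k m q D (σ₇.setReg 21 (2 * (c + 1))).reg := p6.congr fun r hr => by
    simp [hσ₇, Function.update_of_ne (show r ≠ 21 by omega)]
  have hkeep : ∀ j, (σ₇.setReg 21 (2 * (c + 1))).mem (.data j) = σ.mem (.data j) := fun j => by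
    rw [m7 _ (by simp), m6 _ (by simp) (by simp) (by simp), m5']
    rfl
  have hS8 : Stored n k m D sd (adjB G) x (σ₇.setReg 21 (2 * (c + 1))).mem := by
    constructor
    · rw [hkeep]; exact hS.size
    · rw [hkeep]; exact hS.length
    · rw [hkeep]; exact hS.adj
    · rw [hkeep]; exact hS.step
    · rw [hkeep]; exact hS.pow
  obtain ⟨σ₉, r9, b9, t9, -, -, g9⟩ := reach_walkTable (ω := ω) (sd := sd) (g := adjB G)
    (h := adjB (applyUpdates G L)) (x := x) hβ b8 p8 hw' (A := c + 1) (by omega) (by simp)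
    (lt_of_le_of_lt (by gcongr; omega) c1) hS8 (fun u v => adjB_lt) (fun u v => adjB_lt)
    (by rw [m7 _ (by decide)]; exact d6.flip)
    (fun t ht => by
      rw [l7]
      rcases Nat.lt_succ_iff_lt_or_eq.1 ht with ht | rfl
      · have := d6.marks.lt t ht
        rw [hl t ht]; omega
      · rw [hl']; omega)
    (fun s hs t ht hst => by
      rw [l7] at hst
      rcases Nat.lt_succ_iff_lt_or_eq.1 hs with hs | rfl <;>
        rcases Nat.lt_succ_iff_lt_or_eq.1 ht with ht | rfl
      · rw [hl s hs, hl t ht] at hst; exact d6.marks.inj s hs t ht hst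
      · have := d6.marks.lt s hs
        rw [hl s hs, hl'] at hst; omega
      · have := d6.marks.lt t ht
        rw [hl t ht, hl'] at hst; omega
      · rfl)
    (fun u v huv => by
      rw [l7]
      obtain ⟨⟨s, hs, h⟩, ⟨t, ht, h'⟩⟩ := d6.touched u v huv
      exact ⟨⟨s, by omega, by rw [hl s hs, h]⟩, ⟨t, by omega, by rw [hl t ht, h']⟩⟩)
  have p9 : Params n k m q D σ₉.reg := p8.congr fun r hr => g9 r (by omega) (by omega)
  obtain ⟨σ', r10, hans⟩ := reach_answer (ω := ω) (sd := sd) (h := adjB (applyUpdates G L)) (x := x)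
    hβ b9 p9 hw' c3 (A := c + 1) (by omega) (by rw [g9 21 (by decide) (by decide)]; simp)
    (by rw [l7]; exact hl') t9 hdeg
  refine ⟨σ', (r1.seq (r2.seq (r3.seq (r4.seq (r5.seq (r6.seq (r7.seq (r8.seq
    (r9.seq r10))))))))).mono ?_, hans⟩
  simp only [cost_load, cost_ofNat, cost_var, cost_add, cost_mul]
  set l := max L.length 1 with hl
  have hl1 : 1 ≤ l := le_max_right _ _
  have hlL : L.length ≤ l := le_max_left _ _
  -- At most `2 * l` touched vertices and the sink, with two states each. The cube of this bound
  -- together with the factor `1000` gives the constant `216000` below.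
  have hA : 2 * (c + 1) ≤ 6 * l := by omega
  set U := l ^ 3 * (2 ^ m * (k + 2) ^ 2 * (D + 1) ^ 3) with hU
  have u1 : 2 ^ m * (k + 2) * (2 * (c + 1)) * D *
      (1000 * ((k + 2) * (2 * (c + 1)) * (2 * (c + 1)) * ((D + 1) * (D + 1)))) ≤ 216000 * U := by
    calc _ ≤ 2 ^ m * (k + 2) * (6 * l) * (D + 1) *
          (1000 * ((k + 2) * (6 * l) * (6 * l) * ((D + 1) * (D + 1)))) := by
          gcongr; omega
      _ = 216000 * U := by rw [hU]; ring
  have u2 : D * (200 * (2 ^ m + 1)) ≤ 400 * U := by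
    calc D * (200 * (2 ^ m + 1)) ≤ (D + 1) * (200 * (2 ^ m + 2 ^ m)) := by gcongr; omega
      _ = 400 * (1 * ((D + 1) * 2 ^ m)) := by ring
      _ ≤ 400 * ((l ^ 3 * (k + 2) ^ 2 * (D + 1) ^ 2) * ((D + 1) * 2 ^ m)) := by
          gcongr
          have : 0 < l ^ 3 * (k + 2) ^ 2 * (D + 1) ^ 2 := by positivity
          omega
      _ = 400 * U := by rw [hU]; ring
  have u3 : l ≤ U := by
    calc l = l * 1 := (mul_one l).symm
      _ ≤ l * (l ^ 2 * (2 ^ m * (k + 2) ^ 2 * (D + 1) ^ 3)) := by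
          gcongr
          have : 0 < l ^ 2 * (2 ^ m * (k + 2) ^ 2 * (D + 1) ^ 3) := by positivity
          omega
      _ = U := by rw [hU]; ring
  omega

end Answer

end WordRAM

/-! ### Choice of constants and the main theorem. -/

section Main

open WordRAM SensitivityOracle

/-- The degree `2 * k + 2` is at most `2 * 2 ^ k`, so `k` of the `k + E` random bits absorb it and
`E` depends on `ε` alone. -/
theorem exists_error_exponent {ε : ℝ} (hε : 0 < ε) :
    ∃ E : ℕ, ∀ k : ℕ, ((2 * k + 2 : ℕ) : ENNReal) * (2⁻¹ : ENNReal) ^ (k + E) ≤ ENNReal.ofReal ε := by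
  obtain ⟨E, hE⟩ := exists_pow_lt_of_lt_one (half_pos hε) (show (2⁻¹ : ℝ) < 1 by norm_num)
  refine ⟨E, fun k => ?_⟩
  have h1 : ((2 * k + 2 : ℕ) : ℝ) * (2⁻¹ : ℝ) ^ (k + E) ≤ ε := by
    have h2 : ((2 * k + 2 : ℕ) : ℝ) ≤ 2 * 2 ^ k := by
      have : 2 * k + 2 ≤ 2 * 2 ^ k := by have := @Nat.lt_two_pow_self k; omega
      exact_mod_cast this
    calc ((2 * k + 2 : ℕ) : ℝ) * (2⁻¹ : ℝ) ^ (k + E)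
        ≤ (2 * 2 ^ k) * (2⁻¹ : ℝ) ^ (k + E) := by gcongr
      _ = 2 * (2⁻¹ : ℝ) ^ E := by
          rw [pow_add, inv_pow, inv_pow]; field_simp
      _ ≤ ε := by linarith
  have h3 : ((2 * k + 2 : ℕ) : ENNReal) * (2⁻¹ : ENNReal) ^ (k + E) =
      ENNReal.ofReal (((2 * k + 2 : ℕ) : ℝ) * (2⁻¹ : ℝ) ^ (k + E)) := by
    rw [ENNReal.ofReal_mul (by positivity), ENNReal.ofReal_natCast, ENNReal.ofReal_pow (by norm_num),
      ENNReal.ofReal_inv_of_pos (by norm_num), ENNReal.ofReal_ofNat]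
  rw [h3]
  exact ENNReal.ofReal_le_ofReal h1

/-- All table sizes fit into `(E + 20) * (k + log n + 1)` bits. -/
theorem sizes_lt (E n k : ℕ) :
    (n + 2 + (k + 1) / 2) * (n + 2) * ((2 * k + 2) * (k + E) + 1) <
      2 ^ ((E + 20) * (k + Nat.log 2 n + 1)) ∧
    2 ^ ((k + 1) / 2) * (k + 2) * (2 * (n + 2)) * (2 * (n + 2)) * ((2 * k + 2) * (k + E) + 1) <
      2 ^ ((E + 20) * (k + Nat.log 2 n + 1)) ∧
    k + E + 2 < 2 ^ ((E + 20) * (k + Nat.log 2 n + 1)) := by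
  set l := k + Nat.log 2 n + 1 with hl
  have hn : n < 2 ^ l :=
    (Nat.lt_pow_succ_log_self (by norm_num) n).trans_le (Nat.pow_le_pow_right (by norm_num) (by omega))
  have hk : 2 * 2 ^ k ≤ 2 ^ l := by
    rw [← pow_succ']; exact Nat.pow_le_pow_right (by norm_num) (by omega)
  have hk' := @Nat.lt_two_pow_self k
  have hm : 2 ^ ((k + 1) / 2) ≤ 2 ^ l := Nat.pow_le_pow_right (by norm_num) (by omega)
  have hm' := @Nat.lt_two_pow_self ((k + 1) / 2)
  have hkE : k + E ≤ 2 ^ (l * (E + 1)) := by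
    refine (@Nat.lt_two_pow_self (k + E)).le.trans (Nat.pow_le_pow_right (by norm_num) ?_)
    nlinarith
  rw [pow_mul] at hkE
  have hpow : 2 ^ ((E + 20) * l) = (2 ^ l) ^ (E + 20) := by rw [mul_comm, pow_mul]
  rw [hpow]
  have h2 : 2 ≤ 2 ^ l := by
    calc 2 = 2 ^ 1 := rfl
      _ ≤ 2 ^ l := Nat.pow_le_pow_right (by norm_num) (by omega)
  clear_value l
  clear hl hpow
  generalize 2 ^ l = Z at *
  have z2 : 2 * Z ≤ Z ^ 2 := by rw [pow_two]; exact Nat.mul_le_mul_right _ h2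
  have z3 : 2 * Z ^ 2 ≤ Z ^ 3 := by rw [pow_succ' Z 2]; exact Nat.mul_le_mul_right _ h2
  have z4 : 2 * Z ^ 3 ≤ Z ^ 4 := by rw [pow_succ' Z 3]; exact Nat.mul_le_mul_right _ h2
  have hE1 : 1 ≤ Z ^ (E + 1) := Nat.one_le_pow _ _ (by omega)
  have hD : (2 * k + 2) * (k + E) + 1 ≤ Z ^ (E + 4) := by
    calc (2 * k + 2) * (k + E) + 1 ≤ Z * Z ^ (E + 1) + Z * Z ^ (E + 1) := by
          gcongr
          · omega
          · exact Nat.mul_pos (by omega) hE1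
      _ = 2 * Z ^ (E + 2) := by ring
      _ ≤ Z * Z ^ (E + 2) := Nat.mul_le_mul_right _ h2
      _ = Z ^ (E + 3) := by ring
      _ ≤ Z ^ (E + 4) := Nat.pow_le_pow_right (by omega) (by omega)
  have b₁ : n + 2 + (k + 1) / 2 ≤ Z ^ 3 := by omega
  have b₂ : n + 2 ≤ Z ^ 2 := by omega
  have b₃ : k + 2 ≤ Z ^ 2 := by omega
  have b₄ : 2 * (n + 2) ≤ Z ^ 3 := by omega
  have hlt : ∀ i, i < E + 20 → Z ^ i < Z ^ (E + 20) := fun i hi =>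
    Nat.pow_lt_pow_right (by omega) hi
  refine ⟨?_, ?_, ?_⟩
  · calc (n + 2 + (k + 1) / 2) * (n + 2) * ((2 * k + 2) * (k + E) + 1)
        ≤ Z ^ 3 * Z ^ 2 * Z ^ (E + 4) :=
          Nat.mul_le_mul (Nat.mul_le_mul b₁ b₂) hD
      _ = Z ^ (E + 9) := by ring
      _ < Z ^ (E + 20) := hlt _ (by omega)
  · calc 2 ^ ((k + 1) / 2) * (k + 2) * (2 * (n + 2)) * (2 * (n + 2)) * ((2 * k + 2) * (k + E) + 1)
        ≤ Z * Z ^ 2 * Z ^ 3 * Z ^ 3 * Z ^ (E + 4) :=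
          Nat.mul_le_mul (Nat.mul_le_mul (Nat.mul_le_mul (Nat.mul_le_mul hm b₃) b₄) b₄) hD
      _ = Z ^ (E + 13) := by ring
      _ < Z ^ (E + 20) := hlt _ (by omega)
  · calc k + E + 2 ≤ Z ^ (E + 1) + 2 * Z ^ (E + 1) := by omega
      _ = 3 * Z ^ (E + 1) := by ring
      _ ≤ Z ^ 2 * Z ^ (E + 1) := by gcongr; nlinarith
      _ = Z ^ (E + 3) := by ring
      _ < Z ^ (E + 20) := hlt _ (by omega)

theorem queryState_congr {n : ℕ} {σ τ : State} (h : Sim σ τ) (L : List (EdgeUpdate n)) :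
    queryState σ L = queryState τ L := by
  unfold queryState
  rw [h.2.1, h.2.2]

/-- The oracle with error exponent `E`. -/
def pathOracle (E : ℕ) : SensitivityOracle := ⟨preprocess E, query E, query_readOnly E⟩

/-- For every outcome `ω` the oracle halts in time and decides exactly whether the evaluated walk
polynomial is nonzero; probability enters only afterwards. -/
theorem pathOracle_spec {E n k w : ℕ} (hw : (E + 20) * (E + 1000) * (k + Nat.log 2 n + 1) ≤ w)
    (ω : ℕ → Bool) (G : SimpleGraph (Fin n)) (S : Finset (Fin n)) :
    ∃ t σ, Exec w ω (pathOracle E).preprocess (inputState k G S) t σ ∧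
      t ≤ 3000 * (2 ^ ((k + 1) / 2) * (k + 2) * (2 * (n + 2)) ^ 3 *
        (((2 * k + 2) * (k + E) + 1) * ((2 * k + 2) * (k + E) + 1 + 1))) ∧
      ∀ L : List (EdgeUpdate n), L.length < 2 ^ w →
        ∃ t' τ, Exec w ω (pathOracle E).query (queryState σ L) t' τ ∧
          t' ≤ 217000 * (max L.length 1 ^ 3 * (2 ^ ((k + 1) / 2) * (k + 2) ^ 2 *
            ((2 * k + 2) * (k + E) + 1 + 1) ^ 3)) ∧
          (τ.reg 0 ≠ 0 ↔ walkPoly n k ((k + 1) / 2) (sideB S) (adjB (applyUpdates G L))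
            (randVar n ((k + 1) / 2) (k + E) ((2 * k + 2) * (k + E) + 1) ω) ≠ 0) := by
  obtain ⟨h1, h2, h3⟩ := sizes_lt E n k
  have hβ : 1 ≤ (E + 20) * (k + Nat.log 2 n + 1) := Nat.mul_pos (by omega) (by omega)
  have hw' : (E + 20) * (k + Nat.log 2 n + 1) * (E + 1000) ≤ w := by
    rwa [mul_right_comm]
  obtain ⟨σ', hr, hb, hS⟩ := reach_preprocess (ω := ω) hβ G S rfl rfl rfl h1 h2 h3 hw'
  obtain ⟨t, σ, he, ht, hs⟩ := hr _ (Sim.refl _)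
  refine ⟨t, σ, he, ht, fun L hL => ?_⟩
  obtain ⟨τ', hr', hans⟩ := reach_query (ω := ω) hβ hb G L hL rfl rfl rfl h2 h3 hw' hS
    (Nat.lt_succ_of_le (natDegree_walkPoly_randVar _ _ _ _ _ _ _))
  obtain ⟨t', τ, he', ht', hs'⟩ := hr' _ (Sim.refl _)
  rw [queryState_congr hs L]
  exact ⟨t', τ, he', ht', by rw [hs'.1 0 (by norm_num)]; exact hans⟩

/-- Rounding `k / 2` up costs at most a factor of two. -/
theorem two_pow_half_le (k : ℕ) : ((2 ^ ((k + 1) / 2) : ℕ) : ℝ) ≤ 2 * (2 : ℝ) ^ ((k : ℝ) / 2) := by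
  have h : (((k + 1) / 2 : ℕ) : ℝ) ≤ 1 + (k : ℝ) / 2 := by
    have : 2 * ((k + 1) / 2) ≤ k + 1 := by omega
    have : (2 : ℝ) * (((k + 1) / 2 : ℕ) : ℝ) ≤ k + 1 := by exact_mod_cast this
    linarith
  calc ((2 ^ ((k + 1) / 2) : ℕ) : ℝ) = (2 : ℝ) ^ ((((k + 1) / 2 : ℕ) : ℝ)) := by
        rw [Real.rpow_natCast]; push_cast; rfl
    _ ≤ (2 : ℝ) ^ (1 + (k : ℝ) / 2) := Real.rpow_le_rpow_of_exponent_le (by norm_num) h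
    _ = 2 * (2 : ℝ) ^ ((k : ℝ) / 2) := by rw [Real.rpow_add (by norm_num), Real.rpow_one]

theorem le_two_pow_half_mul {t N C k : ℕ} {x : ℝ} (h : t ≤ 2 ^ ((k + 1) / 2) * N)
    (hN : 2 * (N : ℝ) ≤ C * x) : (t : ℝ) ≤ (2 : ℝ) ^ ((k : ℝ) / 2) * C * x := by
  have h1 : (t : ℝ) ≤ ((2 ^ ((k + 1) / 2) : ℕ) : ℝ) * N := by exact_mod_cast h
  calc (t : ℝ) ≤ ((2 ^ ((k + 1) / 2) : ℕ) : ℝ) * N := h1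
    _ ≤ 2 * (2 : ℝ) ^ ((k : ℝ) / 2) * N := by gcongr; exact two_pow_half_le k
    _ = (2 : ℝ) ^ ((k : ℝ) / 2) * (2 * N) := by ring
    _ ≤ (2 : ℝ) ^ ((k : ℝ) / 2) * (C * x) := by gcongr
    _ = _ := by ring

theorem mainTheorem5 (ε : ℝ) (hε : 0 < ε) :
    ∃ (O : SensitivityOracle) (p : Polynomial ℕ) (c : ℕ), 0 < c ∧
      ∀ n k w : ℕ, 0 < n → 0 < k → c * (k + Nat.log 2 n + 1) ≤ w →
      ∀ (S : Finset (Fin n)) (G : SimpleGraph (Fin n)),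
        G.IsBipartiteWith (S : Set (Fin n)) (S : Set (Fin n))ᶜ →
        (∀ ω : ℕ → Bool, O.PreprocessesWithin w ω k G S
          ((2 : ℝ) ^ ((k : ℝ) / 2) * (p.eval k : ℕ) * (n : ℝ) ^ 3)) ∧
        ∀ L : List (EdgeUpdate n), L.length < 2 ^ w →
          (applyUpdates G L).IsBipartiteWith (S : Set (Fin n)) (S : Set (Fin n))ᶜ →
          (∀ ω : ℕ → Bool, O.QueriesWithin w ω k G S L
            ((max L.length 1 : ℕ) ^ 3 * (2 : ℝ) ^ ((k : ℝ) / 2) * (p.eval k : ℕ))) ∧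
          WordRAM.coinMeasure {ω | ¬ O.AnswersCorrectly w ω k G S L} ≤ ENNReal.ofReal ε := by
  obtain ⟨E, hE⟩ := exists_error_exponent hε
  -- The constant is `2 * 3000 * 6 ^ 3`: a factor two for rounding `k / 2`, and `2 * (n + 2) ≤ 6 *
  -- n` for the cubic bound. It also covers `2 * 217000` for the query.
  refine ⟨pathOracle E, Polynomial.C 1296000 * (Polynomial.X + 2) ^ 2 *
    ((2 * Polynomial.X + 2) * (Polynomial.X + Polynomial.C E) + 2) ^ 3, (E + 20) * (E + 1000),
    Nat.mul_pos (by omega) (by omega), ?_⟩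
  intro n k w hn hk hw S G _
  have hp : (Polynomial.C 1296000 * (Polynomial.X + 2) ^ 2 *
      ((2 * Polynomial.X + 2) * (Polynomial.X + Polynomial.C E) + 2) ^ 3).eval k =
      1296000 * (k + 2) ^ 2 * ((2 * k + 2) * (k + E) + 1 + 1) ^ 3 := by simp
  rw [hp]
  set D := (2 * k + 2) * (k + E) + 1 with hD
  refine ⟨fun ω => ?_, fun L hL hbip => ⟨fun ω => ?_, ?_⟩⟩
  · obtain ⟨t, σ, he, ht, -⟩ := pathOracle_spec (k := k) hw ω G S
    refine ⟨t, σ, he, le_two_pow_half_mul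
      (N := 3000 * ((k + 2) * (2 * (n + 2)) ^ 3 * (D * (D + 1)))) (ht.trans_eq (by ring)) ?_⟩
    have h : 2 * (3000 * ((k + 2) * (2 * (n + 2)) ^ 3 * (D * (D + 1)))) ≤
        1296000 * (k + 2) ^ 2 * (D + 1) ^ 3 * n ^ 3 :=
      calc 2 * (3000 * ((k + 2) * (2 * (n + 2)) ^ 3 * (D * (D + 1))))
          ≤ 2 * (3000 * ((k + 2) ^ 2 * (6 * n) ^ 3 * ((D + 1) ^ 2 * (D + 1)))) := by
            have a₁ : k + 2 ≤ (k + 2) ^ 2 := Nat.le_self_pow two_ne_zero _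
            have a₂ : 2 * (n + 2) ≤ 6 * n := by omega
            have a₃ : D * (D + 1) ≤ (D + 1) ^ 2 * (D + 1) :=
              Nat.mul_le_mul_right _ ((Nat.le_succ D).trans (Nat.le_self_pow two_ne_zero _))
            exact Nat.mul_le_mul_left _ (Nat.mul_le_mul_left _ (Nat.mul_le_mul
              (Nat.mul_le_mul a₁ (Nat.pow_le_pow_left a₂ 3)) a₃))
        _ = _ := by ring
    exact_mod_cast h
  · obtain ⟨t, σ, he, -, hq⟩ := pathOracle_spec (k := k) hw ω G S
    obtain ⟨t', τ, he', ht', -⟩ := hq L hL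
    refine ⟨t, σ, t', τ, he, he', ?_⟩
    have h := le_two_pow_half_mul (k := k) (t := t')
      (N := 217000 * (max L.length 1 ^ 3 * ((k + 2) ^ 2 * (D + 1) ^ 3)))
      (C := 1296000 * (k + 2) ^ 2 * (D + 1) ^ 3) (x := (max L.length 1 : ℕ) ^ 3)
      (ht'.trans_eq (by ring)) (by
        have h : 2 * (217000 * (max L.length 1 ^ 3 * ((k + 2) ^ 2 * (D + 1) ^ 3))) ≤
            1296000 * (k + 2) ^ 2 * (D + 1) ^ 3 * max L.length 1 ^ 3 :=
          calc _ = 434000 * ((k + 2) ^ 2 * (D + 1) ^ 3 * max L.length 1 ^ 3) := by ring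
            _ ≤ 1296000 * ((k + 2) ^ 2 * (D + 1) ^ 3 * max L.length 1 ^ 3) := by gcongr; norm_num
            _ = _ := by ring
        exact_mod_cast h)
    exact h.trans_eq (by ring)
  -- The error is one-sided: a wrong answer requires that a path exists and the evaluation vanishes.
  · have hsub : ∀ ω, ¬ (pathOracle E).AnswersCorrectly w ω k G S L →
        HasKPath (applyUpdates G L) k ∧ walkPoly n k ((k + 1) / 2) (sideB S)
          (adjB (applyUpdates G L)) (randVar n ((k + 1) / 2) (k + E) D ω) = 0 := by
      intro ω hω
      obtain ⟨t, σ, he, -, hq⟩ := pathOracle_spec (k := k) hw ω G S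
      obtain ⟨t', τ, he', -, hans⟩ := hq L hL
      by_contra hcon
      refine hω ⟨t, σ, t', τ, he, he', hans.trans ⟨hasKPath_of_walkPoly_ne_zero hk hbip, ?_⟩⟩
      exact fun hpath h0 => hcon ⟨hpath, h0⟩
    by_cases hpath : HasKPath (applyUpdates G L) k
    · exact (MeasureTheory.measure_mono fun ω hω => (hsub ω hω).2).trans
        ((coinMeasure_walkPoly_eq_zero_le hk (by rw [hD]; nlinarith) hbip hpath).trans (hE k))
    · have hempty : {ω | ¬ (pathOracle E).AnswersCorrectly w ω k G S L} = ∅ :=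
        Set.eq_empty_of_forall_notMem fun ω hω => hpath (hsub ω hω).1
      rw [hempty, MeasureTheory.measure_empty]
      exact zero_le

end Main
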